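/- **Setting.** Let $T=\mathbf R^2/\mathbf Z^2$ with symplectic form $dx\,dy$ and a translation-invariant complex structure $J$ compatible with the orientation (e.g. the standard one). For an integer $m$ let $L_m\subset T$ be the image of the line through the origin of slope $-m$, oriented from left to right and equipped with the star $\star_m=(\varepsilon,-m\varepsilon)$, where $\varepsilon$ is a fixed irrational number. Let $\tau(x,y)=(x,y-x)$, and for $m\ge 1$, $\kappa\in\frac1m\mathbf Z$ let $x_{m,\kappa}=(\kappa,0)\in L_0\cap L_m$, so that $x_{m,\kappa}$ depends only on $\kappa$ modulo $1$ and $\tau^n x_{m,\kappa}\in L_n\cap L_{n+m}$. Let $C$ be a commutative ring with an automorphism $\sigma$. Let $\Lambda$ be either $C[[t]]$ with the $t$-adic topology (relative case) or the Novikov ring $\Lambda_C=\{\sum_i a_it^{\lambda_i}: a_i\in C,\ \lambda_i\in\mathbf R,\ \lambda_i\to\infty\}$ with its $t$-adic topology (absolute case); $\sigma$ acts on $\Lambda$ coefficientwise with $\sigma(t^r)=t^r$. Let $\underline\Lambda$ be the local system of rings on $T$ pulled back along $(x,y)\mapsto x$ from the sheaf on $S^1=\mathbf R/\mathbf Z$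 with étalé space $(\mathbf R\times\Lambda)/((s,c)\sim(s+1,\sigma(c)))$, and let $\nabla\gamma$ denote its parallel transport. For $m<m'$ put $\mathrm{CF}(L_m,L_{m'};\underline\Lambda)=\bigoplus_{x\in L_m\cap L_{m'}}\underline\Lambda_x$. For $a\in\Lambda$ write $\tau^nx_{m,\kappa}\cdot a$ for the class of $(s,a)$ placed in the summand of $\tau^nx_{m,\kappa}$, where $s\in[0,1)$ is the representative of $\kappa$ modulo $1$. For $m_0<m_1<m_2$ the triangle product $\mu_2:\mathrm{CF}(L_{m_1},L_{m_2};\underline\Lambda)\times\mathrm{CF}(L_{m_0},L_{m_1};\underline\Lambda)\to\mathrm{CF}(L_{m_0},L_{m_2};\underline\Lambda)$ is the biadditive map with $$\mu_2(x_2\cdot b,x_1\cdot a)=\sum_{y\in L_{m_0}\cap L_{m_2}}y\sum_{u}\pm\,t^{w(u)}\,\nabla\gamma_2(b\,\nabla\gamma_1(a\,\nabla\gamma_0(1))).$$ Here $u$ runs over the rigid $J$-holomorphic triangles, modulo biholomorphisms of the closed unit disc $B$: maps $u:B\to T$ that are continuous, smooth away from three counterclockwise boundary points, holomorphic in the interior,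 that carry these points to $y,x_1,x_2$ and the counterclockwise arcs $\gamma_0:y\to x_1$, $\gamma_1:x_1\to x_2$, $\gamma_2:x_2\to y$ into $L_{m_0},L_{m_1},L_{m_2}$ (constant maps included). The sign is $(-1)^{s}$, with $s$ the number of boundary points of $B$ carried by $u$ to stars of the three circles. In the absolute case $w(u)=\int_B u^*(dx\,dy)$. In the relative case $w(u)=\#u^{-1}(D)$, for a point $D\in T$ that does not lie on the three circles. **Theorem.** Let $m_1,m_2\ge 1$ be integers, and put $$E(u,v)=\frac{m_1u+m_2v}{m_1+m_2},\qquad \phi(s)=\lfloor s\rfloor s-\tfrac12\lfloor s\rfloor\lfloor s+1\rfloor,\qquad \lambda(u,v)=m_1\phi(u)+m_2\phi(v)-(m_1+m_2)\phi(E(u,v)).$$ Then $E$ carries $\frac1{m_1}\mathbf Z\times\frac1{m_2}\mathbf Z$ into $\frac1{m_1+m_2}\mathbf Z$. Let $\kappa_1\in\{0,\frac1{m_1},\dots,\frac{m_1-1}{m_1}\}$, $\kappa_2\in\{0,\frac1{m_2},\dots,\frac{m_2-1}{m_2}\}$ and $a,b\in\Lambda$, and write $E_\ell=E(\kappa_1,\kappa_2+\ell)$.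 (1) In the absolute case the series defining $\mu_2(\tau^{m_1}x_{m_2,\kappa_2}\cdot b,\;x_{m_1,\kappa_1}\cdot a)$ converge, and $$\mu_2(\tau^{m_1}x_{m_2,\kappa_2}\cdot b,\;x_{m_1,\kappa_1}\cdot a)=\sum_{\ell\in\mathbf Z}x_{m_1+m_2,E_\ell}\cdot t^{(\ell+\kappa_2-\kappa_1)^2/(2(\frac1{m_1}+\frac1{m_2}))}\,\sigma^{\ell-\lfloor E_\ell\rfloor}(b)\,\sigma^{-\lfloor E_\ell\rfloor}(a),$$ where the right-hand side is a convergent sum. (2) In the relative case, there is a neighbourhood of $(0,0)$, depending only on $m_1,m_2$, such that for every $D$ in its intersection with the open first quadrant, $D$ does not lie on $L_0,L_{m_1},L_{m_1+m_2}$, and for all $\kappa_1,\kappa_2,a,b$ as above the numbers $\lambda(\kappa_1,\kappa_2+\ell)$ are non-negative integers, the series defining $\mu_2$ converge, and $$\mu_2(\tau^{m_1}x_{m_2,\kappa_2}\cdot b,\;x_{m_1,\kappa_1}\cdot a)=\sum_{\ell\in\mathbf Z}x_{m_1+m_2,E_\ell}\cdot t^{\lambda(\kappa_1,\kappa_2+\ell)}\,\sigma^{\ell-\lfloor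 E_\ell\rfloor}(b)\,\sigma^{-\lfloor E_\ell\rfloor}(a),$$ where the right-hand side is a convergent sum. -/

import Mathlib

/-!
Lagrangian Floer theory of the circles `L_m` on the torus `T = ℝ² / ℤ²`, coupled to a locally
constant sheaf of rings pulled back along the projection `𝔣 : T → S¹`, `(x, y) ↦ x`.
-/

noncomputable section

namespace FField

open scoped Topology

/-! ### The torus, the circles `L_m`, the Dehn twist -/

/-- The torus `T = ℝ² / ℤ²`; its first coordinate is the projection `𝔣 : T → S¹ = ℝ / ℤ`. -/
abbrev Torus : Type := UnitAddCircle × UnitAddCircle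

/-- The universal covering `ℝ² → T`. -/
def proj (v : ℝ × ℝ) : Torus := ((v.1 : UnitAddCircle), (v.2 : UnitAddCircle))

/-- The circle `L_m ⊂ T`: the image of the line through the origin of slope `-m`. It is oriented
from left to right. -/
def lag (m : ℤ) : Set Torus := Set.range fun x : ℝ => proj (x, -(m : ℝ) * x)

/-- The star `⋆_m = (ε, -m ε)` on `L_m`, which fixes the (bounding) spin structure of `L_m`. -/
def star (ε : ℝ) (m : ℤ) : Torus := proj (ε, -(m : ℝ) * ε)

/-- The Dehn twist `τ (x, y) = (x, y - x)`. -/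
def dehnTwist (p : Torus) : Torus := (p.1, p.2 - p.1)

theorem dehnTwist_iterate_fst (n : ℕ) (p : Torus) : (dehnTwist^[n] p).1 = p.1 := by
  induction n generalizing p with
  | zero => rfl
  | succ n ih => rw [Function.iterate_succ_apply, ih]; rfl

/-- The point `x_{m,κ} = (κ, 0)` (an intersection point of `L_0` and `L_m` if `m κ ∈ ℤ`);
it depends on `κ` modulo `1` only. -/
def xPoint (κ : ℝ) : Torus := proj (κ, 0)

/-! ### Local systems of rings on `S¹` -/

section LocalSystem

variable {R : Type*} [CommRing R]

/-- The real numbers that lie over a point of the circle. -/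
abbrev Lifts (θ : UnitAddCircle) : Type := {s : ℝ // (s : UnitAddCircle) = θ}

/-- The fibre over `θ` of the sheaf of rings on `S¹` with étalé space
`(ℝ × R) / ((s, c) ∼ (s + 1, σ c))`. A point of the étalé space over `θ` is an equivalence class of
pairs `(s, c)`, with `s` over `θ`, and such a class is the graph of a function `φ` on the lifts of
`θ` with `φ (s + 1) = σ (φ s)`. The ring structure is pointwise. -/
def Fiber (σ : RingAut R) (θ : UnitAddCircle) : Subring (Lifts θ → R) where
  carrier := {φ | ∀ s s' : Lifts θ, s'.1 = s.1 + 1 → φ s' = σ (φ s)}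
  mul_mem' := by
    intro f g hf hg s s' h
    simp [hf s s' h, hg s s' h]
  one_mem' := by
    intro s s' _
    simp
  add_mem' := by
    intro f g hf hg s s' h
    simp [hf s s' h, hg s s' h]
  zero_mem' := by
    intro s s' _
    simp
  neg_mem' := by
    intro f hf s s' h
    simp [hf s s' h]

/-- The class of `(s₀, c)` in the fibre over the image of `s₀`. -/
def Fiber.mk (σ : RingAut R) {θ : UnitAddCircle} (s₀ : Lifts θ) (c : R) : Fiber σ θ :=
  ⟨fun s => (σ ^ ⌊s.1 - s₀.1⌋) c, by
    intro s s' h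
    have h1 : s'.1 - s₀.1 = (s.1 - s₀.1) + 1 := by rw [h]; ring
    simp only [h1, Int.floor_add_one]
    rw [add_comm, zpow_one_add]
    rfl⟩

/-- The global section given by a `σ`-invariant element. -/
def Fiber.const (σ : RingAut R) (θ : UnitAddCircle) (r : {r : R // σ r = r}) : Fiber σ θ :=
  ⟨fun _ => r.1, fun _ _ _ => r.2.symm⟩

/-- Parallel transport `∇γ` along a path in `T` whose image in `S¹` lifts to a path in `ℝ` from
`s` to `t`. The locally constant sections are the classes of `(r, c)` with `c` fixed and `r`
varying, so `∇γ` carries the class of `(s, c)` to the class of `(t, c)`. -/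
def transport (σ : RingAut R) {θ θ' : UnitAddCircle} (s : Lifts θ) (t : Lifts θ')
    (φ : Fiber σ θ) : Fiber σ θ' :=
  ⟨fun r => φ.1 ⟨r.1 - (t.1 - s.1), by
      have h1 := r.2
      have h2 := s.2
      have h3 := t.2
      rw [AddCircle.coe_sub, AddCircle.coe_sub, h1, h2, h3]
      abel⟩, by
    intro r r' h
    exact φ.2 _ _ (by simp only [h]; ring)⟩

/-- The Floer cochains `CF(L_m, L_m'; Λ) = ⨁_{x ∈ L_m ∩ L_m'} Λ_x` for `m ≠ m'`, where `Λ` is pulled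
back along `𝔣`. There are only `|m - m'|` intersection points, so the direct sum is a product. -/
abbrev CF (σ : RingAut R) (m m' : ℤ) : Type _ :=
  (p : ↥(lag m ∩ lag m')) → Fiber σ p.1.1

open Classical in
/-- The element `x · φ` of `CF(L_m, L_m'; Λ)`: the element `φ ∈ Λ_x` placed in the summand of the
intersection point `x`. -/
def CF.single (σ : RingAut R) (m m' : ℤ) (x : Torus) (φ : Fiber σ x.1) : CF σ m m' :=
  fun p => if h : p.1 = x then h ▸ φ else 0

theorem fract_coe (κ : ℝ) : ((Int.fract κ : ℝ) : UnitAddCircle) = (κ : UnitAddCircle) := by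
  rw [Int.fract, AddCircle.coe_sub]
  have : ((⌊κ⌋ : ℝ) : UnitAddCircle) = 0 := by
    rw [AddCircle.coe_eq_zero_iff]
    exact ⟨⌊κ⌋, by simp⟩
  rw [this, sub_zero]

/-- The element `τ^n x_{n'-n,κ} · a` of `CF(L_n, L_n'; Λ)`, for `(n' - n) κ ∈ ℤ`. Here `a ∈ R` is
regarded as an element of the fibre at `τ^n x_{n'-n,κ}` through the representative of `κ` in the
fundamental domain `[0, 1)`. -/
def gen (σ : RingAut R) (n n' : ℕ) (κ : ℝ) (a : R) : CF σ (n : ℤ) (n' : ℤ) :=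
  CF.single σ n n' (dehnTwist^[n] (xPoint κ))
    (Fiber.mk σ ⟨Int.fract κ, by rw [dehnTwist_iterate_fst, fract_coe]; rfl⟩ a)

end LocalSystem

/-! ### Pseudoholomorphic triangles -/

/-- `J` is a (translation invariant) complex structure on `T`, given by its value on the tangent
space `ℝ²`, and inducing the orientation `dx ∧ dy`. -/
def IsComplexStructure (J : ℝ × ℝ →ₗ[ℝ] ℝ × ℝ) : Prop :=
  (∀ v, J (J v) = -v) ∧ ∀ v, v ≠ 0 → 0 < v.1 * (J v).2 - v.2 * (J v).1

/-- The counterclockwise arc of the unit circle from `p` to `q`. -/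
def ccwArc (p q : ℂ) : Set ℂ :=
  {w | ∃ α β γ : ℝ, α ≤ β ∧ β ≤ γ ∧ γ < α + 2 * Real.pi ∧
    p = Complex.exp (α * Complex.I) ∧ w = Complex.exp (β * Complex.I) ∧
    q = Complex.exp (γ * Complex.I)}

/-- Three distinct points of the unit circle in counterclockwise order. -/
def IsCcw (z₀ z₁ z₂ : ℂ) : Prop :=
  ∃ α β γ : ℝ, α < β ∧ β < γ ∧ γ < α + 2 * Real.pi ∧
    z₀ = Complex.exp (α * Complex.I) ∧ z₁ = Complex.exp (β * Complex.I) ∧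
    z₂ = Complex.exp (γ * Complex.I)

/-- A parametrized `J`-holomorphic triangle `(z, u)`, `u : D → T`, with sides on
`L_{m₀}, L_{m₁}, L_{m₂}` and vertices `x₀ ∈ L_{m₀} ∩ L_{m₂}`, `x₁ ∈ L_{m₁} ∩ L_{m₀}`,
`x₂ ∈ L_{m₂} ∩ L_{m₁}`. The map `u` from the closed unit disc is recorded by one of its lifts
`F` to the universal cover, `u = proj ∘ F`; the choice of the lift (and the values of `F` outside of
the disc) are forgotten in the moduli space below. -/
structure HoloTriangle (J : ℝ × ℝ →ₗ[ℝ] ℝ × ℝ) (m₀ m₁ m₂ : ℤ) (x₀ x₁ x₂ : Torus) where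
  /-- the corner that is mapped to `x₀` -/
  z₀ : ℂ
  /-- the corner that is mapped to `x₁` -/
  z₁ : ℂ
  /-- the corner that is mapped to `x₂` -/
  z₂ : ℂ
  /-- a lift of the map `u` -/
  F : ℂ → ℝ × ℝ
  ccw : IsCcw z₀ z₁ z₂
  continuousOn : ContinuousOn F (Metric.closedBall 0 1)
  smooth : ContDiffOn ℝ ((⊤ : ℕ∞) : WithTop ℕ∞) F (Metric.closedBall 0 1 \ {z₀, z₁, z₂})
  holo : ∀ w ∈ Metric.ball (0 : ℂ) 1, ∀ v : ℂ,
    fderiv ℝ F w (Complex.I * v) = J (fderiv ℝ F w v)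
  vertex₀ : proj (F z₀) = x₀
  vertex₁ : proj (F z₁) = x₁
  vertex₂ : proj (F z₂) = x₂
  side₀ : ∀ w ∈ ccwArc z₀ z₁, proj (F w) ∈ lag m₀
  side₁ : ∀ w ∈ ccwArc z₁ z₂, proj (F w) ∈ lag m₁
  side₂ : ∀ w ∈ ccwArc z₂ z₀, proj (F w) ∈ lag m₂

/-- The biholomorphisms of the unit disc. -/
def IsDiscAut (g : ℂ → ℂ) : Prop :=
  ∃ a c : ℂ, ‖a‖ < 1 ∧ ‖c‖ = 1 ∧
    ∀ w, g w = c * (w - a) / (1 - (starRingEnd ℂ) a * w)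

section Triangles

variable {J : ℝ × ℝ →ₗ[ℝ] ℝ × ℝ} {m₀ m₁ m₂ : ℤ} {x₀ x₁ x₂ : Torus}

namespace HoloTriangle

/-- `(z, u)` and `(z', u')` differ by a biholomorphism of the disc. -/
def Equivalent (S S' : HoloTriangle J m₀ m₁ m₂ x₀ x₁ x₂) : Prop :=
  ∃ g : ℂ → ℂ, IsDiscAut g ∧ g S.z₀ = S'.z₀ ∧ g S.z₁ = S'.z₁ ∧ g S.z₂ = S'.z₂ ∧
    ∀ w ∈ Metric.closedBall (0 : ℂ) 1, proj (S'.F (g w)) = proj (S.F w)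

/-- The symplectic area `∫_D u^* (dx dy)`. -/
def area (S : HoloTriangle J m₀ m₁ m₂ x₀ x₁ x₂) : ℝ :=
  ∫ w in Metric.ball (0 : ℂ) 1,
    ((fderiv ℝ S.F w 1).1 * (fderiv ℝ S.F w Complex.I).2
      - (fderiv ℝ S.F w 1).2 * (fderiv ℝ S.F w Complex.I).1)

/-- The cardinality of `u⁻¹(D)`, for a point `D` of the torus. -/
def divisorCount (D : Torus) (S : HoloTriangle J m₀ m₁ m₂ x₀ x₁ x₂) : ℕ :=
  {w ∈ Metric.closedBall (0 : ℂ) 1 | proj (S.F w) = D}.ncard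

/-- The number of stars that are met going around the boundary of the disc. -/
def starCount (ε : ℝ) (S : HoloTriangle J m₀ m₁ m₂ x₀ x₁ x₂) : ℕ :=
  {w ∈ Metric.sphere (0 : ℂ) 1 | proj (S.F w) = star ε m₀ ∨ proj (S.F w) = star ε m₁ ∨
    proj (S.F w) = star ε m₂}.ncard

/-- The lift to `ℝ` of the `S¹`-coordinate of the vertex `x₀`, read off from `F`. -/
def lift₀ (S : HoloTriangle J m₀ m₁ m₂ x₀ x₁ x₂) : Lifts x₀.1 :=
  ⟨(S.F S.z₀).1, congrArg Prod.fst S.vertex₀⟩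

/-- The lift to `ℝ` of the `S¹`-coordinate of the vertex `x₁`, read off from `F`. -/
def lift₁ (S : HoloTriangle J m₀ m₁ m₂ x₀ x₁ x₂) : Lifts x₁.1 :=
  ⟨(S.F S.z₁).1, congrArg Prod.fst S.vertex₁⟩

/-- The lift to `ℝ` of the `S¹`-coordinate of the vertex `x₂`, read off from `F`. -/
def lift₂ (S : HoloTriangle J m₀ m₁ m₂ x₀ x₁ x₂) : Lifts x₂.1 :=
  ⟨(S.F S.z₂).1, congrArg Prod.fst S.vertex₂⟩

/-- `∇γ₂ (b · ∇γ₁ (a · ∇γ₀ 1))`, where `γ₀ : x₀ → x₁`, `γ₁ : x₁ → x₂`, `γ₂ : x₂ → x₀` are the sides of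
the triangle, in counterclockwise order. -/
def holonomy {R : Type*} [CommRing R] (σ : RingAut R) (S : HoloTriangle J m₀ m₁ m₂ x₀ x₁ x₂)
    (b : Fiber σ x₂.1) (a : Fiber σ x₁.1) : Fiber σ x₀.1 :=
  transport σ S.lift₂ S.lift₀
    (b * transport σ S.lift₁ S.lift₂ (a * transport σ S.lift₀ S.lift₁ 1))

end HoloTriangle

end Triangles

/-- The (integral) Maslov degree of the intersection points of `L_m` and `L_m'`, `m ≠ m'`. -/
def maslov (m m' : ℤ) : ℤ := if m < m' then 0 else 1

/-- The dimension of the moduli spaces of triangles with sides on `L_{m₀}, L_{m₁}, L_{m₂}`. -/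
def triangleIndex (m₀ m₁ m₂ : ℤ) : ℤ := maslov m₀ m₂ - maslov m₀ m₁ - maslov m₁ m₂

/-- The moduli space `ℳ(x₀, x₁, x₂)` of `J`-holomorphic triangles up to reparametrization. -/
def Moduli (J : ℝ × ℝ →ₗ[ℝ] ℝ × ℝ) (m₀ m₁ m₂ : ℤ) (x₀ x₁ x₂ : Torus) : Type :=
  Quot (HoloTriangle.Equivalent (J := J) (m₀ := m₀) (m₁ := m₁) (m₂ := m₂)
    (x₀ := x₀) (x₁ := x₁) (x₂ := x₂))

/-- The rigid triangles: those of index zero. -/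
abbrev RigidTriangle (J : ℝ × ℝ →ₗ[ℝ] ℝ × ℝ) (m₀ m₁ m₂ : ℤ) (x₀ x₁ x₂ : Torus) : Type :=
  {_q : Moduli J m₀ m₁ m₂ x₀ x₁ x₂ // triangleIndex m₀ m₁ m₂ = 0}

/-! ### The triangle product -/

section Product

variable {R : Type*} [CommRing R]

/-- A rule that assigns to each triangle a power `t ^ (…)` of the Novikov parameter. Such powers are
fixed by `σ`, so that they are elements of each fibre. -/
abbrev Weight (σ : RingAut R) (J : ℝ × ℝ →ₗ[ℝ] ℝ × ℝ) (m₀ m₁ m₂ : ℤ) : Type _ :=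
  ∀ x₀ x₁ x₂ : Torus, HoloTriangle J m₀ m₁ m₂ x₀ x₁ x₂ → {r : R // σ r = r}

variable (σ : RingAut R) (J : ℝ × ℝ →ₗ[ℝ] ℝ × ℝ) (ε : ℝ) {m₀ m₁ m₂ : ℤ}

/-- The contribution `± t ^ (…) ∇γ₂ (b · ∇γ₁ (a · ∇γ₀ 1))` of a rigid triangle `u` with vertices
`y, x₁, x₂` to the coefficient at `y` of `μ₂ (x₂ · b, x₁ · a)`, for slopes `m₀ < m₁ < m₂`. All
intersection points then have Maslov degree `0`, so the sign for the left-to-right orientations is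
`(-1)` to the number of stars on the boundary. The contribution does not depend on the
representative `(z, u)` in the moduli space. -/
def contribution (wt : Weight σ J m₀ m₁ m₂) {y x₁ x₂ : Torus}
    (b : Fiber σ x₂.1) (a : Fiber σ x₁.1) (u : RigidTriangle J m₀ m₁ m₂ y x₁ x₂) :
    Fiber σ y.1 :=
  let S : HoloTriangle J m₀ m₁ m₂ y x₁ x₂ := Quot.out u.1
  (-1) ^ S.starCount ε * (Fiber.const σ y.1 (wt _ _ _ S) * S.holonomy σ b a)

/-- The triangle product
`μ₂ : CF(L_{m₁}, L_{m₂}; Λ) × CF(L_{m₀}, L_{m₁}; Λ) → CF(L_{m₀}, L_{m₂}; Λ)` for `m₀ < m₁ < m₂`. -/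
def mu2 [TopologicalSpace R] (wt : Weight σ J m₀ m₁ m₂) (β : CF σ m₁ m₂) (α : CF σ m₀ m₁) :
    CF σ m₀ m₂ :=
  fun y => ∑ᶠ x₂ : ↥(lag m₁ ∩ lag m₂), ∑ᶠ x₁ : ↥(lag m₀ ∩ lag m₁),
    ∑' u : RigidTriangle J m₀ m₁ m₂ y.1 x₁.1 x₂.1, contribution σ J ε wt (β x₂) (α x₁) u

/-- All of the series that define `μ₂ (β, α)` converge. -/
def Mu2Converges [TopologicalSpace R] (wt : Weight σ J m₀ m₁ m₂) (β : CF σ m₁ m₂)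
    (α : CF σ m₀ m₁) : Prop :=
  ∀ (y : ↥(lag m₀ ∩ lag m₂)) (x₂ : ↥(lag m₁ ∩ lag m₂)) (x₁ : ↥(lag m₀ ∩ lag m₁)),
    Summable fun u : RigidTriangle J m₀ m₁ m₂ y.1 x₁.1 x₂.1 =>
      contribution σ J ε wt (β x₂) (α x₁) u

end Product

/-! ### The absolute case: the Novikov ring -/

section Absolute

variable (C : Type*) [CommRing C]

theorem exists_lowerBound {C : Type*} [CommRing C] (f : HahnSeries ℝ C) :
    ∃ s : ℝ, ∀ x ∈ f.support, s ≤ x := by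
  by_cases hf : f = 0
  · exact ⟨0, by simp [hf]⟩
  · exact ⟨f.order, fun x hx => HahnSeries.order_le_of_coeff_ne_zero hx⟩

/-- The Novikov ring `Λ_C`: the series `∑ a_i t ^ λ_i` with `a_i ∈ C`, `λ_i ∈ ℝ` and `λ_i → ∞`. -/
def Novikov : Subring (HahnSeries ℝ C) where
  carrier := {f | ∀ r : ℝ, (f.support ∩ Set.Iic r).Finite}
  mul_mem' := by
    intro f g hf hg r
    obtain ⟨s, hs⟩ := exists_lowerBound f
    obtain ⟨t, ht⟩ := exists_lowerBound g
    refine ((hf (r - t)).add (hg (r - s))).subset ?_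
    rintro x ⟨hx, hxr⟩
    obtain ⟨u, hu, v, hv, rfl⟩ := Set.mem_add.1 (HahnSeries.support_mul_subset hx)
    have h1 := hs u hu
    have h2 := ht v hv
    have h3 : u + v ≤ r := hxr
    exact Set.add_mem_add ⟨hu, by simp only [Set.mem_Iic]; linarith⟩
      ⟨hv, by simp only [Set.mem_Iic]; linarith⟩
  one_mem' := by
    intro r
    refine (Set.finite_singleton (0 : ℝ)).subset ?_
    rintro x ⟨hx, _⟩
    by_contra h
    exact hx (by rw [HahnSeries.coeff_one, if_neg (by simpa using h)])
  add_mem' := by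
    intro f g hf hg r
    refine ((hf r).union (hg r)).subset ?_
    rintro x ⟨hx, hxr⟩
    rcases HahnSeries.support_add_subset f g hx with h | h
    · exact Or.inl ⟨h, hxr⟩
    · exact Or.inr ⟨h, hxr⟩
  zero_mem' := by
    intro r
    simp
  neg_mem' := by
    intro f hf r
    have : (-f).support = f.support := by
      ext x; simp
    simpa only [this] using hf r

/-- The topology of `Λ_C`: two series are close if they agree up to a high power of `t`, i.e. the
coarsest topology for which each truncation `f ↦ (f mod t ^ r)` is locally constant. -/
instance : TopologicalSpace (Novikov C) :=
  ⨅ r : ℝ, TopologicalSpace.induced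
    (fun f : Novikov C => fun s : Set.Iio r => f.1.coeff s.1) ⊥

variable {C}

/-- The monomial `t ^ r`. -/
def tPow (C : Type*) [CommRing C] (r : ℝ) : Novikov C :=
  ⟨HahnSeries.single r 1, by
    intro s
    refine (Set.finite_singleton r).subset ?_
    rintro x ⟨hx, _⟩
    exact HahnSeries.support_single_subset hx⟩

/-- The action on `Λ_C` of a ring homomorphism of `C`, coefficient by coefficient. -/
def novikovMap (σ : C →+* C) (f : Novikov C) : Novikov C :=
  ⟨f.1.map σ, by
    intro r
    refine (f.2 r).subset ?_
    rintro x ⟨hx, hxr⟩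
    refine ⟨fun h => hx ?_, hxr⟩
    simp [HahnSeries.map, h]⟩

/-- The automorphism of `Λ_C` induced by `σ`, with `σ (t ^ r) = t ^ r`. -/
def novikovAut (σ : RingAut C) : RingAut (Novikov C) where
  toFun := novikovMap (σ : C →+* C)
  invFun := novikovMap (σ.symm : C →+* C)
  left_inv f := by
    apply Subtype.ext
    ext x
    simp [novikovMap, HahnSeries.map]
  right_inv f := by
    apply Subtype.ext
    ext x
    simp [novikovMap, HahnSeries.map]
  map_mul' f g := Subtype.ext
    (HahnSeries.map_mul ((σ : C →+* C) : C →ₙ+* C) (x := f.1) (y := g.1))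
  map_add' f g := Subtype.ext
    (HahnSeries.map_add ((σ : C →+* C) : C →+ C) (x := f.1) (y := g.1))

theorem novikovAut_tPow (σ : RingAut C) (r : ℝ) : novikovAut σ (tPow C r) = tPow C r := by
  apply Subtype.ext
  ext x
  by_cases h : x = r <;>
    simp [novikovAut, novikovMap, tPow, HahnSeries.map, HahnSeries.coeff_single, h]

/-- The weight `t ^ area(u)`. -/
def absWeight (σ : RingAut C) (J : ℝ × ℝ →ₗ[ℝ] ℝ × ℝ) (m₀ m₁ m₂ : ℤ) :
    Weight (novikovAut σ) J m₀ m₁ m₂ :=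
  fun _ _ _ S => ⟨tPow C S.area, novikovAut_tPow σ _⟩

end Absolute

/-! ### The relative case: power series -/

section Relative

variable {C : Type*} [CommRing C]

/-- The `t`-adic topology of `C⟦t⟧`: the product topology, for the discrete topology of `C`. -/
instance (C : Type*) [CommRing C] : TopologicalSpace (PowerSeries C) :=
  @PowerSeries.WithPiTopology.instTopologicalSpace C ⊥

/-- The automorphism of `C⟦t⟧` induced by `σ`, with `σ t = t`. -/
def powerSeriesAut (σ : RingAut C) : RingAut (PowerSeries C) where
  toFun := PowerSeries.map (σ : C →+* C)
  invFun := PowerSeries.map (σ.symm : C →+* C)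
  left_inv f := by
    ext n
    simp
  right_inv f := by
    ext n
    simp
  map_mul' := map_mul _
  map_add' := map_add _

theorem powerSeriesAut_X_pow (σ : RingAut C) (n : ℕ) :
    powerSeriesAut σ (PowerSeries.X ^ n) = PowerSeries.X ^ n := by
  change PowerSeries.map (σ : C →+* C) (PowerSeries.X ^ n) = PowerSeries.X ^ n
  simp

/-- The weight `t ^ #u⁻¹(D)`. -/
def relWeight (σ : RingAut C) (D : Torus) (J : ℝ × ℝ →ₗ[ℝ] ℝ × ℝ) (m₀ m₁ m₂ : ℤ) :
    Weight (powerSeriesAut σ) J m₀ m₁ m₂ :=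
  fun _ _ _ S => ⟨PowerSeries.X ^ S.divisorCount D, powerSeriesAut_X_pow σ _⟩

end Relative

/-! ### The functions in the formulas -/

/-- `E(κ₁, κ₂) = (m₁ κ₁ + m₂ κ₂) / (m₁ + m₂)`. -/
def E (m₁ m₂ : ℕ) (κ₁ κ₂ : ℝ) : ℝ := (m₁ * κ₁ + m₂ * κ₂) / (m₁ + m₂)

/-- `φ(s) = ⌊s⌋ s - ⌊s⌋ ⌊s + 1⌋ / 2`. -/
def phi (s : ℝ) : ℝ := ⌊s⌋ * s - 1 / 2 * ⌊s⌋ * ⌊s + 1⌋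

/-- `λ(u, v) = m₁ φ(u) + m₂ φ(v) - (m₁ + m₂) φ(E(u, v))`. -/
def lam (m₁ m₂ : ℕ) (u v : ℝ) : ℝ :=
  m₁ * phi u + m₂ * phi v - (m₁ + m₂) * phi (E m₁ m₂ u v)

end FField

end

noncomputable section

namespace FField

open scoped Topology
open MeasureTheory Set Filter

/-! ### Primitives on star-shaped domains -/

/-! The lift of a triangle to the plane has a rigid boundary. On each arc the function `y + m x` is
continuous and integer valued, hence constant, so the three sides lie on three lines of slopes `0`,
`-m₁`, `-(m₁ + m₂)`. Their vertices lie over `E_ℓ + p`, `κ₁ + p` and `κ₂ + p + ℓ`, so that up to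
translation by `ℤ²` the only invariant of the boundary is the integer `ℓ` (`HasIndex`,
`exists_hasIndex`).

For each `ℓ` there is exactly one triangle up to reparametrization. Uniqueness: match the corners by
an automorphism of the disc (`exists_discAut`). The difference of two lifts with the same side lines
is then holomorphic, vanishes at a corner, and has boundary values on three lines through the
origin. If it were not constant its image would be open, and the farthest image point on a ray that
avoids these lines would give a contradiction (`eqOn_const_of_sphere_cone`, `eqOn_of_sides`).
Existence: a Schwarz–Christoffel map `G` carries the disc onto one standard triangle
(`exists_triangleParam`), and the lift is a constant plus `c • G` with `c = (κ₂ + ℓ - κ₁) / (m₁ +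
m₂)`. A negative `c` is a half turn, which commutes with `J`; for `c = 0` the triangle is constant.
Hence the triangles with vertex `y` correspond to the `ℓ` with `E_ℓ` over `y` (`bijective_index`).

Every ingredient of the contribution is read off from this explicit lift. The area is `c²` times
that of the standard triangle (`HasIndex.area_eq`). The preimages of `D` are the lattice translates
of a small vector inside the triangle; since `φ(s)` equals `∑ max (s - i) 0` up to a linear term,
and the linear terms cancel in `λ`, the number `λ` is the same count taken column by column
(`ncard_latticePoints`, `mem_latticePoints_iff`). The sign is `+`: on the boundary, stars are the
points whose first coordinate lies in `ε + ℤ`, and this coordinate runs from `E_ℓ` to `κ₁`, to `κ₂ +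
ℓ` and back. As `E_ℓ` lies between the other two values, each number other than a vertex value is
taken an even number of times (`HasIndex.even_starCount`). The powers of `σ` compare the lifts of
the vertices with their representatives in `[0, 1)` (`contribution_eq`).

Convergence holds because the exponents grow quadratically in `ℓ`: exactly for the area, and up to a
bounded error for `λ` (`le_lam`). -/

theorem hasDerivAt_starPrimitive {g : ℂ → ℂ} {U : Set ℂ} (hU : IsOpen U)
    (hstar : ∀ w ∈ U, ∀ t ∈ Icc (0 : ℝ) 1, (t : ℂ) * w ∈ U) (hg : DifferentiableOn ℂ g U)
    {w : ℂ} (hw : w ∈ U) :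
    HasDerivAt (fun z : ℂ => z * ∫ t in (0 : ℝ)..1, g (t * z)) (g w) w := by
  have hgc : ContinuousOn g U := hg.continuousOn
  have hg' : ContinuousOn (deriv g) U := (hg.deriv hU).continuousOn
  have hK : IsCompact ((fun t : ℝ => (t : ℂ) * w) '' Icc (0 : ℝ) 1) :=
    isCompact_Icc.image (by fun_prop)
  have hKU : (fun t : ℝ => (t : ℂ) * w) '' Icc (0 : ℝ) 1 ⊆ U := by
    rintro _ ⟨t, ht, rfl⟩; exact hstar w hw t ht
  -- A compact thickening of the segment from `0` to `w` still lies in `U`, so `deriv g` is bounded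
  -- on it. This bound allows differentiation under the integral sign.
  obtain ⟨δ, hδ, hδU⟩ := hK.exists_cthickening_subset_open hU hKU
  obtain ⟨M, hM⟩ := (hK.cthickening (r := δ)).exists_bound_of_continuousOn (hg'.mono hδU)
  have hmem : ∀ z ∈ Metric.ball w δ, ∀ t ∈ Icc (0 : ℝ) 1, (t : ℂ) * z ∈
      Metric.cthickening δ ((fun t : ℝ => (t : ℂ) * w) '' Icc (0 : ℝ) 1) := by
    intro z hz t ht
    refine Metric.mem_cthickening_of_dist_le _ _ _ _ ⟨t, ht, rfl⟩ ?_
    have h1 : dist ((t : ℂ) * z) (t * w) = t * dist z w := by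
      rw [dist_eq_norm, ← mul_sub, norm_mul, Complex.norm_real, Real.norm_of_nonneg ht.1,
        dist_eq_norm]
    have h2 : dist z w < δ := hz
    rw [h1]
    nlinarith [ht.1, ht.2, dist_nonneg (x := z) (y := w)]
  have hUnif : uIoc (0 : ℝ) 1 ⊆ Icc 0 1 := by
    rw [uIoc_of_le zero_le_one]; exact Ioc_subset_Icc_self
  have hcont : ∀ z ∈ Metric.ball w δ, ContinuousOn (fun t : ℝ => g (t * z)) (Icc 0 1) := by
    intro z hz
    exact hgc.comp (by fun_prop) fun t ht => hδU (hmem z hz t ht)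
  have hwb : w ∈ Metric.ball w δ := Metric.mem_ball_self hδ
  have hcont' : ContinuousOn (fun t : ℝ => (t : ℂ) * deriv g (t * w)) (Icc 0 1) :=
    ContinuousOn.mul (by fun_prop)
      (hg'.comp (by fun_prop) fun t ht => hδU (hmem w hwb t ht))
  have key := intervalIntegral.hasDerivAt_integral_of_dominated_loc_of_deriv_le
    (μ := volume) (a := 0) (b := 1) (F := fun (z : ℂ) (t : ℝ) => g (t * z))
    (F' := fun (z : ℂ) (t : ℝ) => (t : ℂ) * deriv g (t * z)) (x₀ := w) (bound := fun _ => M)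
    (Metric.ball_mem_nhds w hδ)
    (by
      filter_upwards [Metric.ball_mem_nhds w hδ] with z hz
      exact ((hcont z hz).mono hUnif).aestronglyMeasurable measurableSet_uIoc)
    (ContinuousOn.intervalIntegrable (by rw [uIcc_of_le zero_le_one]; exact hcont w hwb))
    ((hcont'.mono hUnif).aestronglyMeasurable measurableSet_uIoc)
    (by
      refine Filter.Eventually.of_forall fun t ht z hz => ?_
      have ht' := hUnif ht
      have h1 := hM _ (hmem z hz t ht')
      rw [norm_mul, Complex.norm_real, Real.norm_of_nonneg ht'.1]
      nlinarith [ht'.1, ht'.2, norm_nonneg (deriv g (t * z))])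
    intervalIntegrable_const
    (by
      refine Filter.Eventually.of_forall fun t ht z hz => ?_
      have ht' := hUnif ht
      have h1 : HasDerivAt g (deriv g (t * z)) (t * z) :=
        (hg.differentiableAt (hU.mem_nhds (hδU (hmem z hz t ht')))).hasDerivAt
      have h2 : HasDerivAt (fun z : ℂ => (t : ℂ) * z) t z := by
        simpa using (hasDerivAt_id z).const_mul (t : ℂ)
      rw [mul_comm]
      exact h1.comp z h2)
  have hprod := (hasDerivAt_id w).mul key.2
  refine hprod.congr_deriv ?_
  -- The integrand is the `t`-derivative of `t * g (t * w)`.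
  have hint : ∫ t in (0 : ℝ)..1, (g (t * w) + w * (t * deriv g (t * w))) = g w := by
    have := intervalIntegral.integral_eq_sub_of_hasDerivAt (a := 0) (b := 1)
      (f := fun t : ℝ => (t : ℂ) * g (t * w))
      (f' := fun t : ℝ => g (t * w) + w * (t * deriv g (t * w))) (by
        intro t ht
        rw [uIcc_of_le zero_le_one] at ht
        have h1 : HasDerivAt g (deriv g (t * w)) (t * w) :=
          (hg.differentiableAt (hU.mem_nhds (hδU (hmem w hwb t ht)))).hasDerivAt
        have h3 : HasDerivAt (fun t : ℝ => (t : ℂ)) 1 t := by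
          simpa using (hasDerivAt_id t).ofReal_comp
        have h2 : HasDerivAt (fun t : ℝ => (t : ℂ) * w) w t := by
          simpa using h3.mul_const w
        have h4 := h3.mul (h1.comp t h2)
        refine h4.congr_deriv ?_
        simp only [Function.comp_apply]
        ring)
      (ContinuousOn.intervalIntegrable (by
        rw [uIcc_of_le zero_le_one]
        exact (hcont w hwb).add (continuousOn_const.mul hcont')))
    rw [this]; simp
  rw [intervalIntegral.integral_add
    (ContinuousOn.intervalIntegrable (by rw [uIcc_of_le zero_le_one]; exact hcont w hwb))
    (ContinuousOn.intervalIntegrable (by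
        rw [uIcc_of_le zero_le_one]
        exact (continuousOn_const.mul hcont'))), intervalIntegral.integral_const_mul] at hint
  simpa using hint

/-! ### The Schwarz–Christoffel map of a triangle -/

/-- The factor `(1 - w / z) ^ (-a)`, for `z` on the unit circle. -/
def scFactor (z : ℂ) (a : ℝ) (w : ℂ) : ℂ := (1 - w * (starRingEnd ℂ) z) ^ ((-a : ℝ) : ℂ)

/-- The derivative of the Schwarz–Christoffel map. -/
def scDeriv (z₀ z₁ z₂ : ℂ) (a₀ a₁ a₂ : ℝ) (w : ℂ) : ℂ :=
  scFactor z₀ a₀ w * scFactor z₁ a₁ w * scFactor z₂ a₂ w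

/-- The Schwarz–Christoffel map from the unit disc to a triangle with exterior angles `π aⱼ`. -/
def scMap (z₀ z₁ z₂ : ℂ) (a₀ a₁ a₂ : ℝ) (w : ℂ) : ℂ :=
  w * ∫ t in (0 : ℝ)..1, scDeriv z₀ z₁ z₂ a₀ a₁ a₂ (t * w)

/-- The complement of three radial slits. -/
def slitDomain (z₀ z₁ z₂ : ℂ) : Set ℂ :=
  {w | 1 - w * (starRingEnd ℂ) z₀ ∈ Complex.slitPlane ∧
    1 - w * (starRingEnd ℂ) z₁ ∈ Complex.slitPlane ∧
    1 - w * (starRingEnd ℂ) z₂ ∈ Complex.slitPlane}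

theorem isOpen_slitDomain (z₀ z₁ z₂ : ℂ) : IsOpen (slitDomain z₀ z₁ z₂) := by
  have h : ∀ z : ℂ, IsOpen {w : ℂ | 1 - w * (starRingEnd ℂ) z ∈ Complex.slitPlane} := fun z =>
    Complex.isOpen_slitPlane.preimage (by fun_prop)
  exact (h z₀).inter ((h z₁).inter (h z₂))

/-- The map `w ↦ 1 - w * conj z` carries the segment from `0` to `w` to a segment starting at `1`,
and the slit plane is star convex about `1`. -/
theorem slitDomain_star (z₀ z₁ z₂ : ℂ) : ∀ w ∈ slitDomain z₀ z₁ z₂, ∀ t ∈ Icc (0 : ℝ) 1,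
    (t : ℂ) * w ∈ slitDomain z₀ z₁ z₂ := by
  have h : ∀ z w : ℂ, 1 - w * (starRingEnd ℂ) z ∈ Complex.slitPlane → ∀ t ∈ Icc (0 : ℝ) 1,
      1 - (t * w) * (starRingEnd ℂ) z ∈ Complex.slitPlane := by
    intro z w hw t ht
    have := Complex.starConvex_one_slitPlane.add_smul_mem (y := - (w * (starRingEnd ℂ) z))
      (by simpa [sub_eq_add_neg] using hw) ht.1 ht.2
    convert this using 1
    simp only [Complex.real_smul]
    ring
  exact fun w hw t ht => ⟨h _ _ hw.1 t ht, h _ _ hw.2.1 t ht, h _ _ hw.2.2 t ht⟩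

theorem differentiableAt_scFactor {z w : ℂ} (a : ℝ)
    (h : 1 - w * (starRingEnd ℂ) z ∈ Complex.slitPlane) :
    DifferentiableAt ℂ (scFactor z a) w := by
  unfold scFactor
  exact DifferentiableAt.cpow (by fun_prop) (by fun_prop) h

theorem differentiableOn_scDeriv (z₀ z₁ z₂ : ℂ) (a₀ a₁ a₂ : ℝ) :
    DifferentiableOn ℂ (scDeriv z₀ z₁ z₂ a₀ a₁ a₂) (slitDomain z₀ z₁ z₂) := by
  intro w hw
  exact (((differentiableAt_scFactor a₀ hw.1).mul (differentiableAt_scFactor a₁ hw.2.1)).mul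
    (differentiableAt_scFactor a₂ hw.2.2)).differentiableWithinAt

theorem hasDerivAt_scMap {z₀ z₁ z₂ : ℂ} (a₀ a₁ a₂ : ℝ) {w : ℂ} (hw : w ∈ slitDomain z₀ z₁ z₂) :
    HasDerivAt (scMap z₀ z₁ z₂ a₀ a₁ a₂) (scDeriv z₀ z₁ z₂ a₀ a₁ a₂ w) w :=
  hasDerivAt_starPrimitive (isOpen_slitDomain z₀ z₁ z₂) (slitDomain_star z₀ z₁ z₂)
    (differentiableOn_scDeriv z₀ z₁ z₂ a₀ a₁ a₂) hw

theorem scDeriv_ne_zero {z₀ z₁ z₂ : ℂ} (a₀ a₁ a₂ : ℝ) {w : ℂ} (hw : w ∈ slitDomain z₀ z₁ z₂) :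
    scDeriv z₀ z₁ z₂ a₀ a₁ a₂ w ≠ 0 := by
  have h : ∀ (z : ℂ) (a : ℝ), 1 - w * (starRingEnd ℂ) z ∈ Complex.slitPlane →
      scFactor z a w ≠ 0 := fun z a h => by
    unfold scFactor
    rw [Complex.cpow_ne_zero_iff]
    exact Or.inl (Complex.slitPlane_ne_zero h)
  exact mul_ne_zero (mul_ne_zero (h _ _ hw.1) (h _ _ hw.2.1)) (h _ _ hw.2.2)

/-- Otherwise `w * conj z` is real and at least `1`; its norm is at most `1`, so it equals `1`, and
`w = z`. -/
theorem one_sub_mul_conj_mem_slitPlane {z w : ℂ} (hz : ‖z‖ = 1) (hw : ‖w‖ ≤ 1) (hne : w ≠ z) :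
    1 - w * (starRingEnd ℂ) z ∈ Complex.slitPlane := by
  by_contra h
  rw [Complex.mem_slitPlane_iff, not_or, not_lt, not_not] at h
  have hn : ‖w * (starRingEnd ℂ) z‖ ≤ 1 := by
    rw [norm_mul, RCLike.norm_conj, hz, mul_one]; exact hw
  have h1 : 1 ≤ (w * (starRingEnd ℂ) z).re := by
    have := h.1; simp only [Complex.sub_re, Complex.one_re] at this; linarith
  have h2 : (w * (starRingEnd ℂ) z).im = 0 := by
    have := h.2; simp only [Complex.sub_im, Complex.one_im] at this; linarith
  have h3 : (w * (starRingEnd ℂ) z).re ≤ 1 := (Complex.re_le_norm _).trans hn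
  have h4 : w * (starRingEnd ℂ) z = 1 := Complex.ext (le_antisymm h3 h1) h2
  apply hne
  have h5 : (starRingEnd ℂ) z * z = 1 := by
    rw [mul_comm, Complex.mul_conj, Complex.normSq_eq_norm_sq, hz]; simp
  calc w = w * ((starRingEnd ℂ) z * z) := by rw [h5, mul_one]
    _ = z := by rw [← mul_assoc, h4, one_mul]

theorem mem_slitDomain {z₀ z₁ z₂ w : ℂ} (hz₀ : ‖z₀‖ = 1) (hz₁ : ‖z₁‖ = 1) (hz₂ : ‖z₂‖ = 1)
    (hw : ‖w‖ ≤ 1) (h₀ : w ≠ z₀) (h₁ : w ≠ z₁) (h₂ : w ≠ z₂) : w ∈ slitDomain z₀ z₁ z₂ :=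
  ⟨one_sub_mul_conj_mem_slitPlane hz₀ hw h₀, one_sub_mul_conj_mem_slitPlane hz₁ hw h₁,
    one_sub_mul_conj_mem_slitPlane hz₂ hw h₂⟩

theorem mem_slitDomain_of_norm_lt {z₀ z₁ z₂ w : ℂ} (hz₀ : ‖z₀‖ = 1) (hz₁ : ‖z₁‖ = 1)
    (hz₂ : ‖z₂‖ = 1) (hw : ‖w‖ < 1) : w ∈ slitDomain z₀ z₁ z₂ :=
  mem_slitDomain hz₀ hz₁ hz₂ hw.le (by rintro rfl; linarith) (by rintro rfl; linarith)
    (by rintro rfl; linarith)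

theorem norm_one_sub_mul_conj {z : ℂ} (hz : ‖z‖ = 1) (w : ℂ) :
    ‖1 - w * (starRingEnd ℂ) z‖ = ‖w - z‖ := by
  have h5 : (starRingEnd ℂ) z * z = 1 := by
    rw [mul_comm, Complex.mul_conj, Complex.normSq_eq_norm_sq, hz]; simp
  calc ‖1 - w * (starRingEnd ℂ) z‖ = ‖1 - w * (starRingEnd ℂ) z‖ * ‖z‖ := by rw [hz, mul_one]
    _ = ‖(1 - w * (starRingEnd ℂ) z) * z‖ := (norm_mul _ _).symm
    _ = ‖z - w‖ := by congr 1; rw [sub_mul, mul_assoc, h5]; ring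
    _ = _ := norm_sub_rev _ _

theorem norm_scFactor {z : ℂ} (hz : ‖z‖ = 1) (a : ℝ) (w : ℂ) :
    ‖scFactor z a w‖ = ‖w - z‖ ^ (-a) := by
  rw [scFactor, Complex.norm_cpow_real, norm_one_sub_mul_conj hz]

/-- At most one of three factors can be large. -/
theorem rpow_prod_le {x y z s m a b c : ℝ} (hs : 0 < s) (hm : 0 < m) (hm1 : m ≤ 1)
    (hx : s ≤ x) (hy : s ≤ y) (hz : s ≤ z)
    (hxy : m ≤ x ∨ m ≤ y) (hxz : m ≤ x ∨ m ≤ z) (hyz : m ≤ y ∨ m ≤ z)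
    (ha : 0 < a) (hb : 0 < b) (hc : 0 < c) (ha1 : a < 1) (hb1 : b < 1) (hc1 : c < 1) :
    x ^ (-a) * y ^ (-b) * z ^ (-c) ≤ m⁻¹ * m⁻¹ * (s ^ (-a) + s ^ (-b) + s ^ (-c)) := by
  have hS : ∀ {x a : ℝ}, s ≤ x → 0 < a → x ^ (-a) ≤ s ^ (-a) := fun h h' =>
    Real.rpow_le_rpow_of_nonpos hs h (by linarith)
  have hM : ∀ {x a : ℝ}, m ≤ x → 0 < a → a < 1 → x ^ (-a) ≤ m⁻¹ := fun {x a} h h' h'' => by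
    calc x ^ (-a) ≤ m ^ (-a) := Real.rpow_le_rpow_of_nonpos hm h (by linarith)
      _ ≤ m ^ (-1 : ℝ) := Real.rpow_le_rpow_of_exponent_ge hm hm1 (by linarith)
      _ = m⁻¹ := Real.rpow_neg_one m
  have hx0 : 0 < x := hs.trans_le hx
  have hy0 : 0 < y := hs.trans_le hy
  have hz0 : 0 < z := hs.trans_le hz
  have pa := Real.rpow_pos_of_pos hs (-a)
  have pb := Real.rpow_pos_of_pos hs (-b)
  have pc := Real.rpow_pos_of_pos hs (-c)
  have pm : 0 < m⁻¹ := inv_pos.2 hm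
  have h3 : ∀ {p q r P Q R : ℝ}, 0 ≤ p → 0 ≤ q → 0 ≤ r → p ≤ P → q ≤ Q → r ≤ R →
      p * q * r ≤ P * Q * R := by
    intro p q r P Q R hp hq hr hP hQ hR
    exact mul_le_mul (mul_le_mul hP hQ hq (hp.trans hP)) hR hr
      (mul_nonneg (hp.trans hP) (hq.trans hQ))
  have px := (Real.rpow_pos_of_pos hx0 (-a)).le
  have py := (Real.rpow_pos_of_pos hy0 (-b)).le
  have pz := (Real.rpow_pos_of_pos hz0 (-c)).le
  have hmm : 0 < m⁻¹ * m⁻¹ := mul_pos pm pm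
  by_cases h1 : m ≤ x
  · by_cases h2 : m ≤ y
    · have := h3 px py pz (hM h1 ha ha1) (hM h2 hb hb1) (hS hz hc)
      nlinarith
    · have h4 : m ≤ z := hyz.resolve_left h2
      have := h3 px py pz (hM h1 ha ha1) (hS hy hb) (hM h4 hc hc1)
      nlinarith
  · have h2 := hxy.resolve_left h1
    have h4 := hxz.resolve_left h1
    have := h3 px py pz (hS hx ha) (hM h2 hb hb1) (hM h4 hc hc1)
    nlinarith

/-- Dominated convergence along radii: `t * w` has distance at least `1 - t` from every corner and
is bounded away from all corners but one, so the integrand is controlled by a sum of the powers `(1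
- t) ^ (-aⱼ)`. These are integrable because `aⱼ < 1`. -/
theorem continuousOn_scMap {z₀ z₁ z₂ : ℂ} {a₀ a₁ a₂ : ℝ} (hz₀ : ‖z₀‖ = 1) (hz₁ : ‖z₁‖ = 1)
    (hz₂ : ‖z₂‖ = 1) (h01 : z₀ ≠ z₁) (h02 : z₀ ≠ z₂) (h12 : z₁ ≠ z₂)
    (ha₀ : 0 < a₀) (ha₁ : 0 < a₁) (ha₂ : 0 < a₂) (hb₀ : a₀ < 1) (hb₁ : a₁ < 1) (hb₂ : a₂ < 1) :
    ContinuousOn (scMap z₀ z₁ z₂ a₀ a₁ a₂) (Metric.closedBall 0 1) := by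
  -- With `m` at most half the distance between any two corners, no point is within `m` of two
  -- corners. The cap at `1` lets `m ^ (-a)` be bounded by `m⁻¹`.
  obtain ⟨m, hm, hm1, m01, m02, m12⟩ : ∃ m : ℝ, 0 < m ∧ m ≤ 1 ∧ 2 * m ≤ ‖z₀ - z₁‖ ∧
      2 * m ≤ ‖z₀ - z₂‖ ∧ 2 * m ≤ ‖z₁ - z₂‖ := by
    have p01 := norm_pos_iff.2 (sub_ne_zero.2 h01)
    have p02 := norm_pos_iff.2 (sub_ne_zero.2 h02)
    have p12 := norm_pos_iff.2 (sub_ne_zero.2 h12)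
    refine ⟨min 1 (min (‖z₀ - z₁‖ / 2) (min (‖z₀ - z₂‖ / 2) (‖z₁ - z₂‖ / 2))), by positivity,
      min_le_left _ _, ?_, ?_, ?_⟩
    · have := (min_le_right 1 (min (‖z₀ - z₁‖ / 2) (min (‖z₀ - z₂‖ / 2) (‖z₁ - z₂‖ / 2)))).trans
        (min_le_left _ _)
      linarith
    · have := (min_le_right 1 (min (‖z₀ - z₁‖ / 2) (min (‖z₀ - z₂‖ / 2) (‖z₁ - z₂‖ / 2)))).trans
        ((min_le_right _ _).trans (min_le_left _ _))
      linarith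
    · have := (min_le_right 1 (min (‖z₀ - z₁‖ / 2) (min (‖z₀ - z₂‖ / 2) (‖z₁ - z₂‖ / 2)))).trans
        ((min_le_right _ _).trans (min_le_right _ _))
      linarith
  have hlt : ∀ w ∈ Metric.closedBall (0 : ℂ) 1, ∀ t ∈ Ico (0 : ℝ) 1, ‖(t : ℂ) * w‖ ≤ t := by
    intro w hw t ht
    rw [norm_mul, Complex.norm_real, Real.norm_of_nonneg ht.1]
    have : ‖w‖ ≤ 1 := by simpa using hw
    nlinarith [ht.1]
  -- The value `t = 1` must be discarded, since `w` itself may be a corner.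
  have hae : ∀ᵐ t : ℝ, t ∈ uIoc (0 : ℝ) 1 → t ∈ Ico (0 : ℝ) 1 := by
    have : ∀ᵐ t : ℝ, t ≠ 1 := by simp [ae_iff, measure_singleton]
    filter_upwards [this] with t h1 h2
    rw [uIoc_of_le zero_le_one] at h2
    exact ⟨h2.1.le, lt_of_le_of_ne h2.2 h1⟩
  intro w hw
  refine ContinuousWithinAt.mul continuousWithinAt_id ?_
  refine intervalIntegral.continuousWithinAt_of_dominated_interval
    (bound := fun t => m⁻¹ * m⁻¹ * ((1 - t) ^ (-a₀) + (1 - t) ^ (-a₁) + (1 - t) ^ (-a₂)))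
    ?_ ?_ ?_ ?_
  · filter_upwards [self_mem_nhdsWithin] with z hz
    have h1 : ContinuousOn (fun t : ℝ => scDeriv z₀ z₁ z₂ a₀ a₁ a₂ (t * z)) (Ico 0 1) := by
      refine (differentiableOn_scDeriv z₀ z₁ z₂ a₀ a₁ a₂).continuousOn.comp (by fun_prop) ?_
      intro t ht
      exact mem_slitDomain_of_norm_lt hz₀ hz₁ hz₂ ((hlt z hz t ht).trans_lt ht.2)
    have h2 := h1.aestronglyMeasurable (μ := volume) measurableSet_Ico
    rw [uIoc_of_le zero_le_one, Measure.restrict_congr_set Ioc_ae_eq_Icc,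
      ← Measure.restrict_congr_set Ico_ae_eq_Icc]
    exact h2
  · filter_upwards [self_mem_nhdsWithin] with z hz
    filter_upwards [hae] with t ht ht'
    have ht := ht ht'
    have hd : ∀ u : ℂ, ‖u‖ = 1 → 1 - t ≤ ‖(t : ℂ) * z - u‖ := by
      intro u hu
      have := norm_sub_norm_le u ((t : ℂ) * z)
      rw [norm_sub_rev, hu] at this
      linarith [hlt z hz t ht]
    have hd2 : ∀ u v : ℂ, 2 * m ≤ ‖u - v‖ → m ≤ ‖(t : ℂ) * z - u‖ ∨ m ≤ ‖(t : ℂ) * z - v‖ := by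
      intro u v huv
      by_contra! h
      have : ‖u - v‖ ≤ ‖(t : ℂ) * z - v‖ + ‖(t : ℂ) * z - u‖ := by
        calc ‖u - v‖ = ‖((t : ℂ) * z - v) - ((t : ℂ) * z - u)‖ := by congr 1; ring
          _ ≤ _ := norm_sub_le _ _
      linarith
    rw [scDeriv, norm_mul, norm_mul, norm_scFactor hz₀, norm_scFactor hz₁, norm_scFactor hz₂]
    exact rpow_prod_le (by linarith [ht.2]) hm hm1 (hd _ hz₀) (hd _ hz₁) (hd _ hz₂)
      (hd2 _ _ m01) (hd2 _ _ m02) (hd2 _ _ m12) ha₀ ha₁ ha₂ hb₀ hb₁ hb₂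
  · have hI : ∀ a : ℝ, a < 1 → IntervalIntegrable (fun t : ℝ => (1 - t) ^ (-a)) volume 0 1 := by
      intro a ha
      have := (intervalIntegral.intervalIntegrable_rpow' (a := 0) (b := 1) (r := -a)
        (by linarith)).comp_sub_left 1
      simpa using this.symm
    exact (((hI _ hb₀).add (hI _ hb₁)).add (hI _ hb₂)).const_mul _
  · filter_upwards [hae] with t ht ht'
    have ht := ht ht'
    have hmem : (t : ℂ) * w ∈ slitDomain z₀ z₁ z₂ :=
      mem_slitDomain_of_norm_lt hz₀ hz₁ hz₂ ((hlt w hw t ht).trans_lt ht.2)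
    have h1 : ContinuousAt (scDeriv z₀ z₁ z₂ a₀ a₁ a₂) (t * w) :=
      ((differentiableOn_scDeriv z₀ z₁ z₂ a₀ a₁ a₂).differentiableAt
        ((isOpen_slitDomain z₀ z₁ z₂).mem_nhds hmem)).continuousAt
    exact (ContinuousAt.comp (f := fun z : ℂ => (t : ℂ) * z) h1 (by fun_prop)).continuousWithinAt

/-- The half-angle formula. For `0 < φ < 2π` it is the polar form, with argument `(φ - π) / 2`
inside the range of the principal logarithm, so real powers can be computed directly. -/
theorem one_sub_exp_mul_I (φ : ℝ) : 1 - Complex.exp (φ * Complex.I) =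
    ((2 * Real.sin (φ / 2) : ℝ) : ℂ) * Complex.exp (((φ - Real.pi) / 2 : ℝ) * Complex.I) := by
  have h1 : (φ - Real.pi) / 2 = φ / 2 - Real.pi / 2 := by ring
  have h2 : φ = 2 * (φ / 2) := by ring
  rw [Complex.exp_mul_I, Complex.exp_mul_I, ← Complex.ofReal_cos, ← Complex.ofReal_cos,
    ← Complex.ofReal_sin, ← Complex.ofReal_sin, h1, Real.cos_sub_pi_div_two,
    Real.sin_sub_pi_div_two]
  apply Complex.ext
  · simp only [Complex.sub_re, Complex.one_re, Complex.add_re, Complex.ofReal_re, Complex.mul_re,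
      Complex.I_re, Complex.I_im, Complex.ofReal_im]
    nth_rw 1 [h2]
    rw [Real.cos_two_mul']
    have := Real.sin_sq_add_cos_sq (φ / 2)
    simp only [Complex.add_im, Complex.mul_im, Complex.ofReal_re, Complex.ofReal_im, Complex.I_re,
      Complex.I_im]
    linear_combination -this
  · simp only [Complex.sub_im, Complex.one_im, Complex.add_im, Complex.ofReal_im, Complex.mul_im,
      Complex.I_re, Complex.I_im, Complex.ofReal_re]
    nth_rw 1 [h2]
    rw [Real.sin_two_mul]
    simp

theorem exp_mul_conj_exp (θ α : ℝ) : Complex.exp (θ * Complex.I) *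
    (starRingEnd ℂ) (Complex.exp (α * Complex.I)) = Complex.exp ((θ - α : ℝ) * Complex.I) := by
  rw [← Complex.exp_conj, ← Complex.exp_add]
  congr 1
  simp
  ring

theorem scFactor_exp {θ α : ℝ} (a : ℝ) (h1 : α < θ) (h2 : θ < α + 2 * Real.pi) :
    scFactor (Complex.exp (α * Complex.I)) a (Complex.exp (θ * Complex.I)) =
      (((2 * Real.sin ((θ - α) / 2)) ^ (-a) : ℝ) : ℂ) *
        Complex.exp ((-a * ((θ - α - Real.pi) / 2) : ℝ) * Complex.I) := by
  have hpos : 0 < 2 * Real.sin ((θ - α) / 2) :=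
    mul_pos two_pos (Real.sin_pos_of_pos_of_lt_pi (by linarith) (by linarith))
  have hπ := Real.pi_pos
  rw [scFactor, exp_mul_conj_exp, one_sub_exp_mul_I, Complex.cpow_def_of_ne_zero
    (mul_ne_zero (Complex.ofReal_ne_zero.2 hpos.ne') (Complex.exp_ne_zero _)),
    Complex.log_ofReal_mul hpos (Complex.exp_ne_zero _), Complex.log_exp
      (by simp; linarith) (by simp; linarith), Real.rpow_def_of_pos hpos, Complex.ofReal_exp,
    ← Complex.exp_add]
  congr 1
  push_cast
  ring

/-- The direction of a side of the image of the Schwarz–Christoffel map. -/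
def scAngle (a₀ a₁ a₂ α₀ α₁ α₂ : ℝ) : ℝ :=
  a₀ * (α₀ + Real.pi) / 2 + a₁ * (α₁ + Real.pi) / 2 + a₂ * (α₂ + Real.pi) / 2 + Real.pi / 2

/-- Each factor contributes `-aⱼ θ / 2` to the argument and the tangent vector of the circle
contributes `θ`. These cancel because the exponents add up to `2`, so the image moves in a constant
direction. -/
theorem scDeriv_boundary {a₀ a₁ a₂ α₀ α₁ α₂ θ : ℝ} (ha : a₀ + a₁ + a₂ = 2)
    (h₀ : α₀ < θ) (h₀' : θ < α₀ + 2 * Real.pi) (h₁ : α₁ < θ) (h₁' : θ < α₁ + 2 * Real.pi)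
    (h₂ : α₂ < θ) (h₂' : θ < α₂ + 2 * Real.pi) :
    ∃ ρ : ℝ, 0 < ρ ∧ scDeriv (Complex.exp (α₀ * Complex.I)) (Complex.exp (α₁ * Complex.I))
      (Complex.exp (α₂ * Complex.I)) a₀ a₁ a₂ (Complex.exp (θ * Complex.I)) *
        (Complex.exp (θ * Complex.I) * Complex.I) =
      ρ * Complex.exp (scAngle a₀ a₁ a₂ α₀ α₁ α₂ * Complex.I) := by
  have hpos : ∀ α : ℝ, α < θ → θ < α + 2 * Real.pi → 0 < 2 * Real.sin ((θ - α) / 2) :=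
    fun α h h' => mul_pos two_pos (Real.sin_pos_of_pos_of_lt_pi (by linarith) (by linarith))
  refine ⟨(2 * Real.sin ((θ - α₀) / 2)) ^ (-a₀) * (2 * Real.sin ((θ - α₁) / 2)) ^ (-a₁) *
    (2 * Real.sin ((θ - α₂) / 2)) ^ (-a₂), ?_, ?_⟩
  · have := Real.rpow_pos_of_pos (hpos _ h₀ h₀') (-a₀)
    have := Real.rpow_pos_of_pos (hpos _ h₁ h₁') (-a₁)
    have := Real.rpow_pos_of_pos (hpos _ h₂ h₂') (-a₂)
    positivity
  · rw [scDeriv, scFactor_exp _ h₀ h₀', scFactor_exp _ h₁ h₁', scFactor_exp _ h₂ h₂']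
    have hI : Complex.I = Complex.exp ((Real.pi / 2 : ℝ) * Complex.I) := by
      push_cast; exact Complex.exp_pi_div_two_mul_I.symm
    have hexp : Complex.exp ((-a₀ * ((θ - α₀ - Real.pi) / 2) : ℝ) * Complex.I) *
        Complex.exp ((-a₁ * ((θ - α₁ - Real.pi) / 2) : ℝ) * Complex.I) *
        Complex.exp ((-a₂ * ((θ - α₂ - Real.pi) / 2) : ℝ) * Complex.I) *
        (Complex.exp (θ * Complex.I) * Complex.exp ((Real.pi / 2 : ℝ) * Complex.I)) =
        Complex.exp (scAngle a₀ a₁ a₂ α₀ α₁ α₂ * Complex.I) := by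
      rw [← Complex.exp_add, ← Complex.exp_add, ← Complex.exp_add, ← Complex.exp_add]
      congr 1
      rw [← add_mul, ← add_mul, ← add_mul, ← add_mul]
      congr 1
      norm_cast
      rw [scAngle]
      linear_combination (-θ / 2) * ha
    rw [← hexp, ← hI]
    push_cast
    ring

theorem norm_exp_mul_I (θ : ℝ) : ‖Complex.exp (θ * Complex.I)‖ = 1 :=
  Complex.norm_exp_ofReal_mul_I θ

theorem exp_mul_I_ne {θ α : ℝ} (h1 : α < θ) (h2 : θ < α + 2 * Real.pi) :
    Complex.exp (θ * Complex.I) ≠ Complex.exp (α * Complex.I) := by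
  intro h
  obtain ⟨n, hn⟩ := Complex.exp_eq_exp_iff_exists_int.1 h
  have h3 : (θ : ℂ) = ((α + n * (2 * Real.pi) : ℝ) : ℂ) := by
    apply mul_right_cancel₀ Complex.I_ne_zero
    rw [hn]; push_cast; ring
  have h4 : θ = α + n * (2 * Real.pi) := by exact_mod_cast h3
  have hπ := Real.pi_pos
  have h5 : (0 : ℝ) < n := by by_contra! h; nlinarith
  have h6 : (n : ℝ) < 1 := by by_contra! h; nlinarith
  have h7 : 0 < n := by exact_mod_cast h5
  have h8 : n < 1 := by exact_mod_cast h6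
  omega

/-- On an arc between two corners, the Schwarz–Christoffel map moves along a line. -/
theorem scMap_arc {a₀ a₁ a₂ α₀ α₁ α₂ α β : ℝ} {z₀ z₁ z₂ : ℂ} (ha : a₀ + a₁ + a₂ = 2)
    (hz₀ : z₀ = Complex.exp (α₀ * Complex.I)) (hz₁ : z₁ = Complex.exp (α₁ * Complex.I))
    (hz₂ : z₂ = Complex.exp (α₂ * Complex.I))
    (h₀ : α₀ ≤ α) (h₀' : β ≤ α₀ + 2 * Real.pi) (h₁ : α₁ ≤ α) (h₁' : β ≤ α₁ + 2 * Real.pi)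
    (h₂ : α₂ ≤ α) (h₂' : β ≤ α₂ + 2 * Real.pi)
    (hc : ContinuousOn (scMap z₀ z₁ z₂ a₀ a₁ a₂) (Metric.closedBall 0 1)) :
    ∃ R : ℝ → ℝ, StrictMonoOn R (Icc α β) ∧ ContinuousOn R (Icc α β) ∧ R α = 0 ∧
      ∀ θ ∈ Icc α β, scMap z₀ z₁ z₂ a₀ a₁ a₂ (Complex.exp (θ * Complex.I)) =
        scMap z₀ z₁ z₂ a₀ a₁ a₂ (Complex.exp (α * Complex.I)) +
          R θ * Complex.exp (scAngle a₀ a₁ a₂ α₀ α₁ α₂ * Complex.I) := by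
  set c := scAngle a₀ a₁ a₂ α₀ α₁ α₂ with hcdef
  set f := scMap z₀ z₁ z₂ a₀ a₁ a₂ with hf
  -- After rotation by the side direction the derivative is real and positive, so the imaginary part
  -- stays zero and the real part serves as `R`.
  let h : ℝ → ℂ := fun θ => (f (Complex.exp (θ * Complex.I)) -
    f (Complex.exp (α * Complex.I))) * Complex.exp (-(c * Complex.I))
  have hcont : ContinuousOn h (Icc α β) := by
    refine ContinuousOn.mul (ContinuousOn.sub ?_ continuousOn_const) continuousOn_const
    exact hc.comp (by fun_prop) fun θ _ => by simp
  have hder : ∀ θ ∈ Ioo α β, ∃ ρ : ℝ, 0 < ρ ∧ HasDerivAt h (ρ : ℂ) θ := by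
    intro θ hθ
    obtain ⟨ρ, hρ, he⟩ := scDeriv_boundary (θ := θ) ha (h₀.trans_lt hθ.1) (hθ.2.trans_le h₀')
      (h₁.trans_lt hθ.1) (hθ.2.trans_le h₁') (h₂.trans_lt hθ.1) (hθ.2.trans_le h₂')
    rw [← hz₀, ← hz₁, ← hz₂] at he
    refine ⟨ρ, hρ, ?_⟩
    have hmem : Complex.exp (θ * Complex.I) ∈ slitDomain z₀ z₁ z₂ := by
      refine mem_slitDomain (by rw [hz₀, norm_exp_mul_I]) (by rw [hz₁, norm_exp_mul_I])
        (by rw [hz₂, norm_exp_mul_I]) (norm_exp_mul_I θ).le ?_ ?_ ?_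
      · rw [hz₀]; exact exp_mul_I_ne (h₀.trans_lt hθ.1) (hθ.2.trans_le h₀')
      · rw [hz₁]; exact exp_mul_I_ne (h₁.trans_lt hθ.1) (hθ.2.trans_le h₁')
      · rw [hz₂]; exact exp_mul_I_ne (h₂.trans_lt hθ.1) (hθ.2.trans_le h₂')
    have d1 : HasDerivAt (fun θ : ℝ => Complex.exp (θ * Complex.I))
        (Complex.exp (θ * Complex.I) * Complex.I) θ := by
      have h3 : HasDerivAt (fun t : ℝ => (t : ℂ)) 1 θ := by
        simpa using (hasDerivAt_id θ).ofReal_comp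
      have h4 : HasDerivAt (fun t : ℝ => (t : ℂ) * Complex.I) Complex.I θ := by
        simpa using h3.mul_const Complex.I
      exact h4.cexp
    have d2 := (hasDerivAt_scMap a₀ a₁ a₂ hmem).comp θ d1
    have d3 := (d2.sub_const (f (Complex.exp (α * Complex.I)))).mul_const
      (Complex.exp (-(c * Complex.I)))
    refine d3.congr_deriv ?_
    rw [he, mul_assoc, ← Complex.exp_add, add_neg_cancel, Complex.exp_zero, mul_one]
  have hα : h α = 0 := by simp [h]
  have him : ∀ θ ∈ Icc α β, (h θ).im = 0 := by
    intro θ hθ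
    rcases hθ.1.eq_or_lt with rfl | hlt
    · rw [hα]; rfl
    · obtain ⟨x, hx, hs⟩ := exists_hasDerivAt_eq_slope (fun θ => (h θ).im) (fun _ => 0) hlt
        ((Complex.continuous_im.comp_continuousOn hcont).mono (Icc_subset_Icc_right hθ.2)) (by
          intro x hx
          obtain ⟨ρ, hρ, hd⟩ := hder x ⟨hx.1, hx.2.trans_le hθ.2⟩
          have := Complex.imCLM.hasFDerivAt.comp_hasDerivAt x hd
          exact this.congr_deriv (by simp))
      rw [hα, eq_div_iff (by linarith), zero_mul] at hs
      simpa using hs.symm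
  refine ⟨fun θ => (h θ).re, ?_, Complex.continuous_re.comp_continuousOn hcont, by simp [hα], ?_⟩
  · refine strictMonoOn_of_deriv_pos (convex_Icc α β)
      (Complex.continuous_re.comp_continuousOn hcont) ?_
    intro θ hθ
    rw [interior_Icc] at hθ
    obtain ⟨ρ, hρ, hd⟩ := hder θ hθ
    have : HasDerivAt (fun θ => (h θ).re) ρ θ := by
      have := Complex.reCLM.hasFDerivAt.comp_hasDerivAt θ hd
      exact this.congr_deriv (by simp)
    rw [this.deriv]
    exact hρ
  · intro θ hθ
    have h1 : ((h θ).re : ℂ) = h θ := Complex.ext (by simp) (by simp [him θ hθ])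
    rw [h1]
    simp only [h]
    rw [mul_assoc, ← Complex.exp_add]
    simp

/-! ### Conformal maps of the disc determined by boundary behaviour -/

/-- Maximum principle for half planes. -/
theorem re_mul_le_of_sphere {f : ℂ → ℂ} (hc : ContinuousOn f (Metric.closedBall 0 1))
    (hd : DifferentiableOn ℂ f (Metric.ball 0 1)) {c : ℂ} {k : ℝ}
    (hk : ∀ w ∈ Metric.sphere (0 : ℂ) 1, (c * f w).re ≤ k) :
    ∀ w ∈ Metric.closedBall (0 : ℂ) 1, (c * f w).re ≤ k := by
  intro w hw
  have hcl : closure (Metric.ball (0 : ℂ) 1) = Metric.closedBall 0 1 :=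
    closure_ball _ one_ne_zero
  -- The norm of `exp (c * f)` is the exponential of `(c * f).re`, so the maximum modulus principle
  -- applies to it.
  have hdc : DiffContOnCl ℂ (fun w => Complex.exp (c * f w)) (Metric.ball 0 1) := by
    refine ⟨(hd.const_mul c).cexp, ?_⟩
    rw [hcl]
    exact (continuousOn_const.mul hc).cexp
  have := Complex.norm_le_of_forall_mem_frontier_norm_le Metric.isBounded_ball hdc
    (C := Real.exp k) (fun z hz => by
      rw [frontier_ball _ one_ne_zero] at hz
      rw [Complex.norm_exp]
      exact Real.exp_le_exp.2 (hk z hz)) (z := w) (by rw [hcl]; exact hw)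
  rw [Complex.norm_exp] at this
  exact Real.exp_le_exp.1 this

theorem map_nhds_of_hasDerivAt {f : ℂ → ℂ} {U : Set ℂ} (hU : IsOpen U)
    (hd : DifferentiableOn ℂ f U) {w : ℂ} (hw : w ∈ U) (h0 : deriv f w ≠ 0) :
    Filter.map f (𝓝 w) = 𝓝 (f w) ∧ ∃ V ∈ 𝓝 w, InjOn f V := by
  have hs : HasStrictDerivAt f (deriv f w) w :=
    (hd.analyticAt (hU.mem_nhds hw)).hasStrictDerivAt
  refine ⟨hs.map_nhds_eq h0, ?_⟩
  have hs' := hs.hasStrictFDerivAt_equiv h0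
  exact ⟨(hs'.toOpenPartialHomeomorph f).source,
    (hs'.toOpenPartialHomeomorph f).open_source.mem_nhds hs'.mem_toOpenPartialHomeomorph_source,
    (hs'.toOpenPartialHomeomorph f).injOn⟩

/-- The strict form of the maximum principle for half planes. -/
theorem re_mul_lt_of_sphere {f : ℂ → ℂ} (hc : ContinuousOn f (Metric.closedBall 0 1))
    (hd : DifferentiableOn ℂ f (Metric.ball 0 1))
    (h0 : ∀ w ∈ Metric.ball (0 : ℂ) 1, deriv f w ≠ 0) {c : ℂ} (hc0 : c ≠ 0) {k : ℝ}
    (hk : ∀ w ∈ Metric.sphere (0 : ℂ) 1, (c * f w).re ≤ k) :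
    ∀ w ∈ Metric.ball (0 : ℂ) 1, (c * f w).re < k := by
  intro w hw
  have hle := re_mul_le_of_sphere hc hd hk
  refine lt_of_le_of_ne (hle w (Metric.ball_subset_closedBall hw)) fun heq => ?_
  -- If the bound were attained at `w`, openness of `f` there would make `f w + t * c⁻¹` a value for
  -- small `t > 0`, and the real part would exceed `k` by `t`.
  have hmap := (map_nhds_of_hasDerivAt Metric.isOpen_ball hd hw (h0 w hw)).1
  have hev : ∀ᶠ p in 𝓝 (f w), (c * p).re ≤ k := by
    rw [← hmap, Filter.eventually_map]
    filter_upwards [Metric.isOpen_ball.mem_nhds hw] with z hz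
    exact hle z (Metric.ball_subset_closedBall hz)
  have ht : Tendsto (fun t : ℝ => f w + t * c⁻¹) (𝓝[>] 0) (𝓝 (f w)) := by
    have : Continuous fun t : ℝ => f w + t * c⁻¹ := by fun_prop
    have h2 := this.tendsto 0
    simp only [Complex.ofReal_zero, zero_mul, add_zero] at h2
    exact h2.mono_left nhdsWithin_le_nhds
  obtain ⟨t, ht1, ht2⟩ := ((ht.eventually hev).and self_mem_nhdsWithin).exists
  rw [mul_add, Complex.add_re, heq, mul_left_comm, mul_inv_cancel₀ hc0] at ht1
  simp at ht1
  have : 0 < t := ht2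
  linarith

/-- A map of the disc onto a domain that is holomorphic without critical points, proper, and
injective near some boundary point, is bijective. -/
theorem bijOn_ball_of_boundary {f : ℂ → ℂ} {T : Set ℂ}
    (hc : ContinuousOn f (Metric.closedBall 0 1)) (hd : DifferentiableOn ℂ f (Metric.ball 0 1))
    (h0 : ∀ w ∈ Metric.ball (0 : ℂ) 1, deriv f w ≠ 0)
    (hT : IsPreconnected T) (hTo : IsOpen T) (hball : ∀ w ∈ Metric.ball (0 : ℂ) 1, f w ∈ T)
    (hsph : ∀ w ∈ Metric.sphere (0 : ℂ) 1, f w ∉ T) {w₁ : ℂ} (hw₁ : w₁ ∈ Metric.sphere (0 : ℂ) 1)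
    (huniq : ∀ w ∈ Metric.sphere (0 : ℂ) 1, f w = f w₁ → w = w₁)
    (hinj : ∃ V ∈ 𝓝 w₁, InjOn f V) : BijOn f (Metric.ball 0 1) T := by
  have hloc := fun w hw => map_nhds_of_hasDerivAt Metric.isOpen_ball hd hw (h0 w hw)
  have hmem : ∀ w ∈ Metric.closedBall (0 : ℂ) 1, f w ∈ T → w ∈ Metric.ball (0 : ℂ) 1 := by
    intro w hw hwT
    rcases (mem_closedBall_zero_iff.1 hw).lt_or_eq with h | h
    · simpa using h
    · exact absurd hwT (hsph w (by simpa using h))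
  refine ⟨hball, ?_, ?_⟩
  · -- injectivity
    -- The set of values taken twice is open and relatively closed in the connected set `T`, so it
    -- is empty or all of `T`; the boundary point `w₁` excludes the latter.
    set B : Set ℂ := {p | p ∈ T ∧ ∃ a ∈ Metric.ball (0 : ℂ) 1, ∃ b ∈ Metric.ball (0 : ℂ) 1,
      a ≠ b ∧ f a = p ∧ f b = p} with hB
    -- Pass to convergent subsequences of the two preimages. Their limits can coincide only at a
    -- point where `f` fails to be locally injective.
    have hlim : ∀ q : ℂ, q ∈ closure B → ∃ a ∈ Metric.closedBall (0 : ℂ) 1,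
        ∃ b ∈ Metric.closedBall (0 : ℂ) 1, f a = q ∧ f b = q ∧
          (a = b → ¬ ∃ V ∈ 𝓝 a, InjOn f V) := by
      intro q hq
      obtain ⟨p, hpB, hpq⟩ := mem_closure_iff_seq_limit.1 hq
      choose hpT a ha b hb hab hfa hfb using hpB
      have hcomp : IsCompact (Metric.closedBall (0 : ℂ) 1 ×ˢ Metric.closedBall (0 : ℂ) 1) :=
        (isCompact_closedBall _ _).prod (isCompact_closedBall _ _)
      obtain ⟨⟨a', b'⟩, hab', φ, hφ, hlim⟩ := hcomp.tendsto_subseq (x := fun n => (a n, b n))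
        (fun n => ⟨Metric.ball_subset_closedBall (ha n), Metric.ball_subset_closedBall (hb n)⟩)
      have hla : Tendsto (fun n => a (φ n)) atTop (𝓝 a') := (continuous_fst.tendsto _).comp hlim
      have hlb : Tendsto (fun n => b (φ n)) atTop (𝓝 b') := (continuous_snd.tendsto _).comp hlim
      have hq' : Tendsto (fun n => p (φ n)) atTop (𝓝 q) := hpq.comp hφ.tendsto_atTop
      have hfa' : Tendsto (fun n => f (a (φ n))) atTop (𝓝 (f a')) :=
        (hc a' hab'.1).tendsto.comp (tendsto_nhdsWithin_iff.2
          ⟨hla, Eventually.of_forall fun n => Metric.ball_subset_closedBall (ha _)⟩)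
      have hfb' : Tendsto (fun n => f (b (φ n))) atTop (𝓝 (f b')) :=
        (hc b' hab'.2).tendsto.comp (tendsto_nhdsWithin_iff.2
          ⟨hlb, Eventually.of_forall fun n => Metric.ball_subset_closedBall (hb _)⟩)
      refine ⟨a', hab'.1, b', hab'.2, ?_, ?_, ?_⟩
      · exact tendsto_nhds_unique (hfa'.congr fun n => hfa _) hq'
      · exact tendsto_nhds_unique (hfb'.congr fun n => hfb _) hq'
      · rintro rfl ⟨V, hV, hVi⟩
        obtain ⟨n, hn1, hn2⟩ := ((hla.eventually hV).and (hlb.eventually hV)).exists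
        exact hab _ (hVi hn1 hn2 ((hfa _).trans (hfb _).symm))
    have hBo : IsOpen B := by
      rw [isOpen_iff_mem_nhds]
      rintro p ⟨hpT, a, ha, b, hb, hab, rfl, hfb⟩
      obtain ⟨U, V, hU, hV, haU, hbV, hUV⟩ := t2_separation hab
      have h1 : f '' (U ∩ Metric.ball 0 1) ∈ 𝓝 (f a) := by
        rw [← (hloc a ha).1]
        exact image_mem_map (inter_mem (hU.mem_nhds haU) (Metric.isOpen_ball.mem_nhds ha))
      have h2 : f '' (V ∩ Metric.ball 0 1) ∈ 𝓝 (f a) := by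
        rw [← hfb, ← (hloc b hb).1]
        exact image_mem_map (inter_mem (hV.mem_nhds hbV) (Metric.isOpen_ball.mem_nhds hb))
      filter_upwards [h1, h2, hTo.mem_nhds hpT] with q hq1 hq2 hqT
      obtain ⟨a', ha', rfl⟩ := hq1
      obtain ⟨b', hb', hfb'⟩ := hq2
      exact ⟨hqT, a', ha'.2, b', hb'.2, fun h => disjoint_left.1 hUV ha'.1 (h ▸ hb'.1), rfl, hfb'⟩
    have hBcl : closure B ∩ T ⊆ B := by
      rintro q ⟨hq, hqT⟩
      obtain ⟨a, ha, b, hb, hfa, hfb, hne⟩ := hlim q hq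
      have ha' := hmem a ha (by rw [hfa]; exact hqT)
      have hb' := hmem b hb (by rw [hfb]; exact hqT)
      exact ⟨hqT, a, ha', b, hb', fun h => hne h (hloc a ha').2, hfa, hfb⟩
    have hw₁B : f w₁ ∉ closure B := by
      intro h
      obtain ⟨a, ha, b, hb, hfa, hfb, hne⟩ := hlim _ h
      have key : ∀ w ∈ Metric.closedBall (0 : ℂ) 1, f w = f w₁ → w = w₁ := by
        intro w hw hfw
        refine huniq w ?_ hfw
        rcases (mem_closedBall_zero_iff.1 hw).lt_or_eq with h | h
        · exact absurd (hball w (by simpa using h)) (by rw [hfw]; exact hsph w₁ hw₁)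
        · simpa using h
      obtain rfl := key a ha hfa
      obtain rfl := key b hb hfb
      exact hne rfl hinj
    have hBempty : B = ∅ := by
      by_contra hBne
      obtain ⟨p, hp⟩ := nonempty_iff_ne_empty.2 hBne
      have hTB : T ⊆ B := by
        refine hT.subset_of_closure_inter_subset hBo ⟨p, hp.1, hp⟩ hBcl
      apply hw₁B
      have hcl : w₁ ∈ closure (Metric.ball (0 : ℂ) 1) := by
        rw [closure_ball _ one_ne_zero]; exact Metric.sphere_subset_closedBall hw₁
      have := (hc w₁ (Metric.sphere_subset_closedBall hw₁)).mono
        Metric.ball_subset_closedBall |>.mem_closure_image hcl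
      refine closure_mono ?_ this
      rintro _ ⟨w, hw, rfl⟩
      exact hTB (hball w hw)
    intro a ha b hb hab
    by_contra hne
    have : f a ∈ B := ⟨hball a ha, a, ha, b, hb, hne, rfl, hab.symm⟩
    rw [hBempty] at this
    exact this
  · -- surjectivity
    have ho : IsOpen (f '' Metric.ball 0 1) := by
      rw [isOpen_iff_mem_nhds]
      rintro _ ⟨a, ha, rfl⟩
      rw [← (hloc a ha).1]
      exact image_mem_map (Metric.isOpen_ball.mem_nhds ha)
    have hcomp : IsClosed (f '' Metric.closedBall 0 1) :=
      ((isCompact_closedBall (0 : ℂ) 1).image_of_continuousOn hc).isClosed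
    refine hT.subset_of_closure_inter_subset ho
      ⟨f 0, hball 0 (by simp), 0, by simp, rfl⟩ ?_
    rintro q ⟨hq, hqT⟩
    obtain ⟨w, hw, rfl⟩ := hcomp.closure_subset_iff.2
      (image_mono Metric.ball_subset_closedBall) hq
    exact ⟨w, hmem w hw hqT, rfl⟩

/-! ### Rigidity -/

/-- A holomorphic function on the disc whose boundary values lie on finitely many lines through
the origin, here given by a closed cone with empty interior, is constant. -/
theorem eqOn_const_of_sphere_cone {k : ℂ → ℂ} {S : Set ℂ}
    (hc : ContinuousOn k (Metric.closedBall 0 1)) (hd : DifferentiableOn ℂ k (Metric.ball 0 1))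
    (hS : ∀ p : ℂ, ∀ t : ℝ, 1 ≤ t → t * p ∈ S → p ∈ S) (hint : interior S = ∅)
    (h0 : (0 : ℂ) ∈ S)
    (hsph : ∀ w ∈ Metric.sphere (0 : ℂ) 1, k w ∈ S) :
    ∃ c, ∀ w ∈ Metric.closedBall (0 : ℂ) 1, k w = c := by
  rcases (hd.analyticOnNhd Metric.isOpen_ball).is_constant_or_isOpen
    (convex_ball (0 : ℂ) 1).isPreconnected with ⟨c, hcst⟩ | hopen
  · refine ⟨c, fun w hw => ?_⟩
    have hcl : closure (Metric.ball (0 : ℂ) 1) = Metric.closedBall 0 1 :=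
      closure_ball _ one_ne_zero
    have h1 : EqOn k (fun _ => c) (closure (Metric.ball (0 : ℂ) 1)) :=
      EqOn.of_subset_closure hcst (by rw [hcl]; exact hc) continuousOn_const subset_closure subset_rfl
    exact h1 (by rw [hcl]; exact hw)
  · exfalso
    have ho := hopen _ subset_rfl Metric.isOpen_ball
    obtain ⟨p, ⟨w₀, hw₀, hp⟩, hpS⟩ : ∃ p ∈ k '' Metric.ball 0 1, p ∉ S := by
      by_contra! h
      have : k '' Metric.ball 0 1 ⊆ interior S := interior_maximal h ho
      rw [hint] at this
      exact this ⟨0, by simp, rfl⟩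
    have hp0 : p ≠ 0 := fun h => hpS (h ▸ h0)
    have hK : IsCompact (k '' Metric.closedBall 0 1) :=
      (isCompact_closedBall (0 : ℂ) 1).image_of_continuousOn hc
    -- Push `p ∉ S` outwards to the last multiple in the image. It cannot come from the circle, for
    -- then `p ∈ S`, nor from the open disc, where the image is open and reaches farther.
    set Z : Set ℝ := {t | 1 ≤ t ∧ (t : ℂ) * p ∈ k '' Metric.closedBall 0 1} with hZ
    have hZc : IsClosed Z := by
      refine isClosed_Ici.inter (hK.isClosed.preimage ?_)
      fun_prop
    have h1Z : (1 : ℝ) ∈ Z := ⟨le_rfl, w₀, Metric.ball_subset_closedBall hw₀, by simp [hp]⟩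
    obtain ⟨M, hM⟩ := hK.isBounded.exists_norm_le
    have hZb : BddAbove Z := by
      refine ⟨M / ‖p‖, fun t ht => ?_⟩
      rw [le_div_iff₀ (norm_pos_iff.2 hp0)]
      have := hM _ ht.2
      rwa [norm_mul, Complex.norm_real, Real.norm_of_nonneg (zero_le_one.trans ht.1)] at this
    have hs := hZc.csSup_mem ⟨1, h1Z⟩ hZb
    obtain ⟨h1s, w, hw, hkw⟩ := hs
    have hwb : w ∈ Metric.ball (0 : ℂ) 1 := by
      rcases (mem_closedBall_zero_iff.1 hw).lt_or_eq with h | h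
      · simpa using h
      · exact absurd (hS p _ h1s (hkw ▸ hsph w (by simpa using h))) hpS
    have hnhds : k '' Metric.ball 0 1 ∈ 𝓝 (((sSup Z : ℝ) : ℂ) * p) :=
      ho.mem_nhds ⟨w, hwb, hkw⟩
    have ht : Tendsto (fun t : ℝ => (t : ℂ) * p) (𝓝[>] (sSup Z)) (𝓝 (((sSup Z : ℝ) : ℂ) * p)) := by
      have : Continuous fun t : ℝ => (t : ℂ) * p := by fun_prop
      exact (this.tendsto _).mono_left nhdsWithin_le_nhds
    obtain ⟨t, ht1, ht2⟩ := ((ht.eventually hnhds).and self_mem_nhdsWithin).exists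
    have ht2 : sSup Z < t := ht2
    have : t ∈ Z := ⟨h1s.trans ht2.le, image_mono Metric.ball_subset_closedBall ht1⟩
    exact absurd (le_csSup hZb this) (not_le.2 ht2)

/-! ### The standard conformal triangle -/

/-- The turning angle from `u` to `v` is the argument of `conj u * v`, which lies strictly between
`0` and `π` in the upper half plane. -/
theorem exists_exterior_angle {u v : ℂ} (h : 0 < ((starRingEnd ℂ) u * v).im) :
    ∃ a : ℝ, 0 < a ∧ a < 1 ∧
      v * (‖u‖ : ℂ) = u * ((‖v‖ : ℂ) * Complex.exp ((Real.pi * a : ℝ) * Complex.I)) := by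
  have hπ := Real.pi_pos
  have hu : u ≠ 0 := by rintro rfl; simp at h
  have hnu : (‖u‖ : ℂ) ≠ 0 := by simpa using hu
  set p := (starRingEnd ℂ) u * v with hp
  have h0 : 0 < p.arg := by
    refine lt_of_le_of_ne (Complex.arg_nonneg_iff.2 h.le) fun h' => ?_
    have := (Complex.arg_eq_zero_iff.1 h'.symm).2
    linarith
  have h1 : p.arg < Real.pi := by
    refine lt_of_le_of_ne (Complex.arg_le_pi p) fun h' => ?_
    have := (Complex.arg_eq_pi_iff.1 h').2
    linarith
  refine ⟨p.arg / Real.pi, by positivity, by rwa [div_lt_one hπ], ?_⟩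
  rw [mul_div_cancel₀ _ hπ.ne']
  have h2 := Complex.norm_mul_exp_arg_mul_I p
  have h3 : ‖p‖ = ‖u‖ * ‖v‖ := by rw [hp, norm_mul, RCLike.norm_conj]
  have h4 : u * (starRingEnd ℂ) u = (‖u‖ : ℂ) * ‖u‖ := by
    rw [Complex.mul_conj, Complex.normSq_eq_norm_sq]; push_cast; ring
  rw [h3] at h2
  apply mul_left_cancel₀ hnu
  calc (‖u‖ : ℂ) * (v * ‖u‖) = v * (u * (starRingEnd ℂ) u) := by rw [h4]; ring
    _ = u * p := by rw [hp]; ring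
    _ = u * (((‖u‖ * ‖v‖ : ℝ) : ℂ) * Complex.exp (p.arg * Complex.I)) := by rw [h2]
    _ = _ := by push_cast; ring

/-- The three turns compose to the identity, so the `aⱼ` add up to an even integer; being in `(0,
1)`, they add up to `2`. -/
theorem exists_exterior_angles {e₀ e₁ e₂ : ℂ} (h01 : 0 < ((starRingEnd ℂ) e₀ * e₁).im)
    (h12 : 0 < ((starRingEnd ℂ) e₁ * e₂).im) (h20 : 0 < ((starRingEnd ℂ) e₂ * e₀).im) :
    ∃ a₀ a₁ a₂ : ℝ, 0 < a₀ ∧ a₀ < 1 ∧ 0 < a₁ ∧ a₁ < 1 ∧ 0 < a₂ ∧ a₂ < 1 ∧ a₀ + a₁ + a₂ = 2 ∧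
      e₁ * (‖e₀‖ : ℂ) = e₀ * ((‖e₁‖ : ℂ) * Complex.exp ((Real.pi * a₁ : ℝ) * Complex.I)) ∧
      e₂ * (‖e₁‖ : ℂ) = e₁ * ((‖e₂‖ : ℂ) * Complex.exp ((Real.pi * a₂ : ℝ) * Complex.I)) := by
  obtain ⟨a₁, p1, q1, r1⟩ := exists_exterior_angle h01
  obtain ⟨a₂, p2, q2, r2⟩ := exists_exterior_angle h12
  obtain ⟨a₀, p0, q0, r0⟩ := exists_exterior_angle h20
  refine ⟨a₀, a₁, a₂, p0, q0, p1, q1, p2, q2, ?_, r1, r2⟩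
  have n0 : e₀ ≠ 0 := by rintro rfl; simp at h01
  have n1 : e₁ ≠ 0 := by rintro rfl; simp at h01
  have n2 : e₂ ≠ 0 := by rintro rfl; simp at h20
  have m0 : (‖e₀‖ : ℂ) ≠ 0 := by simpa using n0
  have m1 : (‖e₁‖ : ℂ) ≠ 0 := by simpa using n1
  have m2 : (‖e₂‖ : ℂ) ≠ 0 := by simpa using n2
  have hprod : Complex.exp ((Real.pi * a₀ : ℝ) * Complex.I) *
      Complex.exp ((Real.pi * a₁ : ℝ) * Complex.I) *
      Complex.exp ((Real.pi * a₂ : ℝ) * Complex.I) = 1 := by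
    have hne : e₀ * e₁ * e₂ * (‖e₀‖ : ℂ) * ‖e₁‖ * ‖e₂‖ ≠ 0 := by
      simp only [ne_eq, mul_eq_zero, not_or]
      exact ⟨⟨⟨⟨⟨n0, n1⟩, n2⟩, m0⟩, m1⟩, m2⟩
    apply mul_left_cancel₀ hne
    calc _ = (e₀ * ((‖e₁‖ : ℂ) * Complex.exp ((Real.pi * a₁ : ℝ) * Complex.I))) *
        (e₁ * ((‖e₂‖ : ℂ) * Complex.exp ((Real.pi * a₂ : ℝ) * Complex.I))) *
        (e₂ * ((‖e₀‖ : ℂ) * Complex.exp ((Real.pi * a₀ : ℝ) * Complex.I))) := by ring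
      _ = _ := by rw [← r0, ← r1, ← r2]; ring
  rw [← Complex.exp_add, ← Complex.exp_add, Complex.exp_eq_one_iff] at hprod
  obtain ⟨n, hn⟩ := hprod
  have hπ := Real.pi_pos
  have h3 : ((Real.pi * (a₀ + a₁ + a₂) : ℝ) : ℂ) = ((n * (2 * Real.pi) : ℝ) : ℂ) := by
    apply mul_right_cancel₀ Complex.I_ne_zero
    push_cast at hn ⊢
    linear_combination hn
  have h4 : Real.pi * (a₀ + a₁ + a₂) = n * (2 * Real.pi) := by exact_mod_cast h3
  have h5 : a₀ + a₁ + a₂ = 2 * n := by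
    apply mul_left_cancel₀ hπ.ne'; rw [h4]; ring
  have h6 : (0 : ℝ) < n := by linarith
  have h7 : (n : ℝ) < 2 := by linarith
  have h8 : n = 1 := by
    have : 0 < n := by exact_mod_cast h6
    have : n < 2 := by exact_mod_cast h7
    omega
  rw [h5, h8]; norm_num

theorem exp_sub_two_pi (θ : ℝ) : Complex.exp (θ * Complex.I) =
    Complex.exp ((θ - 2 * Real.pi : ℝ) * Complex.I) := by
  rw [Complex.exp_eq_exp_iff_exists_int]
  exact ⟨1, by push_cast; ring⟩

/-- A conformal map from the disc to a triangle with given side directions, normalized by the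
side lengths `Lₖ ‖eₖ‖`, with prescribed corners on the unit circle. -/
theorem exists_conformal_triangle {e₀ e₁ e₂ : ℂ} {L₀ L₁ L₂ θ₀ θ₁ θ₂ : ℝ} (hL₀ : 0 < L₀)
    (hL₁ : 0 < L₁) (hL₂ : 0 < L₂) (hsum : L₀ * e₀ + L₁ * e₁ + L₂ * e₂ = 0)
    (h01 : 0 < ((starRingEnd ℂ) e₀ * e₁).im) (hθ01 : θ₀ < θ₁) (hθ12 : θ₁ < θ₂)
    (hθ20 : θ₂ < θ₀ + 2 * Real.pi) :
    ∃ (H : ℂ → ℂ) (U : Set ℂ) (Q₀ Q₁ Q₂ : ℝ → ℝ), ContinuousOn H (Metric.closedBall 0 1) ∧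
      IsOpen U ∧ (∀ w ∈ Metric.closedBall (0 : ℂ) 1, w ≠ Complex.exp (θ₀ * Complex.I) →
        w ≠ Complex.exp (θ₁ * Complex.I) → w ≠ Complex.exp (θ₂ * Complex.I) → w ∈ U) ∧
      DifferentiableOn ℂ H U ∧ (∀ w ∈ U, deriv H w ≠ 0) ∧
      (StrictMonoOn Q₀ (Icc θ₀ θ₁) ∧ ContinuousOn Q₀ (Icc θ₀ θ₁) ∧ Q₀ θ₀ = 0 ∧ Q₀ θ₁ = L₀ ∧
        ∀ θ ∈ Icc θ₀ θ₁, H (Complex.exp (θ * Complex.I)) = Q₀ θ * e₀) ∧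
      (StrictMonoOn Q₁ (Icc θ₁ θ₂) ∧ ContinuousOn Q₁ (Icc θ₁ θ₂) ∧ Q₁ θ₁ = 0 ∧ Q₁ θ₂ = L₁ ∧
        ∀ θ ∈ Icc θ₁ θ₂, H (Complex.exp (θ * Complex.I)) = L₀ * e₀ + Q₁ θ * e₁) ∧
      (StrictMonoOn Q₂ (Icc θ₂ (θ₀ + 2 * Real.pi)) ∧
        ContinuousOn Q₂ (Icc θ₂ (θ₀ + 2 * Real.pi)) ∧ Q₂ θ₂ = 0 ∧ Q₂ (θ₀ + 2 * Real.pi) = L₂ ∧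
        ∀ θ ∈ Icc θ₂ (θ₀ + 2 * Real.pi), H (Complex.exp (θ * Complex.I)) =
          L₀ * e₀ + L₁ * e₁ + Q₂ θ * e₂) := by
  have hπ := Real.pi_pos
  -- Pairing the closing relation with one side direction eliminates that side. This is the law of
  -- sines.
  have he12 : L₂ * ((starRingEnd ℂ) e₁ * e₂).im = L₀ * ((starRingEnd ℂ) e₀ * e₁).im := by
    have := congrArg (fun z => ((starRingEnd ℂ) e₁ * z).im) hsum
    simp at this ⊢
    linarith
  have he20 : L₂ * ((starRingEnd ℂ) e₂ * e₀).im = L₁ * ((starRingEnd ℂ) e₀ * e₁).im := by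
    have := congrArg (fun z => ((starRingEnd ℂ) e₀ * z).im) hsum
    simp at this ⊢
    linarith
  have h12 : 0 < ((starRingEnd ℂ) e₁ * e₂).im := by
    have := mul_pos hL₀ h01
    rw [← he12] at this
    exact (mul_pos_iff_of_pos_left hL₂).1 this
  have h20 : 0 < ((starRingEnd ℂ) e₂ * e₀).im := by
    have := mul_pos hL₁ h01
    rw [← he20] at this
    exact (mul_pos_iff_of_pos_left hL₂).1 this
  obtain ⟨a₀, a₁, a₂, p0, q0, p1, q1, p2, q2, ha, r1, r2⟩ := exists_exterior_angles h01 h12 h20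
  have n0 : e₀ ≠ 0 := by rintro rfl; simp at h01
  have n1 : e₁ ≠ 0 := by rintro rfl; simp at h01
  have n2 : e₂ ≠ 0 := by rintro rfl; simp at h20
  have m0 : (‖e₀‖ : ℂ) ≠ 0 := by simpa using n0
  have m1 : (‖e₁‖ : ℂ) ≠ 0 := by simpa using n1
  have m2 : (‖e₂‖ : ℂ) ≠ 0 := by simpa using n2
  have np0 := norm_pos_iff.2 n0
  have np1 := norm_pos_iff.2 n1
  have np2 := norm_pos_iff.2 n2
  set z₀ := Complex.exp (θ₀ * Complex.I) with hz₀
  set z₁ := Complex.exp (θ₁ * Complex.I) with hz₁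
  set z₂ := Complex.exp (θ₂ * Complex.I) with hz₂
  have hn₀ : ‖z₀‖ = 1 := norm_exp_mul_I θ₀
  have hn₁ : ‖z₁‖ = 1 := norm_exp_mul_I θ₁
  have hn₂ : ‖z₂‖ = 1 := norm_exp_mul_I θ₂
  set f := scMap z₀ z₁ z₂ a₀ a₁ a₂ with hf
  have hfc : ContinuousOn f (Metric.closedBall 0 1) :=
    continuousOn_scMap hn₀ hn₁ hn₂ (exp_mul_I_ne hθ01 (by linarith)).symm
      (exp_mul_I_ne (by linarith) (by linarith)).symm (exp_mul_I_ne hθ12 (by linarith)).symm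
      p0 p1 p2 q0 q1 q2
  -- The corner angles are lowered by `2π` where necessary, so that each lies before the arc and the
  -- arc ends within one turn of it. Passing a corner therefore changes the side direction by `π
  -- aⱼ`.
  obtain ⟨R₀, s₀, c₀, i₀, d₀⟩ := scMap_arc (α := θ₀) (β := θ₁) ha hz₀
    (hz₁.trans (exp_sub_two_pi θ₁)) (hz₂.trans (exp_sub_two_pi θ₂)) le_rfl
    (by linarith) (by linarith) (by linarith) (by linarith) (by linarith) hfc
  obtain ⟨R₁, s₁, c₁, i₁, d₁⟩ := scMap_arc (α := θ₁) (β := θ₂) ha hz₀ hz₁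
    (hz₂.trans (exp_sub_two_pi θ₂)) (by linarith)
    (by linarith) (by linarith) (by linarith) (by linarith) (by linarith) hfc
  obtain ⟨R₂, s₂, c₂, i₂, d₂⟩ := scMap_arc (α := θ₂) (β := θ₀ + 2 * Real.pi) ha hz₀ hz₁
    hz₂ (by linarith)
    (by linarith) (by linarith) (by linarith) (by linarith) (by linarith) hfc
  simp only [← hf] at d₀ d₁ d₂
  set A₀ := scAngle a₀ a₁ a₂ θ₀ (θ₁ - 2 * Real.pi) (θ₂ - 2 * Real.pi) with hA₀
  set A₁ := scAngle a₀ a₁ a₂ θ₀ θ₁ (θ₂ - 2 * Real.pi) with hA₁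
  set A₂ := scAngle a₀ a₁ a₂ θ₀ θ₁ θ₂ with hA₂
  have hA01 : A₁ = A₀ + Real.pi * a₁ := by rw [hA₀, hA₁, scAngle, scAngle]; ring
  have hA12 : A₂ = A₁ + Real.pi * a₂ := by rw [hA₁, hA₂, scAngle, scAngle]; ring
  -- The rotation from the prescribed first side to the image of the first arc; the exterior angles
  -- make it the same for the other two sides.
  set ω := Complex.exp (A₀ * Complex.I) * ‖e₀‖ / e₀ with hω
  have hω0 : ω ≠ 0 := div_ne_zero (mul_ne_zero (Complex.exp_ne_zero _) m0) n0
  have E0 : Complex.exp (A₀ * Complex.I) = ω * e₀ / ‖e₀‖ := by rw [hω]; field_simp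
  have E1 : Complex.exp (A₁ * Complex.I) = ω * e₁ / ‖e₁‖ := by
    have : Complex.exp (A₁ * Complex.I) = Complex.exp (A₀ * Complex.I) *
        Complex.exp ((Real.pi * a₁ : ℝ) * Complex.I) := by
      rw [← Complex.exp_add, hA01]; push_cast; congr 1; ring
    rw [this, E0, eq_div_iff m1, div_mul_eq_mul_div, div_mul_eq_mul_div, div_eq_iff m0]
    linear_combination -ω * r1
  have E2 : Complex.exp (A₂ * Complex.I) = ω * e₂ / ‖e₂‖ := by
    have : Complex.exp (A₂ * Complex.I) = Complex.exp (A₁ * Complex.I) *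
        Complex.exp ((Real.pi * a₂ : ℝ) * Complex.I) := by
      rw [← Complex.exp_add, hA12]; push_cast; congr 1; ring
    rw [this, E1, eq_div_iff m2, div_mul_eq_mul_div, div_mul_eq_mul_div, div_eq_iff m1]
    linear_combination -ω * r2
  have v0 := d₀ θ₁ ⟨hθ01.le, le_rfl⟩
  have v1 := d₁ θ₂ ⟨hθ12.le, le_rfl⟩
  have v2 := d₂ (θ₀ + 2 * Real.pi) ⟨hθ20.le, le_rfl⟩
  have hz₀' : Complex.exp ((θ₀ + 2 * Real.pi : ℝ) * Complex.I) = z₀ := by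
    rw [exp_sub_two_pi]; simp [hz₀]
  rw [hz₀', E2] at v2
  rw [← hz₀, ← hz₁, E0] at v0
  rw [← hz₁, ← hz₂, E1] at v1
  rw [← hz₂] at v2
  have ρ0 : 0 < R₀ θ₁ := by rw [← i₀]; exact s₀ ⟨le_rfl, hθ01.le⟩ ⟨hθ01.le, le_rfl⟩ hθ01
  have ρ1 : 0 < R₁ θ₂ := by rw [← i₁]; exact s₁ ⟨le_rfl, hθ12.le⟩ ⟨hθ12.le, le_rfl⟩ hθ12
  have ρ2 : 0 < R₂ (θ₀ + 2 * Real.pi) := by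
    rw [← i₂]; exact s₂ ⟨le_rfl, hθ20.le⟩ ⟨hθ20.le, le_rfl⟩ hθ20
  set l₀ := R₀ θ₁ / ‖e₀‖ with hl₀
  set l₁ := R₁ θ₂ / ‖e₁‖ with hl₁
  set l₂ := R₂ (θ₀ + 2 * Real.pi) / ‖e₂‖ with hl₂
  have hl0 : 0 < l₀ := div_pos ρ0 np0
  have hclose : (l₀ : ℂ) * e₀ + l₁ * e₁ + l₂ * e₂ = 0 := by
    apply mul_left_cancel₀ hω0
    rw [hl₀, hl₁, hl₂]
    push_cast
    linear_combination -v0 - v1 - v2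
  -- Two closed triangles with the same side directions are similar, so this one ratio also governs
  -- the other two sides. It is divided out at the end.
  set s := l₀ / L₀ with hs
  have hs0 : 0 < s := div_pos hl0 hL₀
  have hl0' : l₀ = s * L₀ := by rw [hs]; field_simp
  have key1 : l₂ * ((starRingEnd ℂ) e₁ * e₂).im = l₀ * ((starRingEnd ℂ) e₀ * e₁).im := by
    have := congrArg (fun z => ((starRingEnd ℂ) e₁ * z).im) hclose
    simp at this ⊢
    linarith
  have key2 : l₂ * ((starRingEnd ℂ) e₂ * e₀).im = l₁ * ((starRingEnd ℂ) e₀ * e₁).im := by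
    have := congrArg (fun z => ((starRingEnd ℂ) e₀ * z).im) hclose
    simp at this ⊢
    linarith
  have hl2' : l₂ = s * L₂ := by
    apply mul_right_cancel₀ h12.ne'
    rw [key1, hl0', mul_assoc, mul_assoc, he12]
  have hl1' : l₁ = s * L₁ := by
    apply mul_right_cancel₀ h01.ne'
    rw [← key2, hl2', mul_assoc, mul_assoc, he20]
  have hsC : (s : ℂ) ≠ 0 := by exact_mod_cast hs0.ne'
  have hωs : ω * s ≠ 0 := mul_ne_zero hω0 hsC
  refine ⟨fun w => (f w - f z₀) / (ω * s), slitDomain z₀ z₁ z₂,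
    fun θ => R₀ θ / (s * ‖e₀‖), fun θ => R₁ θ / (s * ‖e₁‖), fun θ => R₂ θ / (s * ‖e₂‖),
    (hfc.sub continuousOn_const).div_const _, isOpen_slitDomain _ _ _, ?_, ?_, ?_,
    ⟨?_, c₀.div_const _, by simp [i₀], ?_, ?_⟩, ⟨?_, c₁.div_const _, by simp [i₁], ?_, ?_⟩,
    ⟨?_, c₂.div_const _, by simp [i₂], ?_, ?_⟩⟩
  · intro w hw g0 g1 g2
    exact mem_slitDomain hn₀ hn₁ hn₂ (by simpa using hw) g0 g1 g2
  · intro w hw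
    exact (((hasDerivAt_scMap a₀ a₁ a₂ hw).sub_const _).div_const _).differentiableAt.differentiableWithinAt
  · intro w hw
    rw [(((hasDerivAt_scMap a₀ a₁ a₂ hw).sub_const _).div_const _).deriv]
    exact div_ne_zero (scDeriv_ne_zero a₀ a₁ a₂ hw) hωs
  · exact fun x hx y hy hxy => div_lt_div_of_pos_right (s₀ hx hy hxy) (by positivity)
  · have : R₀ θ₁ = l₀ * ‖e₀‖ := by rw [hl₀]; field_simp
    simp only [this, hl0']; field_simp
  · intro θ hθ
    simp only [d₀ θ hθ, E0]
    push_cast; field_simp; ring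
  · exact fun x hx y hy hxy => div_lt_div_of_pos_right (s₁ hx hy hxy) (by positivity)
  · have : R₁ θ₂ = l₁ * ‖e₁‖ := by rw [hl₁]; field_simp
    simp only [this, hl1']; field_simp
  · intro θ hθ
    simp only [d₁ θ hθ, E1, ← hz₁]
    have h1 : f z₁ = f z₀ + l₀ * (ω * e₀) := by rw [v0, hl₀]; push_cast; ring
    rw [h1, hl0']
    push_cast; field_simp; ring
  · exact fun x hx y hy hxy => div_lt_div_of_pos_right (s₂ hx hy hxy) (by positivity)
  · have : R₂ (θ₀ + 2 * Real.pi) = l₂ * ‖e₂‖ := by rw [hl₂]; field_simp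
    simp only [this, hl2']; field_simp
  · intro θ hθ
    simp only [d₂ θ hθ, E2, ← hz₂]
    have h1 : f z₁ = f z₀ + l₀ * (ω * e₀) := by rw [v0, hl₀]; push_cast; ring
    have h2 : f z₂ = f z₀ + l₀ * (ω * e₀) + l₁ * (ω * e₁) := by
      rw [v1, h1, hl₁]; push_cast; ring
    rw [h2, hl0', hl1']
    push_cast; field_simp; ring

theorem exists_exp_of_mem_sphere {w : ℂ} (hw : w ∈ Metric.sphere (0 : ℂ) 1) (θ₀ : ℝ) :
    ∃ θ ∈ Ico θ₀ (θ₀ + 2 * Real.pi), w = Complex.exp (θ * Complex.I) := by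
  refine ⟨toIcoMod Real.two_pi_pos θ₀ w.arg, toIcoMod_mem_Ico _ _ _, ?_⟩
  have h1 : w = Complex.exp (w.arg * Complex.I) := by
    have := Complex.norm_mul_exp_arg_mul_I w
    rw [mem_sphere_zero_iff_norm.1 hw] at this
    simpa using this.symm
  nth_rw 1 [h1]
  rw [Complex.exp_eq_exp_iff_exists_int]
  refine ⟨toIcoDiv Real.two_pi_pos θ₀ w.arg, ?_⟩
  have := toIcoMod_add_toIcoDiv_zsmul Real.two_pi_pos θ₀ w.arg
  nth_rw 1 [← this]
  push_cast
  simp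
  ring

/-- The open triangle in `ℂ` with side directions `e₀, e₁, e₂` and vertices `0, L e₀`. -/
def complexTriangle (e₀ e₁ e₂ : ℂ) (L : ℝ) : Set ℂ :=
  {p | 0 < ((starRingEnd ℂ) e₀ * p).im ∧ 0 < ((starRingEnd ℂ) e₁ * (p - L * e₀)).im ∧
    0 < ((starRingEnd ℂ) e₂ * p).im}

theorem convex_halfPlane (e v : ℂ) : Convex ℝ {p : ℂ | 0 < ((starRingEnd ℂ) e * (p - v)).im} := by
  intro x hx y hy a b ha hb hab
  simp only [mem_ofPred_eq] at *
  have : (starRingEnd ℂ) e * (a • x + b • y - v) =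
      a * ((starRingEnd ℂ) e * (x - v)) + b * ((starRingEnd ℂ) e * (y - v)) := by
    have hab' : (a : ℂ) + b = 1 := by exact_mod_cast hab
    simp only [Complex.real_smul]
    linear_combination ((starRingEnd ℂ) e * v) * hab'
  rw [this, Complex.add_im, Complex.im_ofReal_mul, Complex.im_ofReal_mul]
  rcases ha.eq_or_lt with rfl | ha'
  · have : b = 1 := by linarith
    subst this; simpa using hy
  · have := mul_pos ha' hx
    have := mul_nonneg hb hy.le
    linarith

theorem convex_complexTriangle (e₀ e₁ e₂ : ℂ) (L : ℝ) : Convex ℝ (complexTriangle e₀ e₁ e₂ L) := by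
  have h := ((convex_halfPlane e₀ 0).inter (convex_halfPlane e₁ (L * e₀))).inter
    (convex_halfPlane e₂ 0)
  simp only [sub_zero] at h
  convert h using 1
  ext p
  simp [complexTriangle, and_assoc]

theorem isOpen_complexTriangle (e₀ e₁ e₂ : ℂ) (L : ℝ) : IsOpen (complexTriangle e₀ e₁ e₂ L) := by
  have h : ∀ e v : ℂ, IsOpen {p : ℂ | 0 < ((starRingEnd ℂ) e * (p - v)).im} := fun e v =>
    isOpen_lt continuous_const (Complex.continuous_im.comp (by fun_prop))
  have h' := ((h e₀ 0).inter (h e₁ (L * e₀))).inter (h e₂ 0)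
  simp only [sub_zero] at h'
  convert h' using 1
  ext p
  simp [complexTriangle, and_assoc]

theorem bijOn_complexTriangle {e₀ e₁ e₂ : ℂ} {L₀ L₁ L₂ θ₀ θ₁ θ₂ : ℝ} (hL₀ : 0 < L₀)
    (hL₁ : 0 < L₁) (hL₂ : 0 < L₂) (hsum : L₀ * e₀ + L₁ * e₁ + L₂ * e₂ = 0)
    (h01 : 0 < ((starRingEnd ℂ) e₀ * e₁).im) (hθ01 : θ₀ < θ₁) (hθ12 : θ₁ < θ₂)
    (hθ20 : θ₂ < θ₀ + 2 * Real.pi) {H : ℂ → ℂ} {U : Set ℂ} {Q₀ Q₁ Q₂ : ℝ → ℝ}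
    (hc : ContinuousOn H (Metric.closedBall 0 1)) (hU : IsOpen U)
    (hUm : ∀ w ∈ Metric.closedBall (0 : ℂ) 1, w ≠ Complex.exp (θ₀ * Complex.I) →
        w ≠ Complex.exp (θ₁ * Complex.I) → w ≠ Complex.exp (θ₂ * Complex.I) → w ∈ U)
    (hd : DifferentiableOn ℂ H U) (hd0 : ∀ w ∈ U, deriv H w ≠ 0)
    (h₀ : StrictMonoOn Q₀ (Icc θ₀ θ₁)) (i₀ : Q₀ θ₀ = 0) (j₀ : Q₀ θ₁ = L₀)
    (k₀ : ∀ θ ∈ Icc θ₀ θ₁, H (Complex.exp (θ * Complex.I)) = Q₀ θ * e₀)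
    (h₁ : StrictMonoOn Q₁ (Icc θ₁ θ₂)) (i₁ : Q₁ θ₁ = 0) (j₁ : Q₁ θ₂ = L₁)
    (k₁ : ∀ θ ∈ Icc θ₁ θ₂, H (Complex.exp (θ * Complex.I)) = L₀ * e₀ + Q₁ θ * e₁)
    (h₂ : StrictMonoOn Q₂ (Icc θ₂ (θ₀ + 2 * Real.pi))) (i₂ : Q₂ θ₂ = 0)
    (j₂ : Q₂ (θ₀ + 2 * Real.pi) = L₂)
    (k₂ : ∀ θ ∈ Icc θ₂ (θ₀ + 2 * Real.pi), H (Complex.exp (θ * Complex.I)) =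
          L₀ * e₀ + L₁ * e₁ + Q₂ θ * e₂) :
    BijOn H (Metric.ball 0 1) (complexTriangle e₀ e₁ e₂ L₀) := by
  have hπ := Real.pi_pos
  set D := ((starRingEnd ℂ) e₀ * e₁).im with hD
  have he12 : L₂ * ((starRingEnd ℂ) e₁ * e₂).im = L₀ * D := by
    have := congrArg (fun z => ((starRingEnd ℂ) e₁ * z).im) hsum
    simp at this hD ⊢
    rw [hD]
    linarith
  have he20 : L₂ * ((starRingEnd ℂ) e₂ * e₀).im = L₁ * D := by
    have := congrArg (fun z => ((starRingEnd ℂ) e₀ * z).im) hsum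
    simp at this hD ⊢
    rw [hD]
    linarith
  have s10 : ((starRingEnd ℂ) e₁ * e₀).im = -D := by simp [hD]; ring
  have s21 : ((starRingEnd ℂ) e₂ * e₁).im = -((starRingEnd ℂ) e₁ * e₂).im := by simp; ring
  have s02 : ((starRingEnd ℂ) e₀ * e₂).im = -((starRingEnd ℂ) e₂ * e₀).im := by simp; ring
  have s00 : ∀ e : ℂ, ((starRingEnd ℂ) e * e).im = 0 := fun e => by simp; ring
  set D₁ := ((starRingEnd ℂ) e₁ * e₂).im with hD₁
  set D₂ := ((starRingEnd ℂ) e₂ * e₀).im with hD₂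
  have pD₁ : 0 < D₁ := by
    have := mul_pos hL₀ h01
    rw [← he12] at this
    exact (mul_pos_iff_of_pos_left hL₂).1 this
  have pD₂ : 0 < D₂ := by
    have := mul_pos hL₁ h01
    rw [← he20] at this
    exact (mul_pos_iff_of_pos_left hL₂).1 this
  -- the three functionals on a boundary point
  have r₀ : ∀ θ ∈ Icc θ₀ θ₁, 0 ≤ Q₀ θ ∧ Q₀ θ ≤ L₀ := fun θ hθ =>
    ⟨i₀ ▸ h₀.monotoneOn ⟨le_rfl, hθ01.le⟩ hθ hθ.1, j₀ ▸ h₀.monotoneOn hθ ⟨hθ01.le, le_rfl⟩ hθ.2⟩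
  have r₁ : ∀ θ ∈ Icc θ₁ θ₂, 0 ≤ Q₁ θ ∧ Q₁ θ ≤ L₁ := fun θ hθ =>
    ⟨i₁ ▸ h₁.monotoneOn ⟨le_rfl, hθ12.le⟩ hθ hθ.1, j₁ ▸ h₁.monotoneOn hθ ⟨hθ12.le, le_rfl⟩ hθ.2⟩
  have r₂ : ∀ θ ∈ Icc θ₂ (θ₀ + 2 * Real.pi), 0 ≤ Q₂ θ ∧ Q₂ θ ≤ L₂ := fun θ hθ =>
    ⟨i₂ ▸ h₂.monotoneOn ⟨le_rfl, hθ20.le⟩ hθ hθ.1,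
      j₂ ▸ h₂.monotoneOn hθ ⟨hθ20.le, le_rfl⟩ hθ.2⟩
  have val : ∀ x y z : ℝ,
      ((starRingEnd ℂ) e₀ * (x * e₀ + y * e₁ + z * e₂)).im = y * D - z * D₂ ∧
      ((starRingEnd ℂ) e₁ * (x * e₀ + y * e₁ + z * e₂ - L₀ * e₀)).im =
        (L₀ - x) * D + z * D₁ ∧
      ((starRingEnd ℂ) e₂ * (x * e₀ + y * e₁ + z * e₂)).im = x * D₂ - y * D₁ := by
    intro x y z
    have g0 := s00 e₀
    have g1 := s00 e₁
    have g2 := s00 e₂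
    refine ⟨?_, ?_, ?_⟩
    · rw [show (starRingEnd ℂ) e₀ * (x * e₀ + y * e₁ + z * e₂) = x * ((starRingEnd ℂ) e₀ * e₀) +
        y * ((starRingEnd ℂ) e₀ * e₁) + z * ((starRingEnd ℂ) e₀ * e₂) by ring, Complex.add_im,
        Complex.add_im, Complex.im_ofReal_mul, Complex.im_ofReal_mul, Complex.im_ofReal_mul, g0,
        s02, ← hD]
      ring
    · rw [show (starRingEnd ℂ) e₁ * (x * e₀ + y * e₁ + z * e₂ - L₀ * e₀) =
        ((x - L₀ : ℝ) : ℂ) * ((starRingEnd ℂ) e₁ * e₀) +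
        y * ((starRingEnd ℂ) e₁ * e₁) + z * ((starRingEnd ℂ) e₁ * e₂) by push_cast; ring,
        Complex.add_im, Complex.add_im, Complex.im_ofReal_mul, Complex.im_ofReal_mul,
        Complex.im_ofReal_mul, g1, s10, ← hD₁]
      ring
    · rw [show (starRingEnd ℂ) e₂ * (x * e₀ + y * e₁ + z * e₂) = x * ((starRingEnd ℂ) e₂ * e₀) +
        y * ((starRingEnd ℂ) e₂ * e₁) + z * ((starRingEnd ℂ) e₂ * e₂) by ring, Complex.add_im,
        Complex.add_im, Complex.im_ofReal_mul, Complex.im_ofReal_mul, Complex.im_ofReal_mul, g2,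
        s21, ← hD₂]
      ring
  have hsphere : ∀ w ∈ Metric.sphere (0 : ℂ) 1, ∃ x y z : ℝ, H w = x * e₀ + y * e₁ + z * e₂ ∧
      ((0 ≤ x ∧ x ≤ L₀ ∧ y = 0 ∧ z = 0 ∧ ∃ θ ∈ Icc θ₀ θ₁, w = Complex.exp (θ * Complex.I) ∧
        x = Q₀ θ) ∨ (x = L₀ ∧ 0 ≤ y ∧ y ≤ L₁ ∧ z = 0) ∨
        (x = L₀ ∧ y = L₁ ∧ 0 ≤ z ∧ z ≤ L₂)) := by
    intro w hw
    obtain ⟨θ, hθ, rfl⟩ := exists_exp_of_mem_sphere hw θ₀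
    rcases le_or_gt θ θ₁ with h | h
    · have hm : θ ∈ Icc θ₀ θ₁ := ⟨hθ.1, h⟩
      exact ⟨Q₀ θ, 0, 0, by rw [k₀ θ hm]; simp, Or.inl ⟨(r₀ θ hm).1, (r₀ θ hm).2, rfl, rfl, θ, hm,
        rfl, rfl⟩⟩
    · rcases le_or_gt θ θ₂ with h' | h'
      · have hm : θ ∈ Icc θ₁ θ₂ := ⟨h.le, h'⟩
        exact ⟨L₀, Q₁ θ, 0, by rw [k₁ θ hm]; simp, Or.inr (Or.inl ⟨rfl, (r₁ θ hm).1, (r₁ θ hm).2,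
          rfl⟩)⟩
      · have hm : θ ∈ Icc θ₂ (θ₀ + 2 * Real.pi) := ⟨h'.le, hθ.2.le⟩
        exact ⟨L₀, L₁, Q₂ θ, by rw [k₂ θ hm], Or.inr (Or.inr ⟨rfl, rfl, (r₂ θ hm).1,
          (r₂ θ hm).2⟩)⟩
  have hfun : ∀ w ∈ Metric.sphere (0 : ℂ) 1, 0 ≤ ((starRingEnd ℂ) e₀ * H w).im ∧
      0 ≤ ((starRingEnd ℂ) e₁ * (H w - L₀ * e₀)).im ∧ 0 ≤ ((starRingEnd ℂ) e₂ * H w).im := by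
    intro w hw
    obtain ⟨x, y, z, hH, hcase⟩ := hsphere w hw
    rw [hH]
    obtain ⟨v1, v2, v3⟩ := val x y z
    rw [v1, v2, v3]
    rcases hcase with ⟨g1, g2, rfl, rfl, -⟩ | ⟨rfl, g1, g2, rfl⟩ | ⟨rfl, rfl, g1, g2⟩
    · refine ⟨by simp, ?_, ?_⟩
      · have := mul_nonneg (sub_nonneg.2 g2) h01.le; linarith
      · have := mul_nonneg g1 pD₂.le; linarith
    · refine ⟨?_, by simp, ?_⟩
      · have := mul_nonneg g1 h01.le; linarith
      · have h5 : x * D₂ = L₁ * D₁ := by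
          apply mul_left_cancel₀ hL₂.ne'
          linear_combination x * he20 - L₁ * he12
        have := mul_nonneg (sub_nonneg.2 g2) pD₁.le
        linarith
    · refine ⟨?_, ?_, ?_⟩
      · have := mul_nonneg (sub_nonneg.2 g2) pD₂.le; linarith
      · have := mul_nonneg g1 pD₁.le; linarith
      · have h5 : x * D₂ = y * D₁ := by
          apply mul_left_cancel₀ hL₂.ne'
          linear_combination x * he20 - y * he12
        linarith
  have hnot : ∀ w ∈ Metric.sphere (0 : ℂ) 1, H w ∉ complexTriangle e₀ e₁ e₂ L₀ := by
    intro w hw hT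
    obtain ⟨x, y, z, hH, hcase⟩ := hsphere w hw
    obtain ⟨t1, t2, t3⟩ := hT
    rw [hH] at t1 t2 t3
    obtain ⟨v1, v2, v3⟩ := val x y z
    rw [v1] at t1; rw [v2] at t2; rw [v3] at t3
    rcases hcase with ⟨g1, g2, rfl, rfl, -⟩ | ⟨rfl, g1, g2, rfl⟩ | ⟨rfl, rfl, g1, g2⟩
    · simp at t1
    · simp at t2
    · have h5 : x * D₂ = y * D₁ := by
        apply mul_left_cancel₀ hL₂.ne'
        linear_combination x * he20 - y * he12
      linarith
  have hballU : Metric.ball (0 : ℂ) 1 ⊆ U := by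
    intro w hw
    have hlt : ‖w‖ < 1 := by simpa using hw
    refine hUm w (Metric.ball_subset_closedBall hw) ?_ ?_ ?_ <;>
    · rintro rfl; rw [norm_exp_mul_I] at hlt; exact lt_irrefl _ hlt
  have hdb := hd.mono hballU
  have hmax : ∀ (e : ℂ) (k : ℝ), e ≠ 0 → (∀ w ∈ Metric.sphere (0 : ℂ) 1,
      k ≤ ((starRingEnd ℂ) e * H w).im) → ∀ w ∈ Metric.ball (0 : ℂ) 1,
      k < ((starRingEnd ℂ) e * H w).im := by
    intro e k he hk w hw
    have hre : ∀ w, ((Complex.I * (starRingEnd ℂ) e) * H w).re =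
        -((starRingEnd ℂ) e * H w).im := fun w => by
      rw [mul_assoc, Complex.I_mul_re]
    have := re_mul_lt_of_sphere hc hdb (fun w hw => hd0 w (hballU hw))
      (c := Complex.I * (starRingEnd ℂ) e) (mul_ne_zero Complex.I_ne_zero (by simpa using he))
      (k := -k) (fun w hw => by rw [hre]; linarith [hk w hw]) w hw
    rw [hre] at this
    linarith
  have n0 : e₀ ≠ 0 := by rintro rfl; simp [hD] at h01
  have n1 : e₁ ≠ 0 := by rintro rfl; simp [hD] at h01
  have n2 : e₂ ≠ 0 := by rintro rfl; simp [hD₂] at pD₂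
  -- The middle of the first arc serves as the test point of `bijOn_ball_of_boundary`: `H` extends
  -- past it with nonzero derivative, and its value, interior to a side, is taken only once on the
  -- circle.
  have hw₁m : (θ₀ + θ₁) / 2 ∈ Icc θ₀ θ₁ := ⟨by linarith, by linarith⟩
  have hq0 : 0 < Q₀ ((θ₀ + θ₁) / 2) := by
    rw [← i₀]; exact h₀ ⟨le_rfl, hθ01.le⟩ hw₁m (by linarith)
  have hq1 : Q₀ ((θ₀ + θ₁) / 2) < L₀ := by
    rw [← j₀]; exact h₀ hw₁m ⟨hθ01.le, le_rfl⟩ (by linarith)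
  have hw₁U : Complex.exp (((θ₀ + θ₁) / 2 : ℝ) * Complex.I) ∈ U := by
    refine hUm _ (by rw [mem_closedBall_zero_iff, norm_exp_mul_I])
      (exp_mul_I_ne (by linarith) (by linarith)) ?_ ?_
    · exact (exp_mul_I_ne (by linarith) (by linarith)).symm
    · exact (exp_mul_I_ne (by linarith) (by linarith)).symm
  refine bijOn_ball_of_boundary hc hdb (fun w hw => hd0 w (hballU hw))
    (convex_complexTriangle e₀ e₁ e₂ L₀).isPreconnected (isOpen_complexTriangle e₀ e₁ e₂ L₀)
    (fun w hw => ⟨?_, ?_, ?_⟩) hnot (w₁ := Complex.exp (((θ₀ + θ₁) / 2 : ℝ) * Complex.I))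
    (by rw [mem_sphere_zero_iff_norm, norm_exp_mul_I]) ?_
    (map_nhds_of_hasDerivAt hU hd hw₁U (hd0 _ hw₁U)).2
  · exact hmax e₀ 0 n0 (fun w hw => (hfun w hw).1) w hw
  · have := hmax e₁ ((starRingEnd ℂ) e₁ * (L₀ * e₀)).im n1 (fun w hw => by
      have := (hfun w hw).2.1
      rw [mul_sub, Complex.sub_im] at this
      linarith) w hw
    rw [mul_sub, Complex.sub_im]
    linarith
  · exact hmax e₂ 0 n2 (fun w hw => (hfun w hw).2.2) w hw
  · intro w hw heq
    obtain ⟨x, y, z, hH, hcase⟩ := hsphere w hw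
    rw [k₀ _ hw₁m] at heq
    have hv := val (Q₀ ((θ₀ + θ₁) / 2)) 0 0
    simp only [Complex.ofReal_zero, zero_mul, add_zero, sub_zero] at hv
    obtain ⟨v1, v2, v3⟩ := val x y z
    rw [← hH, heq] at v1 v2 v3
    rw [hv.1] at v1
    rw [hv.2.1] at v2
    rw [hv.2.2] at v3
    rcases hcase with ⟨g1, g2, rfl, rfl, θ, hθ, rfl, rfl⟩ | ⟨rfl, g1, g2, rfl⟩ | ⟨rfl, rfl, g1, g2⟩
    · have : Q₀ θ = Q₀ ((θ₀ + θ₁) / 2) := by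
        apply mul_right_cancel₀ pD₂.ne'; linarith
      rw [h₀.injOn hθ hw₁m this]
    · have := mul_pos (sub_pos.2 hq1) h01
      rw [sub_self, zero_mul, zero_mul, add_zero] at v2
      linarith
    · have h5 : x * D₂ = y * D₁ := by
        apply mul_left_cancel₀ hL₂.ne'
        linear_combination x * he20 - y * he12
      have := mul_pos hq0 pD₂
      linarith

/-! ### Real coordinates -/

/-- The coordinate sends `x + i y` to `x (1, 0) + y J (1, 0)`. Its determinant `q` is the second
component of `J (1, 0)`, positive by the orientation condition. -/
theorem exists_complexCoordinate {J : ℝ × ℝ →ₗ[ℝ] ℝ × ℝ} (hJ : IsComplexStructure J) :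
    ∃ (B : ℂ ≃L[ℝ] ℝ × ℝ) (q : ℝ), 0 < q ∧ (∀ z, B (Complex.I * z) = J (B z)) ∧
      ∀ u v : ℂ, (B u).1 * (B v).2 - (B u).2 * (B v).1 = q * ((starRingEnd ℂ) u * v).im := by
  obtain ⟨p, q, hpq⟩ : ∃ p q : ℝ, J (1, 0) = (p, q) := ⟨_, _, rfl⟩
  have hq : 0 < q := by
    have := hJ.2 (1, 0) (by simp)
    rw [hpq] at this
    simpa using this
  let e : ℂ ≃ₗ[ℝ] ℝ × ℝ :=
    { toFun := fun z => (z.re + z.im * p, z.im * q)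
      invFun := fun v => ⟨v.1 - v.2 / q * p, v.2 / q⟩
      map_add' := fun u v => by
        ext <;> simp <;> ring
      map_smul' := fun c u => by
        ext <;> simp <;> ring
      left_inv := fun z => by
        apply Complex.ext <;> simp [hq.ne']
      right_inv := fun v => by
        ext <;> simp [hq.ne'] }
  refine ⟨e.toContinuousLinearEquiv, q, hq, fun z => ?_, fun u v => ?_⟩
  · have h1 : ∀ z : ℂ, e z = z.re • ((1, 0) : ℝ × ℝ) + z.im • J (1, 0) := fun z => by
      rw [hpq]; ext <;> simp [e]
    change e (Complex.I * z) = J (e z)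
    rw [h1, h1, map_add, map_smul, map_smul, hJ.1]
    simp [add_comm]
  · change (e u).1 * (e v).2 - (e u).2 * (e v).1 = _
    simp [e]
    ring

/-- `F` is `J`-holomorphic at `w`. -/
def IsJHolAt (J : ℝ × ℝ →ₗ[ℝ] ℝ × ℝ) (F : ℂ → ℝ × ℝ) (w : ℂ) : Prop :=
  DifferentiableAt ℝ F w ∧ ∀ v : ℂ, fderiv ℝ F w (Complex.I * v) = J (fderiv ℝ F w v)

/-- The coordinate `B` turns `J` into multiplication by `i`, which gives the Cauchy–Riemann
equations; by real linearity they need only be tested on the vector `1`. -/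
theorem isJHolAt_iff {J : ℝ × ℝ →ₗ[ℝ] ℝ × ℝ} {B : ℂ ≃L[ℝ] ℝ × ℝ}
    (hB : ∀ z, B (Complex.I * z) = J (B z)) {F : ℂ → ℝ × ℝ} {w : ℂ} :
    IsJHolAt J F w ↔ DifferentiableAt ℂ (fun z => B.symm (F z)) w := by
  have hB' : ∀ v, B.symm (J v) = Complex.I * B.symm v := fun v => by
    rw [ContinuousLinearEquiv.symm_apply_eq, hB, ContinuousLinearEquiv.apply_symm_apply]
  rw [differentiableAt_complex_iff_differentiableAt_real]
  have h1 : DifferentiableAt ℝ (fun z => B.symm (F z)) w ↔ DifferentiableAt ℝ F w :=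
    B.symm.comp_differentiableAt_iff
  have h2 : fderiv ℝ (fun z => B.symm (F z)) w = (B.symm : ℝ × ℝ →L[ℝ] ℂ).comp (fderiv ℝ F w) :=
    B.symm.comp_fderiv
  rw [h1, h2, IsJHolAt]
  refine and_congr_right fun hd => ⟨fun h => ?_, fun h v => ?_⟩
  · have := h 1
    rw [mul_one] at this
    simp only [ContinuousLinearMap.comp_apply, ContinuousLinearEquiv.coe_coe, this, hB',
      smul_eq_mul]
  · simp only [ContinuousLinearMap.comp_apply, ContinuousLinearEquiv.coe_coe, smul_eq_mul] at h
    rw [← hB', EmbeddingLike.apply_eq_iff_eq] at h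
    have hJJ : ∀ x, J (J x) = -x := fun x => by
      rw [← B.apply_symm_apply x, ← hB, ← hB, ← mul_assoc, Complex.I_mul_I, neg_one_mul, map_neg]
    have hv : v = v.re • (1 : ℂ) + v.im • Complex.I := by
      apply Complex.ext <;> simp
    have hIv : Complex.I * v = v.re • Complex.I - v.im • (1 : ℂ) := by
      apply Complex.ext <;> simp
    rw [hIv]
    nth_rw 3 [hv]
    simp only [map_add, map_sub, map_smul, h, hJJ]
    simp [sub_eq_add_neg]

theorem interior_line_eq_empty {a b : ℝ} (h : a ≠ 0 ∨ b ≠ 0) :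
    interior {v : ℝ × ℝ | a * v.1 + b * v.2 = 0} = ∅ := by
  rw [eq_empty_iff_forall_notMem]
  intro v hv
  have hv0 := interior_subset hv
  have ht : Tendsto (fun t : ℝ => (v.1 + t * a, v.2 + t * b)) (𝓝[>] 0) (𝓝 v) := by
    have : Continuous fun t : ℝ => (v.1 + t * a, v.2 + t * b) := by fun_prop
    have h2 := this.tendsto 0
    simp only [zero_mul, add_zero] at h2
    exact h2.mono_left nhdsWithin_le_nhds
  obtain ⟨t, ht1, ht2⟩ := ((ht.eventually (mem_interior_iff_mem_nhds.1 hv)).and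
    self_mem_nhdsWithin).exists
  simp only [mem_ofPred_eq] at hv0 ht1
  have ht2 : 0 < t := ht2
  have h3 : t * (a ^ 2 + b ^ 2) = 0 := by linear_combination ht1 - hv0
  have h4 : 0 < a ^ 2 + b ^ 2 := by
    rcases h with h | h
    · have := sq_pos_of_ne_zero h; positivity
    · have := sq_pos_of_ne_zero h; positivity
  exact (mul_pos ht2 h4).ne' h3

/-- A `J`-holomorphic map that carries the boundary to three lines through the origin, and a point
of the disc to the origin, is zero. -/
theorem eq_zero_of_sphere_lines {J : ℝ × ℝ →ₗ[ℝ] ℝ × ℝ} (hJ : IsComplexStructure J)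
    {k : ℂ → ℝ × ℝ} (hc : ContinuousOn k (Metric.closedBall 0 1))
    (hd : ∀ w ∈ Metric.ball (0 : ℂ) 1, IsJHolAt J k w) (s₀ s₁ s₂ : ℝ)
    (hs : ∀ w ∈ Metric.sphere (0 : ℂ) 1, (k w).2 + s₀ * (k w).1 = 0 ∨
      (k w).2 + s₁ * (k w).1 = 0 ∨ (k w).2 + s₂ * (k w).1 = 0)
    {z : ℂ} (hz : z ∈ Metric.closedBall (0 : ℂ) 1) (hkz : k z = 0) :
    ∀ w ∈ Metric.closedBall (0 : ℂ) 1, k w = 0 := by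
  obtain ⟨B, q, hq, hB, -⟩ := exists_complexCoordinate hJ
  set ℓ : ℝ → Set (ℝ × ℝ) := fun s => {v | s * v.1 + 1 * v.2 = 0} with hℓ
  have hℓc : ∀ s, IsClosed (ℓ s) := fun s => isClosed_eq (by fun_prop) continuous_const
  have hℓi : ∀ s, interior (ℓ s) = ∅ := fun s => interior_line_eq_empty (Or.inr one_ne_zero)
  have hmem : ∀ s v, v ∈ ℓ s ↔ v.2 + s * v.1 = 0 := fun s v => by
    simp only [hℓ, mem_ofPred_eq, one_mul, add_comm]
  set S : Set ℂ := B ⁻¹' (ℓ s₀ ∪ (ℓ s₁ ∪ ℓ s₂)) with hS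
  have hSi : interior S = ∅ := by
    have h : interior (B ⁻¹' (ℓ s₀ ∪ (ℓ s₁ ∪ ℓ s₂))) = B ⁻¹' interior (ℓ s₀ ∪ (ℓ s₁ ∪ ℓ s₂)) :=
      (B.toHomeomorph.preimage_interior _).symm
    rw [hS, h, interior_union_isClosed_of_interior_empty (hℓc s₀), hℓi, preimage_empty]
    rw [interior_union_isClosed_of_interior_empty (hℓc s₁) (hℓi s₂), hℓi]
  obtain ⟨c, hcst⟩ := eqOn_const_of_sphere_cone (k := fun w => B.symm (k w)) (S := S)
    (B.symm.continuous.comp_continuousOn hc)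
    (fun w hw => ((isJHolAt_iff hB).1 (hd w hw)).differentiableWithinAt)
    (fun p t ht h => by
      have ht0 : t ≠ 0 := by linarith
      have h2 : B ((t : ℂ) * p) = t • B p := by
        rw [← map_smul]; simp
      have h3 : ∀ s, t • B p ∈ ℓ s → B p ∈ ℓ s := by
        intro s h
        rw [hmem] at h ⊢
        simp only [Prod.smul_snd, Prod.smul_fst, smul_eq_mul] at h
        apply mul_left_cancel₀ ht0
        linear_combination h
      rw [hS, mem_preimage, h2] at h
      exact h.imp (h3 _) (Or.imp (h3 _) (h3 _)))
    hSi (by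
      rw [hS, mem_preimage, map_zero]
      left; rw [hmem]; simp)
    (fun w hw => by
      rw [hS, mem_preimage, B.apply_symm_apply]
      exact (hs w hw).imp (hmem _ _).2 (Or.imp (hmem _ _).2 (hmem _ _).2))
  intro w hw
  have h1 : B.symm (k w) = B.symm (k z) := (hcst w hw).trans (hcst z hz).symm
  rw [← hkz]
  exact B.symm.injective h1

/-- The open triangle with vertices `0`, `(-m₂, 0)`, `(m₁, -m₁ (m₁ + m₂))`. -/
def standardTriangle (m₁ m₂ : ℝ) : Set (ℝ × ℝ) :=
  {v | v.2 < 0 ∧ 0 < v.2 + m₁ * v.1 + m₁ * m₂ ∧ v.2 + (m₁ + m₂) * v.1 < 0}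

/-- A parametrization of the standard triangle by a conformal map with prescribed corners
`exp (i θₖ)`. -/
structure IsTriangleParam (J : ℝ × ℝ →ₗ[ℝ] ℝ × ℝ) (m₁ m₂ θ₀ θ₁ θ₂ : ℝ) (G : ℂ → ℝ × ℝ)
    (Q₀ Q₁ Q₂ : ℝ → ℝ) : Prop where
  continuousOn : ContinuousOn G (Metric.closedBall 0 1)
  smooth : ContDiffOn ℝ ((⊤ : ℕ∞) : WithTop ℕ∞) G (Metric.closedBall 0 1 \
    {Complex.exp (θ₀ * Complex.I), Complex.exp (θ₁ * Complex.I), Complex.exp (θ₂ * Complex.I)})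
  hol : ∀ w ∈ Metric.ball (0 : ℂ) 1, IsJHolAt J G w
  bijOn : BijOn G (Metric.ball 0 1) (standardTriangle m₁ m₂)
  mono₀ : StrictMonoOn Q₀ (Icc θ₀ θ₁)
  cont₀ : ContinuousOn Q₀ (Icc θ₀ θ₁)
  start₀ : Q₀ θ₀ = 0
  end₀ : Q₀ θ₁ = m₂
  arc₀ : ∀ θ ∈ Icc θ₀ θ₁, G (Complex.exp (θ * Complex.I)) = (-Q₀ θ, 0)
  mono₁ : StrictMonoOn Q₁ (Icc θ₁ θ₂)
  cont₁ : ContinuousOn Q₁ (Icc θ₁ θ₂)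
  start₁ : Q₁ θ₁ = 0
  end₁ : Q₁ θ₂ = m₁ + m₂
  arc₁ : ∀ θ ∈ Icc θ₁ θ₂, G (Complex.exp (θ * Complex.I)) = (-m₂ + Q₁ θ, -m₁ * Q₁ θ)
  mono₂ : StrictMonoOn Q₂ (Icc θ₂ (θ₀ + 2 * Real.pi))
  cont₂ : ContinuousOn Q₂ (Icc θ₂ (θ₀ + 2 * Real.pi))
  start₂ : Q₂ θ₂ = 0
  end₂ : Q₂ (θ₀ + 2 * Real.pi) = m₁
  arc₂ : ∀ θ ∈ Icc θ₂ (θ₀ + 2 * Real.pi), G (Complex.exp (θ * Complex.I)) =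
    (m₁ - Q₂ θ, -(m₁ + m₂) * (m₁ - Q₂ θ))

/-- The sides `m₂ (-1, 0)`, `(m₁ + m₂) (1, -m₁)` and `m₁ (-1, m₁ + m₂)` add up to zero and turn to
the left, the first two directions having determinant `m₁ > 0`. A complex coordinate reduces the
claim to `exists_conformal_triangle`. -/
theorem exists_triangleParam {J : ℝ × ℝ →ₗ[ℝ] ℝ × ℝ} (hJ : IsComplexStructure J)
    {m₁ m₂ θ₀ θ₁ θ₂ : ℝ} (hm₁ : 0 < m₁) (hm₂ : 0 < m₂) (hθ01 : θ₀ < θ₁) (hθ12 : θ₁ < θ₂)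
    (hθ20 : θ₂ < θ₀ + 2 * Real.pi) : ∃ G Q₀ Q₁ Q₂, IsTriangleParam J m₁ m₂ θ₀ θ₁ θ₂ G Q₀ Q₁ Q₂ := by
  obtain ⟨B, q, hq, hB, hdet⟩ := exists_complexCoordinate hJ
  set e₀ := B.symm (-1, 0) with he₀
  set e₁ := B.symm (1, -m₁) with he₁
  set e₂ := B.symm (-1, m₁ + m₂) with he₂
  have b₀ : B e₀ = (-1, 0) := B.apply_symm_apply _
  have b₁ : B e₁ = (1, -m₁) := B.apply_symm_apply _
  have b₂ : B e₂ = (-1, m₁ + m₂) := B.apply_symm_apply _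
  have hBmul : ∀ (t : ℝ) (z : ℂ), B ((t : ℂ) * z) = t • B z := fun t z => by
    rw [← map_smul]; simp
  have hsum : (m₂ : ℂ) * e₀ + ((m₁ + m₂ : ℝ) : ℂ) * e₁ + m₁ * e₂ = 0 := by
    apply B.injective
    rw [map_add, map_add, hBmul, hBmul, hBmul, b₀, b₁, b₂, map_zero]
    ext <;> simp <;> ring
  have h01 : 0 < ((starRingEnd ℂ) e₀ * e₁).im := by
    have := hdet e₀ e₁
    rw [b₀, b₁] at this
    have h2 : m₁ = q * ((starRingEnd ℂ) e₀ * e₁).im := by linarith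
    rw [h2] at hm₁
    exact (mul_pos_iff_of_pos_left hq).1 hm₁
  have hm : 0 < m₁ + m₂ := add_pos hm₁ hm₂
  obtain ⟨H, U, Q₀, Q₁, Q₂, hc, hU, hUm, hd, hd0, ⟨s₀, c₀, i₀, j₀, k₀⟩, ⟨s₁, c₁, i₁, j₁, k₁⟩,
    s₂, c₂, i₂, j₂, k₂⟩ := exists_conformal_triangle hm₂ hm hm₁ hsum h01 hθ01 hθ12 hθ20
  have hbij := bijOn_complexTriangle hm₂ hm hm₁ hsum h01 hθ01 hθ12 hθ20 hc hU hUm hd hd0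
    s₀ i₀ j₀ k₀ s₁ i₁ j₁ k₁ s₂ i₂ j₂ k₂
  refine ⟨fun w => B (H w), Q₀, Q₁, Q₂, ?_, ?_, ?_, ?_, s₀, c₀, i₀, j₀, ?_, s₁, c₁, i₁, j₁, ?_,
    s₂, c₂, i₂, j₂, ?_⟩
  · exact B.continuous.comp_continuousOn hc
  · have h1 : ContDiffOn ℂ ((⊤ : ℕ∞) : WithTop ℕ∞) H U := hd.contDiffOn hU
    have h2 : ContDiffOn ℝ ((⊤ : ℕ∞) : WithTop ℕ∞) H U := h1.restrict_scalars ℝ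
    refine (B.contDiff.comp_contDiffOn h2).mono ?_
    rintro w ⟨hw, hne⟩
    simp only [mem_insert_iff, mem_singleton_iff, not_or] at hne
    exact hUm w hw hne.1 hne.2.1 hne.2.2
  · intro w hw
    rw [isJHolAt_iff hB]
    simp only [B.symm_apply_apply]
    have hlt : ‖w‖ < 1 := by simpa using hw
    refine hd.differentiableAt (hU.mem_nhds (hUm w (Metric.ball_subset_closedBall hw) ?_ ?_ ?_)) <;>
    · rintro rfl; rw [norm_exp_mul_I] at hlt; exact lt_irrefl _ hlt
  · have himg : BijOn B (complexTriangle e₀ e₁ e₂ m₂) (standardTriangle m₁ m₂) := by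
      have hiff : ∀ p, B p ∈ standardTriangle m₁ m₂ ↔ p ∈ complexTriangle e₀ e₁ e₂ m₂ := by
        intro p
        have d0 := hdet e₀ p
        have d1 := hdet e₁ (p - m₂ * e₀)
        have d2 := hdet e₂ p
        rw [b₀] at d0
        rw [map_sub, hBmul, b₀, b₁] at d1
        rw [b₂] at d2
        simp only [Prod.fst_sub, Prod.snd_sub, Prod.smul_fst, Prod.smul_snd, smul_eq_mul] at d0 d1 d2
        simp only [standardTriangle, complexTriangle, mem_ofPred_eq]
        rw [← mul_pos_iff_of_pos_left (b := ((starRingEnd ℂ) e₀ * p).im) hq, ← d0,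
          ← mul_pos_iff_of_pos_left (b := ((starRingEnd ℂ) e₁ * (p - m₂ * e₀)).im) hq,
          ← d1, ← mul_pos_iff_of_pos_left (b := ((starRingEnd ℂ) e₂ * p).im) hq, ← d2]
        constructor
        · rintro ⟨h1, h2, h3⟩
          exact ⟨by linarith, by linarith, by linarith⟩
        · rintro ⟨h1, h2, h3⟩
          exact ⟨by linarith, by linarith, by linarith⟩
      refine ⟨fun p hp => (hiff p).2 hp, B.injective.injOn, fun v hv => ⟨B.symm v, ?_, by simp⟩⟩
      rw [← hiff]; simpa using hv
    exact himg.comp hbij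
  · intro θ hθ
    simp only [k₀ θ hθ, hBmul, b₀]
    ext <;> simp
  · intro θ hθ
    simp only [k₁ θ hθ, hBmul, b₀, b₁, map_add]
    ext <;> simp; ring
  · intro θ hθ
    simp only [k₂ θ hθ, hBmul, b₀, b₁, b₂, map_add]
    ext <;> simp <;> ring

/-! ### Arcs of the circle and automorphisms of the disc -/

theorem exp_eq_exp_add {θ α : ℝ} (h : Complex.exp (θ * Complex.I) = Complex.exp (α * Complex.I)) :
    ∃ n : ℤ, θ = α + n * (2 * Real.pi) := by
  obtain ⟨n, hn⟩ := Complex.exp_eq_exp_iff_exists_int.1 h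
  refine ⟨n, ?_⟩
  have h3 : (θ : ℂ) = ((α + n * (2 * Real.pi) : ℝ) : ℂ) := by
    apply mul_right_cancel₀ Complex.I_ne_zero
    rw [hn]; push_cast; ring
  exact_mod_cast h3

theorem exp_add_int_mul (θ : ℝ) (n : ℤ) :
    Complex.exp ((θ + n * (2 * Real.pi) : ℝ) * Complex.I) = Complex.exp (θ * Complex.I) := by
  rw [Complex.exp_eq_exp_iff_exists_int]
  exact ⟨n, by push_cast; ring⟩

theorem ccwArc_exp {θ₀ θ₁ : ℝ} (h : θ₀ ≤ θ₁) (h' : θ₁ < θ₀ + 2 * Real.pi) :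
    ccwArc (Complex.exp (θ₀ * Complex.I)) (Complex.exp (θ₁ * Complex.I)) =
      (fun θ : ℝ => Complex.exp (θ * Complex.I)) '' Icc θ₀ θ₁ := by
  have hπ := Real.pi_pos
  ext w
  constructor
  · rintro ⟨α, β, γ, h1, h2, h3, h4, rfl, h6⟩
    obtain ⟨n, hn⟩ := exp_eq_exp_add h4
    obtain ⟨k, hk⟩ := exp_eq_exp_add h6
    have hkn : k = n := by
      have h5 : ((k : ℝ) - n) * (2 * Real.pi) < 1 * (2 * Real.pi) := by linarith
      have h6 : (-1) * (2 * Real.pi) < ((k : ℝ) - n) * (2 * Real.pi) := by linarith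
      have h7 := lt_of_mul_lt_mul_right h5 (by positivity)
      have h8 := lt_of_mul_lt_mul_right h6 (by positivity)
      have h9 : k - n < 1 := by exact_mod_cast h7
      have h10 : -1 < k - n := by exact_mod_cast h8
      omega
    subst hkn
    refine ⟨β + k * (2 * Real.pi), ⟨by linarith, by linarith⟩, exp_add_int_mul β k⟩
  · rintro ⟨θ, hθ, rfl⟩
    exact ⟨θ₀, θ, θ₁, hθ.1, hθ.2, h', rfl, rfl, rfl⟩

/-- Positive multiple of `-i` times the oriented area, for a triangle with corners on the unit
circle. -/
def circleTriple (a b c : ℂ) : ℂ := (a - b) * (b - c) * (c - a) / (a * b * c)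

theorem exp_sub_exp (α β : ℝ) : Complex.exp (α * Complex.I) - Complex.exp (β * Complex.I) =
    ((2 * Real.sin ((β - α) / 2) : ℝ) : ℂ) *
      Complex.exp (((α + β - Real.pi) / 2 : ℝ) * Complex.I) := by
  have h1 : Complex.exp (β * Complex.I) = Complex.exp (α * Complex.I) *
      Complex.exp ((β - α : ℝ) * Complex.I) := by
    rw [← Complex.exp_add]; congr 1; push_cast; ring
  have h2 : Complex.exp (((α + β - Real.pi) / 2 : ℝ) * Complex.I) = Complex.exp (α * Complex.I) *
      Complex.exp (((β - α - Real.pi) / 2 : ℝ) * Complex.I) := by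
    rw [← Complex.exp_add]; congr 1; push_cast; ring
  rw [h1, h2, ← mul_one_sub, one_sub_exp_mul_I]
  ring

/-- Each chord is twice the sine of a half angle times a phase, and the phases combine to `i` times
the product of the three points. The sign of the sines detects the cyclic order. -/
theorem circleTriple_exp (α β γ : ℝ) :
    circleTriple (Complex.exp (α * Complex.I)) (Complex.exp (β * Complex.I))
      (Complex.exp (γ * Complex.I)) =
    ((-(8 * (Real.sin ((β - α) / 2) * Real.sin ((γ - β) / 2) * Real.sin ((γ - α) / 2))) : ℝ) : ℂ) *
      Complex.I := by
  have hI : Complex.I = Complex.exp (-((3 * Real.pi / 2 : ℝ) * Complex.I)) := by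
    refine Complex.exp_pi_div_two_mul_I.symm.trans ?_
    rw [Complex.exp_eq_exp_iff_exists_int]
    exact ⟨1, by push_cast; ring⟩
  rw [circleTriple, div_eq_iff (by simp [Complex.exp_ne_zero]), exp_sub_exp, exp_sub_exp,
    exp_sub_exp]
  have hs : Real.sin ((α - γ) / 2) = -Real.sin ((γ - α) / 2) := by
    rw [← Real.sin_neg]; congr 1; ring
  have he : Complex.exp (((α + β - Real.pi) / 2 : ℝ) * Complex.I) *
      Complex.exp (((β + γ - Real.pi) / 2 : ℝ) * Complex.I) *
      Complex.exp (((γ + α - Real.pi) / 2 : ℝ) * Complex.I) =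
      Complex.exp (-((3 * Real.pi / 2 : ℝ) * Complex.I)) * (Complex.exp (α * Complex.I) *
        Complex.exp (β * Complex.I) * Complex.exp (γ * Complex.I)) := by
    simp only [← Complex.exp_add]; congr 1; push_cast; ring
  rw [← hI] at he
  rw [hs]
  push_cast at he ⊢
  linear_combination (-(8 * (Complex.sin ((β - α) / 2) * Complex.sin ((γ - β) / 2) *
    Complex.sin ((γ - α) / 2)))) * he

theorem sin_half_pos {x : ℝ} (h : 0 < x) (h' : x < 2 * Real.pi) : 0 < Real.sin (x / 2) :=
  Real.sin_pos_of_pos_of_lt_pi (by linarith) (by linarith)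

theorem IsCcw.norm_eq {a b c : ℂ} (h : IsCcw a b c) : ‖a‖ = 1 ∧ ‖b‖ = 1 ∧ ‖c‖ = 1 := by
  obtain ⟨α, β, γ, -, -, -, rfl, rfl, rfl⟩ := h
  exact ⟨norm_exp_mul_I _, norm_exp_mul_I _, norm_exp_mul_I _⟩

theorem IsCcw.exists_triple {a b c : ℂ} (h : IsCcw a b c) :
    ∃ r : ℝ, 0 < r ∧ circleTriple a b c = ((-r : ℝ) : ℂ) * Complex.I := by
  obtain ⟨α, β, γ, h1, h2, h3, rfl, rfl, rfl⟩ := h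
  refine ⟨_, ?_, circleTriple_exp α β γ⟩
  have := sin_half_pos (x := β - α) (by linarith) (by linarith)
  have := sin_half_pos (x := γ - β) (by linarith) (by linarith)
  have := sin_half_pos (x := γ - α) (by linarith) (by linarith)
  positivity

theorem ccwArc_triple_nonpos {p w q : ℂ} (h : w ∈ ccwArc p q) : (circleTriple p w q).im ≤ 0 := by
  obtain ⟨α, β, γ, h1, h2, h3, rfl, rfl, rfl⟩ := h
  rw [circleTriple_exp]
  have hs : ∀ x : ℝ, 0 ≤ x → x < 2 * Real.pi → 0 ≤ Real.sin (x / 2) := fun x h h' =>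
    Real.sin_nonneg_of_nonneg_of_le_pi (by linarith) (by linarith)
  have a1 := hs (β - α) (by linarith) (by linarith)
  have a2 := hs (γ - β) (by linarith) (by linarith)
  have a3 := hs (γ - α) (by linarith) (by linarith)
  have := mul_nonneg (mul_nonneg a1 a2) a3
  rw [Complex.im_ofReal_mul, Complex.I_im]
  linarith

/-- Measure all angles from `p`. If `w` came after `q`, exactly one of the three sines would be
negative and the triple would have positive imaginary part. -/
theorem mem_ccwArc_of_triple {p w q : ℂ} (hp : ‖p‖ = 1) (hw : ‖w‖ = 1) (hq : ‖q‖ = 1)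
    (hpq : p ≠ q) (h : (circleTriple p w q).im ≤ 0) : w ∈ ccwArc p q := by
  have hπ := Real.pi_pos
  obtain ⟨α, -, rfl⟩ := exists_exp_of_mem_sphere (mem_sphere_zero_iff_norm.2 hp) 0
  obtain ⟨β, hβ, rfl⟩ := exists_exp_of_mem_sphere (mem_sphere_zero_iff_norm.2 hw) α
  obtain ⟨γ, hγ, rfl⟩ := exists_exp_of_mem_sphere (mem_sphere_zero_iff_norm.2 hq) α
  have hαγ : α < γ := lt_of_le_of_ne hγ.1 fun h => hpq (by rw [h])
  refine ⟨α, β, γ, hβ.1, ?_, hγ.2, rfl, rfl, rfl⟩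
  by_contra! hlt
  rw [circleTriple_exp, Complex.im_ofReal_mul, Complex.I_im, mul_one] at h
  have a1 := sin_half_pos (x := β - α) (by linarith) (by linarith [hβ.2])
  have a2 := sin_half_pos (x := β - γ) (by linarith) (by linarith [hβ.2])
  have a3 := sin_half_pos (x := γ - α) (by linarith) (by linarith [hγ.2])
  have a4 : Real.sin ((γ - β) / 2) = -Real.sin ((β - γ) / 2) := by
    rw [← Real.sin_neg]; congr 1; ring
  rw [a4] at h
  have := mul_pos (mul_pos a1 a2) a3
  linarith

theorem conj_eq_inv_of_norm {z : ℂ} (h : ‖z‖ = 1) : (starRingEnd ℂ) z = z⁻¹ := by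
  rw [Complex.inv_def, Complex.normSq_eq_norm_sq, h]; simp

theorem one_sub_conj_mul_ne_zero {a w : ℂ} (ha : ‖a‖ < 1) (hw : ‖w‖ ≤ 1) :
    1 - (starRingEnd ℂ) a * w ≠ 0 := by
  intro h
  have h1 : ‖(starRingEnd ℂ) a * w‖ = 1 := by rw [← sub_eq_zero.1 h, norm_one]
  rw [norm_mul, RCLike.norm_conj] at h1
  nlinarith [norm_nonneg a, norm_nonneg w]

/-- Any two positively oriented triples on the circle are related by an automorphism of the disc. -/
theorem exists_discAut {z₀ z₁ z₂ y₀ y₁ y₂ : ℂ} (hz : IsCcw z₀ z₁ z₂) (hy : IsCcw y₀ y₁ y₂) :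
    ∃ g, IsDiscAut g ∧ g z₀ = y₀ ∧ g z₁ = y₁ ∧ g z₂ = y₂ := by
  obtain ⟨n0, n1, n2⟩ := hz.norm_eq
  obtain ⟨k0, k1, k2⟩ := hy.norm_eq
  obtain ⟨r, hr, ht⟩ := hz.exists_triple
  obtain ⟨r', hr', ht'⟩ := hy.exists_triple
  have nz : ∀ {z : ℂ}, ‖z‖ = 1 → z ≠ 0 := fun h h' => by rw [h', norm_zero] at h; norm_num at h
  have a0 := nz n0
  have a1 := nz n1
  have a2 := nz n2
  have b0 := nz k0
  have b1 := nz k1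
  have b2 := nz k2
  set d := z₁ - z₂ with hd
  set e := z₁ - z₀ with he
  set d' := y₁ - y₂ with hd'
  set e' := y₁ - y₀ with he'
  -- The coefficients of `(p w + q) / (u w + s)` come from equating the cross ratios of `w, z₀, z₁,
  -- z₂` and of `y, y₀, y₁, y₂`.
  set p := -y₂ * e' * d + y₀ * d' * e with hp
  set q := y₂ * e' * z₀ * d - y₀ * d' * z₂ * e with hq
  set u := -e' * d + d' * e with hu
  set s := e' * z₀ * d - d' * z₂ * e with hs
  set Z := z₀ * z₁ * z₂ * y₀ * y₁ * y₂ with hZ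
  have hZ0 : Z ≠ 0 := by simp [hZ, a0, a1, a2, b0, b1, b2]
  -- On the unit circle conjugation is inversion. This relation and the next express that the Möbius
  -- map preserves the circle.
  have hsp : s = -Z * (starRingEnd ℂ) p := by
    simp only [hp, hd, he, hd', he', hs, hZ, map_add, map_sub, map_mul, map_neg,
      conj_eq_inv_of_norm n0, conj_eq_inv_of_norm n1, conj_eq_inv_of_norm n2,
      conj_eq_inv_of_norm k0, conj_eq_inv_of_norm k1, conj_eq_inv_of_norm k2]
    field_simp
    ring
  have huq : u = -Z * (starRingEnd ℂ) q := by
    simp only [hq, hd, he, hd', he', hu, hZ, map_sub, map_mul,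
      conj_eq_inv_of_norm n0, conj_eq_inv_of_norm n1, conj_eq_inv_of_norm n2,
      conj_eq_inv_of_norm k0, conj_eq_inv_of_norm k1, conj_eq_inv_of_norm k2]
    field_simp
    ring
  have hZn : ‖Z‖ = 1 := by simp [hZ, n0, n1, n2, k0, k1, k2]
  have hdet : p * s - q * u = Z * (circleTriple z₀ z₁ z₂ * circleTriple y₀ y₁ y₂) := by
    simp only [circleTriple, hZ, hp, hq, hs, hu, hd, he, hd', he']
    field_simp
    ring
  -- Both triples being counterclockwise, the determinant has the sign for which the disc goes to
  -- itself and not to the exterior.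
  have hpos : ‖p‖ ^ 2 - ‖q‖ ^ 2 = r * r' := by
    have h1 : Z * ((‖p‖ ^ 2 - ‖q‖ ^ 2 : ℝ) : ℂ) = Z * ((r * r' : ℝ) : ℂ) := by
      have h2 : ((‖p‖ ^ 2 : ℝ) : ℂ) = p * (starRingEnd ℂ) p := by
        rw [Complex.mul_conj, Complex.normSq_eq_norm_sq]
      have h3 : ((‖q‖ ^ 2 : ℝ) : ℂ) = q * (starRingEnd ℂ) q := by
        rw [Complex.mul_conj, Complex.normSq_eq_norm_sq]
      rw [hsp, huq, ht, ht'] at hdet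
      rw [Complex.ofReal_sub, h2, h3]
      push_cast at hdet ⊢
      linear_combination -hdet + (-Z * r * r') * Complex.I_mul_I
    have h4 := mul_left_cancel₀ hZ0 h1
    exact_mod_cast h4
  have hlt : ‖q‖ < ‖p‖ := by
    have := mul_pos hr hr'
    nlinarith [norm_nonneg q, norm_nonneg p]
  have hp0 : p ≠ 0 := norm_pos_iff.1 ((norm_nonneg q).trans_lt hlt)
  have hs0 : s ≠ 0 := by
    rw [hsp]; exact mul_ne_zero (neg_ne_zero.2 hZ0) (by simpa using hp0)
  have hconj : (starRingEnd ℂ) (-q / p) = -u / s := by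
    have hcp : (starRingEnd ℂ) p ≠ 0 := by simpa using hp0
    rw [huq, hsp, map_div₀, map_neg]
    field_simp
  have han : ‖-q / p‖ < 1 := by
    rw [norm_div, norm_neg, div_lt_one (norm_pos_iff.2 hp0)]; exact hlt
  have key : ∀ z y, ‖z‖ = 1 → p * z + q = y * (u * z + s) →
      p / s * (z - -q / p) / (1 - (starRingEnd ℂ) (-q / p) * z) = y := by
    intro z y hz h
    rw [div_eq_iff (one_sub_conj_mul_ne_zero han hz.le), hconj]
    field_simp
    linear_combination h
  refine ⟨fun w => p / s * (w - -q / p) / (1 - (starRingEnd ℂ) (-q / p) * w),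
    ⟨-q / p, p / s, han, ?_, fun w => rfl⟩, key _ _ n0 ?_, key _ _ n1 ?_, key _ _ n2 ?_⟩
  · rw [hsp, norm_div, norm_mul, norm_neg, RCLike.norm_conj, hZn, one_mul,
      div_self (norm_ne_zero_iff.2 hp0)]
  · rw [hp, hq, hu, hs]; ring
  · rw [hp, hq, hu, hs, hd, he, hd', he']; ring
  · rw [hp, hq, hu, hs]; ring

theorem IsDiscAut.differentiableAt {g : ℂ → ℂ} (hg : IsDiscAut g) {w : ℂ} (hw : ‖w‖ ≤ 1) :
    DifferentiableAt ℂ g w := by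
  obtain ⟨a, c, ha, hc, h⟩ := hg
  have : g = fun w => c * (w - a) / (1 - (starRingEnd ℂ) a * w) := funext h
  rw [this]
  exact DifferentiableAt.div (by fun_prop) (by fun_prop) (one_sub_conj_mul_ne_zero ha hw)

theorem one_sub_conj_mul_eq {a w : ℂ} (hw : ‖w‖ = 1) :
    w - a = w * (starRingEnd ℂ) (1 - (starRingEnd ℂ) a * w) := by
  have hw0 : w ≠ 0 := by rintro rfl; simp at hw
  rw [map_sub, map_mul, conj_eq_inv_of_norm hw, map_one, Complex.conj_conj]
  field_simp

theorem IsDiscAut.norm_eq_one {g : ℂ → ℂ} (hg : IsDiscAut g) {w : ℂ} (hw : ‖w‖ = 1) :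
    ‖g w‖ = 1 := by
  obtain ⟨a, c, ha, hc, h⟩ := hg
  have h0 := norm_ne_zero_iff.2 (one_sub_conj_mul_ne_zero ha hw.le)
  rw [h, norm_div, norm_mul, hc, one_mul, one_sub_conj_mul_eq hw, norm_mul, hw, one_mul,
    RCLike.norm_conj, div_self h0]

theorem IsDiscAut.norm_lt_one {g : ℂ → ℂ} (hg : IsDiscAut g) {w : ℂ} (hw : ‖w‖ < 1) :
    ‖g w‖ < 1 := by
  obtain ⟨a, c, ha, hc, h⟩ := hg
  have h0 := norm_pos_iff.2 (one_sub_conj_mul_ne_zero ha hw.le)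
  rw [h, norm_div, norm_mul, hc, one_mul, div_lt_one h0]
  have h1 : ‖1 - (starRingEnd ℂ) a * w‖ ^ 2 - ‖w - a‖ ^ 2 = (1 - ‖a‖ ^ 2) * (1 - ‖w‖ ^ 2) := by
    simp only [← Complex.normSq_eq_norm_sq, Complex.normSq_apply]
    simp
    ring
  have h2 : 0 < (1 - ‖a‖ ^ 2) * (1 - ‖w‖ ^ 2) := by
    apply mul_pos <;> nlinarith [norm_nonneg a, norm_nonneg w]
  nlinarith [norm_nonneg (w - a), norm_nonneg (1 - (starRingEnd ℂ) a * w)]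

theorem IsDiscAut.norm_le_one {g : ℂ → ℂ} (hg : IsDiscAut g) {w : ℂ} (hw : ‖w‖ ≤ 1) :
    ‖g w‖ ≤ 1 := by
  rcases hw.lt_or_eq with h | h
  · exact (hg.norm_lt_one h).le
  · exact (hg.norm_eq_one h).le

/-- A disc automorphism multiplies the chord `u - v` by `c (1 - ‖a‖²)` over the two denominators. On
the circle the phases of the denominators are those of `g u / (c u)`, so that only a positive factor
survives. -/
theorem IsDiscAut.circleTriple_eq {g : ℂ → ℂ} (hg : IsDiscAut g) {x y z : ℂ} (hx : ‖x‖ = 1)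
    (hy : ‖y‖ = 1) (hz : ‖z‖ = 1) :
    ∃ r : ℝ, 0 < r ∧ circleTriple (g x) (g y) (g z) = r * circleTriple x y z := by
  obtain ⟨a, c, ha, hc, h⟩ := hg
  have hdx := one_sub_conj_mul_ne_zero ha hx.le
  have hdy := one_sub_conj_mul_ne_zero ha hy.le
  have hdz := one_sub_conj_mul_ne_zero ha hz.le
  have hc0 : c ≠ 0 := by rintro rfl; simp at hc
  have nz : ∀ {z : ℂ}, ‖z‖ = 1 → z ≠ 0 := fun h h' => by rw [h', norm_zero] at h; norm_num at h
  have x0 := nz hx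
  have y0 := nz hy
  have z0 := nz hz
  have hd : ∀ {u v : ℂ}, 1 - (starRingEnd ℂ) a * u ≠ 0 → 1 - (starRingEnd ℂ) a * v ≠ 0 →
      g u - g v = c * ((1 - ‖a‖ ^ 2 : ℝ) : ℂ) * (u - v) /
        ((1 - (starRingEnd ℂ) a * u) * (1 - (starRingEnd ℂ) a * v)) := by
    intro u v hu hv
    have h2 : ((‖a‖ ^ 2 : ℝ) : ℂ) = a * (starRingEnd ℂ) a := by
      rw [Complex.mul_conj, Complex.normSq_eq_norm_sq]
    rw [h, h, Complex.ofReal_sub, h2, div_sub_div _ _ hu hv]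
    congr 1
    push_cast
    ring
  have hv : ∀ {u : ℂ}, ‖u‖ = 1 → g u = c * u * (starRingEnd ℂ) (1 - (starRingEnd ℂ) a * u) /
      (1 - (starRingEnd ℂ) a * u) := by
    intro u hu
    rw [h]; nth_rw 1 [one_sub_conj_mul_eq hu]; rw [mul_assoc]
  have hn : ∀ w : ℂ, ((‖w‖ ^ 2 : ℝ) : ℂ) = w * (starRingEnd ℂ) w := fun w => by
    rw [Complex.mul_conj, Complex.normSq_eq_norm_sq]
  refine ⟨(1 - ‖a‖ ^ 2) ^ 3 / (‖1 - (starRingEnd ℂ) a * x‖ ^ 2 * ‖1 - (starRingEnd ℂ) a * y‖ ^ 2 *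
    ‖1 - (starRingEnd ℂ) a * z‖ ^ 2), ?_, ?_⟩
  · have h1 : 0 < 1 - ‖a‖ ^ 2 := by nlinarith [norm_nonneg a]
    have := norm_pos_iff.2 hdx
    have := norm_pos_iff.2 hdy
    have := norm_pos_iff.2 hdz
    positivity
  · rw [circleTriple, circleTriple, hd hdx hdy, hd hdy hdz, hd hdz hdx, hv hx, hv hy, hv hz,
      Complex.ofReal_div, Complex.ofReal_mul, Complex.ofReal_mul, hn (1 - _), hn (1 - _),
      hn (1 - _), Complex.ofReal_pow]
    have cx : (starRingEnd ℂ) (1 - (starRingEnd ℂ) a * x) ≠ 0 := by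
      rw [Ne, map_eq_zero]; exact hdx
    have cy : (starRingEnd ℂ) (1 - (starRingEnd ℂ) a * y) ≠ 0 := by
      rw [Ne, map_eq_zero]; exact hdy
    have cz : (starRingEnd ℂ) (1 - (starRingEnd ℂ) a * z) ≠ 0 := by
      rw [Ne, map_eq_zero]; exact hdz
    generalize (starRingEnd ℂ) (1 - (starRingEnd ℂ) a * x) = X at *
    generalize (starRingEnd ℂ) (1 - (starRingEnd ℂ) a * y) = Y at *
    generalize (starRingEnd ℂ) (1 - (starRingEnd ℂ) a * z) = W at *
    generalize 1 - (starRingEnd ℂ) a * x = X' at *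
    generalize 1 - (starRingEnd ℂ) a * y = Y' at *
    generalize 1 - (starRingEnd ℂ) a * z = W' at *
    field_simp

theorem IsDiscAut.injOn_sphere {g : ℂ → ℂ} (hg : IsDiscAut g) {x y : ℂ} (hx : ‖x‖ = 1)
    (hy : ‖y‖ = 1) (h : g x = g y) : x = y := by
  obtain ⟨a, c, ha, hc, hgw⟩ := hg
  have hc0 : c ≠ 0 := by rintro rfl; simp at hc
  rw [hgw, hgw, div_eq_div_iff (one_sub_conj_mul_ne_zero ha hx.le)
    (one_sub_conj_mul_ne_zero ha hy.le)] at h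
  have h1 : c * ((1 - a * (starRingEnd ℂ) a) * (x - y)) = 0 := by linear_combination h
  have h2 : 1 - a * (starRingEnd ℂ) a ≠ 0 := by
    rw [mul_comm]; exact one_sub_conj_mul_ne_zero ha ha.le
  rcases mul_eq_zero.1 h1 with h3 | h3
  · exact absurd h3 hc0
  · exact sub_eq_zero.1 ((mul_eq_zero.1 h3).resolve_left h2)

theorem norm_eq_one_of_mem_ccwArc {p q w : ℂ} (h : w ∈ ccwArc p q) :
    ‖p‖ = 1 ∧ ‖w‖ = 1 ∧ ‖q‖ = 1 := by
  obtain ⟨α, β, γ, -, -, -, rfl, rfl, rfl⟩ := h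
  exact ⟨norm_exp_mul_I _, norm_exp_mul_I _, norm_exp_mul_I _⟩

theorem IsDiscAut.mapsTo_ccwArc {g : ℂ → ℂ} (hg : IsDiscAut g) {p q w : ℂ} (hpq : p ≠ q)
    (hw : w ∈ ccwArc p q) : g w ∈ ccwArc (g p) (g q) := by
  obtain ⟨hp, hw1, hq⟩ := norm_eq_one_of_mem_ccwArc hw
  refine mem_ccwArc_of_triple (hg.norm_eq_one hp) (hg.norm_eq_one hw1) (hg.norm_eq_one hq)
    (fun h => hpq (hg.injOn_sphere hp hq h)) ?_
  obtain ⟨r, hr, h⟩ := hg.circleTriple_eq hp hw1 hq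
  rw [h, Complex.im_ofReal_mul]
  exact mul_nonpos_of_nonneg_of_nonpos hr.le (ccwArc_triple_nonpos hw)

/-! ### Classification of holomorphic triangles -/

theorem coe_eq_coe_iff {a b : ℝ} : (a : UnitAddCircle) = b ↔ ∃ n : ℤ, a = b + n := by
  rw [← sub_eq_zero, ← AddCircle.coe_sub, AddCircle.coe_eq_zero_iff]
  constructor
  · rintro ⟨n, hn⟩
    refine ⟨n, ?_⟩
    simp only [zsmul_eq_mul, mul_one] at hn
    linarith
  · rintro ⟨n, hn⟩
    exact ⟨n, by simp only [zsmul_eq_mul, mul_one]; linarith⟩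

theorem proj_eq_proj_iff {v w : ℝ × ℝ} :
    proj v = proj w ↔ ∃ i j : ℤ, v.1 = w.1 + i ∧ v.2 = w.2 + j := by
  simp only [proj, Prod.mk.injEq, coe_eq_coe_iff]
  constructor
  · rintro ⟨⟨i, hi⟩, j, hj⟩; exact ⟨i, j, hi, hj⟩
  · rintro ⟨i, j, hi, hj⟩; exact ⟨⟨i, hi⟩, j, hj⟩

theorem proj_mem_lag_iff {m : ℤ} {v : ℝ × ℝ} : proj v ∈ lag m ↔ ∃ n : ℤ, v.2 + m * v.1 = n := by
  constructor
  · rintro ⟨x, hx⟩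
    obtain ⟨i, j, hi, hj⟩ := proj_eq_proj_iff.1 hx
    simp only at hi hj
    refine ⟨-(j + m * i), ?_⟩
    push_cast
    rw [hi] at hj
    linear_combination -hj
  · rintro ⟨n, hn⟩
    exact ⟨v.1, proj_eq_proj_iff.2 ⟨0, -n, by simp, by push_cast; linear_combination -hn⟩⟩

/-- Two different values would force a half-integral value in between. This places each side of a
lifted triangle on a single line. -/
theorem eq_of_integer_valued {X : Type*} [TopologicalSpace X] {s : Set X} (hs : IsPreconnected s)
    {f : X → ℝ} (hf : ContinuousOn f s) (hi : ∀ x ∈ s, ∃ n : ℤ, f x = n) {x y : X} (hx : x ∈ s)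
    (hy : y ∈ s) : f x = f y := by
  have key : ∀ x ∈ s, ∀ y ∈ s, ¬ f x < f y := by
    intro x hx y hy hlt
    obtain ⟨n, hn⟩ := hi x hx
    obtain ⟨k, hk⟩ := hi y hy
    rw [hn, hk] at hlt
    have h1 : n < k := by exact_mod_cast hlt
    have h2 : ((n : ℝ) + 1) ≤ k := by exact_mod_cast h1
    obtain ⟨z, hz, hfz⟩ := hs.intermediate_value hx hy hf
      (show (n : ℝ) + 1 / 2 ∈ Icc (f x) (f y) from ⟨by rw [hn]; linarith, by rw [hk]; linarith⟩)
    obtain ⟨j, hj⟩ := hi z hz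
    rw [hj] at hfz
    have h3 : (2 * j : ℤ) = 2 * n + 1 := by
      have : (2 * j : ℝ) = 2 * n + 1 := by linarith
      exact_mod_cast this
    omega
  exact le_antisymm (not_lt.1 (key y hy x hx)) (not_lt.1 (key x hx y hy))

theorem isPreconnected_ccwArc {p q : ℂ} : IsPreconnected (ccwArc p q) := by
  rcases (ccwArc p q).eq_empty_or_nonempty with h | ⟨w, α, β, γ, h1, h2, h3, rfl, rfl, rfl⟩
  · rw [h]; exact isPreconnected_empty
  · rw [ccwArc_exp (h1.trans h2) h3]
    exact isPreconnected_Icc.image _ (by fun_prop)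

theorem ccwArc_subset_sphere (p q : ℂ) : ccwArc p q ⊆ Metric.sphere 0 1 := fun _ hw =>
  mem_sphere_zero_iff_norm.2 (norm_eq_one_of_mem_ccwArc hw).2.1

theorem ccwArc_subset_closedBall (p q : ℂ) : ccwArc p q ⊆ Metric.closedBall 0 1 :=
  (ccwArc_subset_sphere p q).trans Metric.sphere_subset_closedBall

theorem IsCcw.left_mem₀₁ {a b c : ℂ} (h : IsCcw a b c) : a ∈ ccwArc a b := by
  obtain ⟨α, β, γ, h1, h2, h3, rfl, rfl, rfl⟩ := h
  exact ⟨α, α, β, le_rfl, h1.le, by linarith, rfl, rfl, rfl⟩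

theorem IsCcw.right_mem₀₁ {a b c : ℂ} (h : IsCcw a b c) : b ∈ ccwArc a b := by
  obtain ⟨α, β, γ, h1, h2, h3, rfl, rfl, rfl⟩ := h
  exact ⟨α, β, β, h1.le, le_rfl, by linarith, rfl, rfl, rfl⟩

theorem IsCcw.rotate {a b c : ℂ} (h : IsCcw a b c) : IsCcw b c a := by
  obtain ⟨α, β, γ, h1, h2, h3, rfl, rfl, rfl⟩ := h
  refine ⟨β, γ, α + 2 * Real.pi, h2, h3, by linarith, rfl, rfl, ?_⟩
  have := exp_add_int_mul α 1
  simp only [Int.cast_one, one_mul] at this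
  exact this.symm

theorem IsCcw.ne {a b c : ℂ} (h : IsCcw a b c) : a ≠ b := by
  obtain ⟨α, β, γ, h1, h2, h3, rfl, rfl, rfl⟩ := h
  exact (exp_mul_I_ne h1 (by linarith)).symm

theorem IsCcw.sphere_eq {a b c : ℂ} (h : IsCcw a b c) {w : ℂ} (hw : w ∈ Metric.sphere (0 : ℂ) 1) :
    w ∈ ccwArc a b ∨ w ∈ ccwArc b c ∨ w ∈ ccwArc c a := by
  obtain ⟨α, β, γ, h1, h2, h3, rfl, rfl, rfl⟩ := h
  obtain ⟨θ, hθ, rfl⟩ := exists_exp_of_mem_sphere hw α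
  have h4 := exp_add_int_mul α 1
  simp only [Int.cast_one, one_mul] at h4
  rcases le_or_gt θ β with h | h
  · exact Or.inl ⟨α, θ, β, hθ.1, h, by linarith, rfl, rfl, rfl⟩
  · rcases le_or_gt θ γ with h' | h'
    · exact Or.inr (Or.inl ⟨β, θ, γ, h.le, h', by linarith, rfl, rfl, rfl⟩)
    · exact Or.inr (Or.inr ⟨γ, θ, α + 2 * Real.pi, h'.le, hθ.2.le, by linarith, rfl, rfl,
        h4.symm⟩)

/-- Two holomorphic maps with the same corners, whose sides lie on the same lines, agree. -/
theorem eqOn_of_sides {J : ℝ × ℝ →ₗ[ℝ] ℝ × ℝ} (hJ : IsComplexStructure J) {F F' : ℂ → ℝ × ℝ}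
    {z₀ z₁ z₂ : ℂ} (hz : IsCcw z₀ z₁ z₂) (hc : ContinuousOn F (Metric.closedBall 0 1))
    (hc' : ContinuousOn F' (Metric.closedBall 0 1)) (hd : ∀ w ∈ Metric.ball (0 : ℂ) 1, IsJHolAt J F w)
    (hd' : ∀ w ∈ Metric.ball (0 : ℂ) 1, IsJHolAt J F' w) {s₀ s₁ s₂ c₀ c₁ c₂ : ℝ} (hs : s₀ ≠ s₂)
    (h₀ : ∀ w ∈ ccwArc z₀ z₁, (F w).2 + s₀ * (F w).1 = c₀)
    (h₁ : ∀ w ∈ ccwArc z₁ z₂, (F w).2 + s₁ * (F w).1 = c₁)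
    (h₂ : ∀ w ∈ ccwArc z₂ z₀, (F w).2 + s₂ * (F w).1 = c₂)
    (h₀' : ∀ w ∈ ccwArc z₀ z₁, (F' w).2 + s₀ * (F' w).1 = c₀)
    (h₁' : ∀ w ∈ ccwArc z₁ z₂, (F' w).2 + s₁ * (F' w).1 = c₁)
    (h₂' : ∀ w ∈ ccwArc z₂ z₀, (F' w).2 + s₂ * (F' w).1 = c₂) :
    ∀ w ∈ Metric.closedBall (0 : ℂ) 1, F w = F' w := by
  -- The corner `z₀` lies on both of the sides with the different slopes `s₀` and `s₂`, which
  -- determine its image.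
  have hk0 : F z₀ - F' z₀ = 0 := by
    have a1 := h₀ z₀ hz.left_mem₀₁
    have a2 := h₀' z₀ hz.left_mem₀₁
    have a3 := h₂ z₀ hz.rotate.rotate.right_mem₀₁
    have a4 := h₂' z₀ hz.rotate.rotate.right_mem₀₁
    have h1 : (F z₀).1 - (F' z₀).1 = 0 := by
      apply mul_left_cancel₀ (sub_ne_zero.2 hs)
      linear_combination a1 - a2 - a3 + a4
    have h2 : (F z₀).2 - (F' z₀).2 = 0 := by linear_combination a1 - a2 - s₀ * h1
    ext <;> simp [h1, h2]
  have hJs : ∀ w ∈ Metric.ball (0 : ℂ) 1, IsJHolAt J (fun w => F w - F' w) w := by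
    intro w hw
    obtain ⟨B, q, hq, hB, -⟩ := exists_complexCoordinate hJ
    rw [isJHolAt_iff hB]
    simp only [map_sub]
    exact ((isJHolAt_iff hB).1 (hd w hw)).sub ((isJHolAt_iff hB).1 (hd' w hw))
  have := eq_zero_of_sphere_lines hJ (hc.sub hc') hJs s₀ s₁ s₂ (fun w hw => by
    simp only [Pi.sub_apply, Prod.snd_sub, Prod.fst_sub]
    rcases hz.sphere_eq hw with h | h | h
    · left; linear_combination h₀ w h - h₀' w h
    · right; left; linear_combination h₁ w h - h₁' w h
    · right; right; linear_combination h₂ w h - h₂' w h)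
    (z := z₀) (by rw [mem_closedBall_zero_iff, hz.norm_eq.1]) hk0
  intro w hw
  exact sub_eq_zero.1 (this w hw)

theorem dehnTwist_iterate_xPoint (n : ℕ) (κ : ℝ) :
    dehnTwist^[n] (xPoint κ) = proj (κ, -(n : ℝ) * κ) := by
  induction n with
  | zero => simp [xPoint]
  | succ n ih =>
    rw [Function.iterate_succ_apply', ih]
    simp only [dehnTwist, proj, ← AddCircle.coe_sub]
    congr 2
    push_cast
    ring

/-- The triangles that contribute to `μ₂ (τ^{m₁} x_{m₂,κ₂}, x_{m₁,κ₁})`, with vertex `y`. -/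
abbrev ProductTriangle (J : ℝ × ℝ →ₗ[ℝ] ℝ × ℝ) (m₁ m₂ : ℕ) (κ₁ κ₂ : ℝ) (y : Torus) : Type :=
  HoloTriangle J ((0 : ℕ) : ℤ) (m₁ : ℤ) ((m₁ + m₂ : ℕ) : ℤ) y (dehnTwist^[0] (xPoint κ₁))
    (dehnTwist^[m₁] (xPoint κ₂))

namespace ProductTriangle

variable {J : ℝ × ℝ →ₗ[ℝ] ℝ × ℝ} {m₁ m₂ : ℕ} {κ₁ κ₂ : ℝ} {y : Torus}

/-- The lift of `S` translated by `-(p, q)` has the vertices `(E_ℓ, 0)`, `(κ₁, 0)` and the third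
vertex over `κ₂ + ℓ`. -/
def HasIndex (S : ProductTriangle J m₁ m₂ κ₁ κ₂ y) (ℓ p q : ℤ) : Prop :=
  (∀ w ∈ ccwArc S.z₀ S.z₁, (S.F w).2 + 0 * (S.F w).1 = q) ∧
  (∀ w ∈ ccwArc S.z₁ S.z₂, (S.F w).2 + m₁ * (S.F w).1 = q + m₁ * (κ₁ + p)) ∧
  (∀ w ∈ ccwArc S.z₂ S.z₀, (S.F w).2 + (m₁ + m₂) * (S.F w).1 =
    q + m₁ * (κ₁ + p) + m₂ * (κ₂ + p + ℓ))

theorem isJHolAt (S : ProductTriangle J m₁ m₂ κ₁ κ₂ y) {w : ℂ} (hw : w ∈ Metric.ball (0 : ℂ) 1) :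
    IsJHolAt J S.F w := by
  refine ⟨?_, S.holo w hw⟩
  obtain ⟨n0, n1, n2⟩ := S.ccw.norm_eq
  have hlt : ‖w‖ < 1 := by simpa using hw
  have hmem : Metric.closedBall (0 : ℂ) 1 \ {S.z₀, S.z₁, S.z₂} ∈ 𝓝 w := by
    filter_upwards [Metric.isOpen_ball.mem_nhds hw] with v hv
    have hlt : ‖v‖ < 1 := by simpa using hv
    refine ⟨Metric.ball_subset_closedBall hv, ?_⟩
    rintro (rfl | rfl | rfl) <;> linarith
  exact (S.smooth.contDiffAt hmem).differentiableAt (by simp)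

theorem HasIndex.vertices {S : ProductTriangle J m₁ m₂ κ₁ κ₂ y} {ℓ p q : ℤ} (hm₁ : 0 < m₁)
    (hm₂ : 0 < m₂) (h : HasIndex S ℓ p q) : S.F S.z₀ = (E m₁ m₂ κ₁ (κ₂ + ℓ) + p, (q : ℝ)) ∧
      S.F S.z₁ = (κ₁ + p, (q : ℝ)) ∧ (S.F S.z₂).1 = κ₂ + p + ℓ := by
  obtain ⟨h0, h1, h2⟩ := h
  have m1 : (m₁ : ℝ) ≠ 0 := by exact_mod_cast hm₁.ne'
  have m2 : (m₂ : ℝ) ≠ 0 := by exact_mod_cast hm₂.ne'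
  have m12 : (m₁ : ℝ) + m₂ ≠ 0 := by positivity
  have a0 := h0 _ S.ccw.left_mem₀₁
  have a1 := h0 _ S.ccw.right_mem₀₁
  have b0 := h1 _ S.ccw.rotate.left_mem₀₁
  have b1 := h1 _ S.ccw.rotate.right_mem₀₁
  have c0 := h2 _ S.ccw.rotate.rotate.left_mem₀₁
  have c1 := h2 _ S.ccw.rotate.rotate.right_mem₀₁
  refine ⟨Prod.ext ?_ (by simpa using a0), Prod.ext ?_ (by simpa using a1), ?_⟩
  · simp only [E]
    field_simp
    linear_combination c1 - a0
  · apply mul_left_cancel₀ m1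
    linear_combination b0 - a1
  · apply mul_left_cancel₀ m2
    linear_combination c0 - b1

/-- Each side has a constant integer value of its linear form. The corners `z₁` and `z₂` lie over
`κ₁ + p` and `κ₂ + r` for integers `p`, `r`, and `ℓ = r - p`; evaluating the forms at the corners
expresses the three constants through `ℓ, p, q`. -/
theorem exists_hasIndex (S : ProductTriangle J m₁ m₂ κ₁ κ₂ y) : ∃ ℓ p q, HasIndex S ℓ p q := by
  have key : ∀ (m : ℤ) (a b : ℂ), a ∈ ccwArc a b → (∀ w ∈ ccwArc a b, proj (S.F w) ∈ lag m) →
      ∃ n : ℤ, ∀ w ∈ ccwArc a b, (S.F w).2 + m * (S.F w).1 = n := by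
    intro m a b ha h
    obtain ⟨n, hn⟩ := proj_mem_lag_iff.1 (h a ha)
    refine ⟨n, fun w hw => ?_⟩
    rw [← hn]
    have hcF := S.continuousOn.mono (ccwArc_subset_closedBall a b)
    exact eq_of_integer_valued (f := fun w => (S.F w).2 + m * (S.F w).1) isPreconnected_ccwArc
      ((continuous_snd.comp_continuousOn hcF).add
        (continuousOn_const.mul (continuous_fst.comp_continuousOn hcF)))
      (fun w hw => proj_mem_lag_iff.1 (h w hw)) hw ha
  obtain ⟨n₀, h₀⟩ := key _ _ _ S.ccw.left_mem₀₁ S.side₀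
  obtain ⟨n₁, h₁⟩ := key _ _ _ S.ccw.rotate.left_mem₀₁ S.side₁
  obtain ⟨n₂, h₂⟩ := key _ _ _ S.ccw.rotate.rotate.left_mem₀₁ S.side₂
  have v1 := S.vertex₁.trans (dehnTwist_iterate_xPoint 0 κ₁)
  have v2 := S.vertex₂.trans (dehnTwist_iterate_xPoint m₁ κ₂)
  obtain ⟨p, -, hp, -⟩ := proj_eq_proj_iff.1 v1
  obtain ⟨r, -, hr, -⟩ := proj_eq_proj_iff.1 v2
  simp only at hp hr
  have a1 := h₀ _ S.ccw.right_mem₀₁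
  have b0 := h₁ _ S.ccw.rotate.left_mem₀₁
  have b1 := h₁ _ S.ccw.rotate.right_mem₀₁
  have c0 := h₂ _ S.ccw.rotate.rotate.left_mem₀₁
  rw [hp] at a1 b0
  rw [hr] at b1 c0
  push_cast at a1 b0 b1 c0
  refine ⟨r - p, p, n₀, fun w hw => ?_, fun w hw => ?_, fun w hw => ?_⟩
  · have := h₀ w hw; simpa using this
  · have := h₁ w hw; push_cast at this ⊢; linear_combination this - b0 + a1
  · have := h₂ w hw; push_cast at this ⊢; linear_combination this - c0 + b1 - b0 + a1

theorem HasIndex.vertex_eq {S : ProductTriangle J m₁ m₂ κ₁ κ₂ y} {ℓ p q : ℤ} (hm₁ : 0 < m₁)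
    (hm₂ : 0 < m₂) (h : HasIndex S ℓ p q) : xPoint (E m₁ m₂ κ₁ (κ₂ + ℓ)) = y := by
  rw [← S.vertex₀, (h.vertices hm₁ hm₂).1, xPoint, proj_eq_proj_iff]
  exact ⟨-p, -q, by simp, by simp⟩

/-- Once the corners are matched by a disc automorphism, the lifts differ only by the deck
translation `(p' - p, q' - q)`, because `eqOn_of_sides` applies after this translation is removed.
-/
theorem HasIndex.equivalent {S S' : ProductTriangle J m₁ m₂ κ₁ κ₂ y} {ℓ p q p' q' : ℤ}
    (hJ : IsComplexStructure J) (hm₁ : 0 < m₁)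
    (hm₂ : 0 < m₂) (h : HasIndex S ℓ p q) (h' : HasIndex S' ℓ p' q') : S.Equivalent S' := by
  obtain ⟨g, hg, g0, g1, g2⟩ := exists_discAut S.ccw S'.ccw
  refine ⟨g, hg, g0, g1, g2, ?_⟩
  obtain ⟨B, _, _, hB, -⟩ := exists_complexCoordinate hJ
  have hgc : ContinuousOn g (Metric.closedBall 0 1) := fun w hw =>
    (hg.differentiableAt (by simpa using hw)).continuousAt.continuousWithinAt
  set t : ℝ × ℝ := ((p' : ℝ) - p, (q' : ℝ) - q) with ht
  have key := eqOn_of_sides hJ S.ccw S.continuousOn (F' := fun w => S'.F (g w) - t)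
    ((S'.continuousOn.comp hgc fun w hw => by
      simpa using hg.norm_le_one (by simpa using hw)).sub continuousOn_const)
    (fun w hw => isJHolAt S hw) (fun w hw => by
      rw [isJHolAt_iff hB]
      have hw' : g w ∈ Metric.ball (0 : ℂ) 1 := by
        simpa using hg.norm_lt_one (by simpa using hw)
      have h1 := (isJHolAt_iff hB).1 (isJHolAt S' hw')
      have h2 : DifferentiableAt ℂ g w :=
        hg.differentiableAt (by simpa using Metric.ball_subset_closedBall hw)
      simp only [map_sub]
      exact (DifferentiableAt.comp w (f := g) h1 h2).sub_const _)
    (s₀ := 0) (s₁ := m₁) (s₂ := m₁ + m₂) (by positivity) h.1 h.2.1 h.2.2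
    (fun w hw => by
      have := h'.1 (g w) (by rw [← g0, ← g1]; exact hg.mapsTo_ccwArc S.ccw.ne hw)
      simp only [ht, Prod.snd_sub, Prod.fst_sub]
      linear_combination this)
    (fun w hw => by
      have := h'.2.1 (g w) (by rw [← g1, ← g2]; exact hg.mapsTo_ccwArc S.ccw.rotate.ne hw)
      simp only [ht, Prod.snd_sub, Prod.fst_sub]
      linear_combination this)
    (fun w hw => by
      have := h'.2.2 (g w) (by rw [← g2, ← g0]; exact hg.mapsTo_ccwArc S.ccw.rotate.rotate.ne hw)
      simp only [ht, Prod.snd_sub, Prod.fst_sub]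
      linear_combination this)
  intro w hw
  rw [key w hw, proj_eq_proj_iff]
  exact ⟨p' - p, q' - q, by simp [ht], by simp [ht]⟩

/-- Lifts of the same map differ by a constant integer vector, so the difference of the first
coordinates at `z₂` and `z₁`, namely `κ₂ + ℓ - κ₁`, is an invariant. -/
theorem HasIndex.index_eq {S S' : ProductTriangle J m₁ m₂ κ₁ κ₂ y} {ℓ ℓ' p q p' q' : ℤ}
    (hm₁ : 0 < m₁) (hm₂ : 0 < m₂) (h : HasIndex S ℓ p q) (h' : HasIndex S' ℓ' p' q')
    (he : S.Equivalent S') : ℓ = ℓ' := by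
  obtain ⟨g, hg, g0, g1, g2, heq⟩ := he
  have hgc : ContinuousOn g (Metric.closedBall 0 1) := fun w hw =>
    (hg.differentiableAt (by simpa using hw)).continuousAt.continuousWithinAt
  have hc : ContinuousOn (fun w => (S'.F (g w)).1 - (S.F w).1) (Metric.closedBall 0 1) :=
    (continuous_fst.comp_continuousOn (S'.continuousOn.comp hgc fun w hw => by
      simpa using hg.norm_le_one (by simpa using hw))).sub
      (continuous_fst.comp_continuousOn S.continuousOn)
  obtain ⟨n0, n1, n2⟩ := S.ccw.norm_eq
  have := eq_of_integer_valued (convex_closedBall (0 : ℂ) 1).isPreconnected hc (fun w hw => by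
    obtain ⟨i, j, hi, hj⟩ := proj_eq_proj_iff.1 (heq w hw)
    exact ⟨i, by rw [hi]; ring⟩) (x := S.z₁) (y := S.z₂) (by simp [n1]) (by simp [n2])
  obtain ⟨-, a1, a2⟩ := h.vertices hm₁ hm₂
  obtain ⟨-, b1, b2⟩ := h'.vertices hm₁ hm₂
  rw [g1, g2, a1, a2, b1, b2] at this
  simp only at this
  have h2 : (ℓ : ℝ) = ℓ' := by linarith
  exact_mod_cast h2

/-- The coefficient of the conformal map of the standard triangle. -/
def scale (m₁ m₂ : ℕ) (κ₁ κ₂ : ℝ) (ℓ : ℤ) : ℝ := (κ₂ + ℓ - κ₁) / (m₁ + m₂)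

theorem param_sides {θ₀ θ₁ θ₂ : ℝ} {G : ℂ → ℝ × ℝ} {Q₀ Q₁ Q₂ : ℝ → ℝ} (hm₁ : 0 < m₁)
    (hm₂ : 0 < m₂) (hG : IsTriangleParam J m₁ m₂ θ₀ θ₁ θ₂ G Q₀ Q₁ Q₂) (hθ01 : θ₀ < θ₁)
    (hθ12 : θ₁ < θ₂) (hθ20 : θ₂ < θ₀ + 2 * Real.pi) (κ₁ κ₂ : ℝ) (ℓ p q : ℤ) (F : ℂ → ℝ × ℝ)
    (hF : ∀ w, F w = (E m₁ m₂ κ₁ (κ₂ + ℓ) + p, (q : ℝ)) + scale m₁ m₂ κ₁ κ₂ ℓ • G w) :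
    (∀ w ∈ ccwArc (Complex.exp (θ₀ * Complex.I)) (Complex.exp (θ₁ * Complex.I)),
      (F w).2 + 0 * (F w).1 = q) ∧
    (∀ w ∈ ccwArc (Complex.exp (θ₁ * Complex.I)) (Complex.exp (θ₂ * Complex.I)),
      (F w).2 + m₁ * (F w).1 = q + m₁ * (κ₁ + p)) ∧
    (∀ w ∈ ccwArc (Complex.exp (θ₂ * Complex.I)) (Complex.exp (θ₀ * Complex.I)),
      (F w).2 + (m₁ + m₂) * (F w).1 = q + m₁ * (κ₁ + p) + m₂ * (κ₂ + p + ℓ)) := by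
  have m12 : (m₁ : ℝ) + m₂ ≠ 0 := by positivity
  have h4 := exp_add_int_mul θ₀ 1
  simp only [Int.cast_one, one_mul] at h4
  rw [ccwArc_exp hθ01.le (by linarith), ccwArc_exp hθ12.le (by linarith), ← h4,
    ccwArc_exp hθ20.le (by linarith)]
  refine ⟨?_, ?_, ?_⟩
  · rintro _ ⟨θ, hθ, rfl⟩
    rw [hF, hG.arc₀ θ hθ]
    simp
  · rintro _ ⟨θ, hθ, rfl⟩
    rw [hF, hG.arc₁ θ hθ]
    simp only [Prod.smul_mk, Prod.mk_add_mk, smul_eq_mul, E, scale]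
    field_simp
    ring
  · rintro _ ⟨θ, hθ, rfl⟩
    rw [hF, hG.arc₂ θ hθ]
    simp only [Prod.smul_mk, Prod.mk_add_mk, smul_eq_mul, E, scale]
    field_simp
    ring

/-- Real scalars commute with `J`, whatever their sign. Thus triangles with `κ₂ + ℓ < κ₁`, and
constant ones, need no separate construction. -/
theorem isJHolAt_affine {G : ℂ → ℝ × ℝ} {w : ℂ} (h : IsJHolAt J G w) (c : ℝ) (v : ℝ × ℝ) :
    IsJHolAt J (fun w => v + c • G w) w := by
  have h1 : fderiv ℝ (fun w => v + c • G w) w = c • fderiv ℝ G w := by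
    rw [fderiv_const_add, fderiv_fun_const_smul h.1]
  refine ⟨(h.1.const_smul c).const_add v, fun u => ?_⟩
  rw [h1]
  simp only [smul_apply, map_smul, h.2 u]

/-- The rescaled standard triangle with the same corners satisfies the same side conditions, so
rigidity identifies it with `S.F`. Area, intersection numbers and stars are all computed from this
form. -/
theorem HasIndex.eqOn {S : ProductTriangle J m₁ m₂ κ₁ κ₂ y} {ℓ p q : ℤ} (hJ : IsComplexStructure J)
    (hm₁ : 0 < m₁) (hm₂ : 0 < m₂) (h : HasIndex S ℓ p q) :
    ∃ (θ₀ θ₁ θ₂ : ℝ) (G : ℂ → ℝ × ℝ) (Q₀ Q₁ Q₂ : ℝ → ℝ), θ₀ < θ₁ ∧ θ₁ < θ₂ ∧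
      θ₂ < θ₀ + 2 * Real.pi ∧ IsTriangleParam J m₁ m₂ θ₀ θ₁ θ₂ G Q₀ Q₁ Q₂ ∧
      ∀ w ∈ Metric.closedBall (0 : ℂ) 1,
        S.F w = (E m₁ m₂ κ₁ (κ₂ + ℓ) + p, (q : ℝ)) + scale m₁ m₂ κ₁ κ₂ ℓ • G w := by
  obtain ⟨θ₀, θ₁, θ₂, h01, h12, h20, e0, e1, e2⟩ := S.ccw
  obtain ⟨G, Q₀, Q₁, Q₂, hG⟩ := exists_triangleParam hJ (m₁ := m₁) (m₂ := m₂)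
    (by exact_mod_cast hm₁) (by exact_mod_cast hm₂) h01 h12 h20
  refine ⟨θ₀, θ₁, θ₂, G, Q₀, Q₁, Q₂, h01, h12, h20, hG, ?_⟩
  obtain ⟨a0, a1, a2⟩ := param_sides hm₁ hm₂ hG h01 h12 h20 κ₁ κ₂ ℓ p q _ (fun w => rfl)
  rw [← e0, ← e1] at a0
  rw [← e1, ← e2] at a1
  rw [← e2, ← e0] at a2
  exact eqOn_of_sides hJ S.ccw S.continuousOn
    (continuousOn_const.add (hG.continuousOn.const_smul (scale m₁ m₂ κ₁ κ₂ ℓ)))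
    (fun w hw => isJHolAt S hw) (fun w hw => isJHolAt_affine (hG.hol w hw) _ _)
    (s₀ := 0) (s₁ := m₁) (s₂ := m₁ + m₂) (by positivity) h.1 h.2.1 h.2.2 a0 a1 a2

theorem exists_of_index (hJ : IsComplexStructure J) (hm₁ : 0 < m₁) (hm₂ : 0 < m₂)
    (hκ₁ : ∃ k : ℤ, m₁ * κ₁ = k) (hκ₂ : ∃ k : ℤ, m₂ * κ₂ = k) (ℓ : ℤ)
    (hy : xPoint (E m₁ m₂ κ₁ (κ₂ + ℓ)) = y) :
    ∃ S : ProductTriangle J m₁ m₂ κ₁ κ₂ y, HasIndex S ℓ 0 0 := by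
  have hπ := Real.pi_gt_three
  obtain ⟨k₁, hk₁⟩ := hκ₁
  obtain ⟨k₂, hk₂⟩ := hκ₂
  -- Any counterclockwise corners would do; the angles `0, 1, 2` qualify because `2 < 2π`.
  obtain ⟨G, Q₀, Q₁, Q₂, hG⟩ := exists_triangleParam hJ (m₁ := m₁) (m₂ := m₂) (θ₀ := 0) (θ₁ := 1)
    (θ₂ := 2) (by exact_mod_cast hm₁) (by exact_mod_cast hm₂) (by norm_num) (by norm_num)
    (by linarith)
  have m12 : (m₁ : ℝ) + m₂ ≠ 0 := by positivity
  set F : ℂ → ℝ × ℝ := fun w =>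
    (E m₁ m₂ κ₁ (κ₂ + ℓ) + ((0 : ℤ) : ℝ), ((0 : ℤ) : ℝ)) + scale m₁ m₂ κ₁ κ₂ ℓ • G w with hF
  have hsides := param_sides hm₁ hm₂ hG (by norm_num) (by norm_num) (by linarith) κ₁ κ₂ ℓ 0 0 F
    (fun w => rfl)
  have g0 := hG.arc₀ 0 ⟨le_rfl, by norm_num⟩
  have g1 := hG.arc₀ 1 ⟨by norm_num, le_rfl⟩
  have g2 := hG.arc₂ 2 ⟨le_rfl, by linarith⟩
  rw [hG.start₀] at g0
  rw [hG.end₀] at g1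
  rw [hG.start₂] at g2
  refine ⟨⟨Complex.exp ((0 : ℝ) * Complex.I), Complex.exp ((1 : ℝ) * Complex.I),
    Complex.exp ((2 : ℝ) * Complex.I), F,
    ⟨0, 1, 2, by norm_num, by norm_num, by linarith, rfl, rfl, rfl⟩,
    continuousOn_const.add (hG.continuousOn.const_smul (scale m₁ m₂ κ₁ κ₂ ℓ)),
    contDiffOn_const.add (hG.smooth.const_smul (scale m₁ m₂ κ₁ κ₂ ℓ)),
    fun w hw => (isJHolAt_affine (hG.hol w hw) _ _).2, ?_, ?_, ?_, ?_, ?_, ?_⟩, hsides⟩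
  · simp only [hF, g0, ← hy, xPoint]
    simp
  · rw [dehnTwist_iterate_xPoint]
    simp only [hF, g1, E, scale]
    congr 1
    ext
    · simp; field_simp; ring
    · simp
  · rw [dehnTwist_iterate_xPoint, proj_eq_proj_iff]
    refine ⟨ℓ, k₁ - m₁ * ℓ, ?_, ?_⟩
    · simp only [hF, g2, E, scale]
      simp; field_simp; ring
    · simp only [hF, g2, E, scale]
      simp; rw [← hk₁]; field_simp; ring
  · intro w hw
    rw [proj_mem_lag_iff]
    exact ⟨0, by simpa using hsides.1 w hw⟩
  · intro w hw
    rw [proj_mem_lag_iff]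
    refine ⟨k₁, ?_⟩
    have := hsides.2.1 w hw
    push_cast at this ⊢
    rw [this, ← hk₁]; ring
  · intro w hw
    rw [proj_mem_lag_iff]
    refine ⟨k₁ + k₂ + m₂ * ℓ, ?_⟩
    have := hsides.2.2 w hw
    push_cast at this ⊢
    rw [this, ← hk₁, ← hk₂]; ring

end ProductTriangle

/-! ### The function `λ` counts lattice points -/

theorem sum_Ioc_sub (s : ℝ) (N : ℕ) (k : ℕ) :
    ∑ i ∈ Finset.Ioc (-(N : ℤ)) (-(N : ℤ) + k), (s - i) =
      k * s + k * N - k * (k + 1) / 2 := by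
  induction k with
  | zero => simp
  | succ k ih =>
    have : Finset.Ioc (-(N : ℤ)) (-(N : ℤ) + (k + 1 : ℕ)) =
        insert (-(N : ℤ) + (k + 1 : ℕ)) (Finset.Ioc (-(N : ℤ)) (-(N : ℤ) + k)) := by
      ext i; simp only [Finset.mem_insert, Finset.mem_Ioc]; push_cast; omega
    rw [this, Finset.sum_insert (by simp), ih]
    push_cast
    ring

/-- Only the terms with `i ≤ ⌊s⌋` survive and form an arithmetic progression. Thus `phi` is a sum of
positive parts up to an affine function of `s`. -/
theorem sum_Ioc_posPart (s : ℝ) (N : ℕ) (h : |s| < N) :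
    ∑ i ∈ Finset.Ioc (-(N : ℤ)) N, max (s - i) 0 = phi s + (N * s + N * (N - 1) / 2) := by
  obtain ⟨h1, h2⟩ := abs_lt.1 h
  have h3 : -(N : ℤ) ≤ ⌊s⌋ := Int.le_floor.2 (by push_cast; exact h1.le)
  have h4 : ⌊s⌋ ≤ (N : ℤ) := Int.floor_le_iff.2 (by push_cast; linarith)
  obtain ⟨k, hk⟩ := Int.le.dest h3
  have hk' : (⌊s⌋ : ℝ) = -N + k := by exact_mod_cast hk.symm
  have h5 : ∑ i ∈ Finset.Ioc (-(N : ℤ)) N, max (s - i) 0 =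
      ∑ i ∈ Finset.Ioc (-(N : ℤ)) ⌊s⌋, (s - i) := by
    rw [← Finset.sum_subset (Finset.Ioc_subset_Ioc_right h4) (f := fun i : ℤ => max (s - i) 0)]
    · refine Finset.sum_congr rfl fun i hi => max_eq_left ?_
      have := Int.le_floor.1 (Finset.mem_Ioc.1 hi).2
      linarith
    · intro i hi hi'
      refine max_eq_right ?_
      simp only [Finset.mem_Ioc, not_and, not_le] at hi hi'
      have := Int.floor_lt.1 (hi' hi.1)
      linarith
  rw [h5, ← hk, sum_Ioc_sub, phi, Int.floor_add_one]
  push_cast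
  rw [hk']
  ring

/-- The integers `j` such that `(i, j)` lies in the triangle, its lower and its left side included
as appropriate. -/
def column (m₁ m₂ : ℕ) (k₁ k₂ i : ℤ) : Finset ℤ :=
  if m₂ * k₁ < m₁ * k₂ then Finset.Ico (k₁ - m₁ * i) (min 0 (k₁ + k₂ - (m₁ + m₂) * i))
  else Finset.Ico (max 0 (k₁ + k₂ - (m₁ + m₂) * i)) (k₁ - m₁ * i)

/-- In terms of `A = k₁ - m₁ i` and `B = k₂ - m₂ i`, the case distinction compares `m₂ A` with `m₁
B` and does not depend on `i`. It restricts the possible signs of `A` and `B`, after which both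
sides are piecewise linear. -/
theorem card_column {m₁ m₂ : ℕ} (hm₁ : 0 < m₁) (hm₂ : 0 < m₂) (k₁ k₂ i : ℤ) :
    ((column m₁ m₂ k₁ k₂ i).card : ℤ) = max (k₁ - m₁ * i) 0 + max (k₂ - m₂ * i) 0 -
      max (k₁ + k₂ - (m₁ + m₂) * i) 0 := by
  have h1 : (0 : ℤ) < m₁ := by exact_mod_cast hm₁
  have h2 : (0 : ℤ) < m₂ := by exact_mod_cast hm₂
  set A := k₁ - m₁ * i with hA
  set B := k₂ - m₂ * i with hB
  have hAB : k₁ + k₂ - (m₁ + m₂) * i = A + B := by rw [hA, hB]; ring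
  have hd : (m₁ : ℤ) * k₂ - m₂ * k₁ = m₁ * B - m₂ * A := by rw [hA, hB]; ring
  rw [column, hAB]
  split_ifs with h
  · have h' : m₂ * A < m₁ * B := by linarith
    rw [Int.card_Ico]
    rcases le_or_gt 0 A with a | a
    · have : 0 < B := by
        by_contra hb
        nlinarith [mul_nonneg h2.le a, mul_nonneg h1.le (show 0 ≤ -B by linarith)]
      omega
    · rcases le_or_gt 0 B with b | b <;> omega
  · have h' : m₁ * B ≤ m₂ * A := by linarith
    rw [Int.card_Ico]
    rcases le_or_gt A 0 with a | a
    · have : B ≤ 0 := by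
        by_contra hb
        nlinarith [mul_nonneg h2.le (show 0 ≤ -A by linarith), mul_pos h1 (not_le.1 hb)]
      omega
    · rcases le_or_gt 0 B with b | b <;> omega

/-- The lattice points of the triangle. -/
def latticePoints (m₁ m₂ : ℕ) (k₁ k₂ : ℤ) : Set (ℤ × ℤ) := {x | x.2 ∈ column m₁ m₂ k₁ k₂ x.1}

/-- The affine corrections of the three values of `phi` cancel, because `E` is the mean of `u` and
`v` with weights `m₁` and `m₂`. -/
theorem lam_eq_sum {m₁ m₂ : ℕ} (hm₁ : 0 < m₁) (hm₂ : 0 < m₂) {u v : ℝ} {N : ℕ}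
    (hu : |u| < N) (hv : |v| < N) : lam m₁ m₂ u v = ∑ i ∈ Finset.Ioc (-(N : ℤ)) N,
      (m₁ * max (u - i) 0 + m₂ * max (v - i) 0 - (m₁ + m₂) * max (E m₁ m₂ u v - i) 0) := by
  have m1 : (0 : ℝ) < m₁ := by exact_mod_cast hm₁
  have m2 : (0 : ℝ) < m₂ := by exact_mod_cast hm₂
  have hE : |E m₁ m₂ u v| < N := by
    rw [abs_lt] at hu hv ⊢
    rw [E, div_lt_iff₀ (by positivity), lt_div_iff₀ (by positivity)]
    constructor <;> nlinarith
  rw [Finset.sum_sub_distrib, Finset.sum_add_distrib, ← Finset.mul_sum, ← Finset.mul_sum,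
    ← Finset.mul_sum, sum_Ioc_posPart _ _ hu, sum_Ioc_posPart _ _ hv, sum_Ioc_posPart _ _ hE, lam]
  simp only [E]
  field_simp
  ring

theorem ncard_latticePoints {m₁ m₂ : ℕ} (hm₁ : 0 < m₁) (hm₂ : 0 < m₂) {u v : ℝ} {k₁ k₂ : ℤ}
    (hu : m₁ * u = k₁) (hv : m₂ * v = k₂) :
    ((latticePoints m₁ m₂ k₁ k₂).ncard : ℝ) = lam m₁ m₂ u v := by
  have m1 : (0 : ℝ) < m₁ := by exact_mod_cast hm₁
  have m2 : (0 : ℝ) < m₂ := by exact_mod_cast hm₂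
  obtain ⟨N, hN⟩ := exists_nat_gt (max |u| |v|)
  have hu' := (le_max_left _ _).trans_lt hN
  have hv' := (le_max_right _ _).trans_lt hN
  have hcol : ∀ i : ℤ, ((column m₁ m₂ k₁ k₂ i).card : ℝ) =
      m₁ * max (u - i) 0 + m₂ * max (v - i) 0 - (m₁ + m₂) * max (E m₁ m₂ u v - i) 0 := by
    intro i
    have h := card_column hm₁ hm₂ k₁ k₂ i
    have h' : ((column m₁ m₂ k₁ k₂ i).card : ℝ) = max ((k₁ : ℝ) - m₁ * i) 0 +
        max ((k₂ : ℝ) - m₂ * i) 0 - max ((k₁ : ℝ) + k₂ - (m₁ + m₂) * i) 0 := by exact_mod_cast h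
    rw [h', mul_max_of_nonneg _ _ m1.le, mul_max_of_nonneg _ _ m2.le,
      mul_max_of_nonneg _ _ (add_pos m1 m2).le, ← hu, ← hv]
    simp only [E, mul_zero, mul_sub]
    congr 3
    field_simp
  -- Outside this range the three positive parts are all linear or all zero, and their combination
  -- vanishes.
  have hzero : ∀ i : ℤ, i ∉ Finset.Ioc (-(N : ℤ)) N → column m₁ m₂ k₁ k₂ i = ∅ := by
    intro i hi
    rw [← Finset.card_eq_zero]
    have h := hcol i
    rw [abs_lt] at hu' hv'
    simp only [Finset.mem_Ioc, not_and, not_le] at hi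
    have hE1 : (m₁ + m₂) * E m₁ m₂ u v = m₁ * u + m₂ * v := by
      simp only [E]; field_simp
    rcases le_or_gt i (-N) with h1 | h1
    · have h2 : (i : ℝ) ≤ -N := by exact_mod_cast h1
      have hE2 : 0 ≤ E m₁ m₂ u v - i := by
        by_contra hc
        nlinarith [mul_pos m1 (show 0 < u - i by linarith), mul_pos m2 (show 0 < v - i by linarith),
          mul_pos (add_pos m1 m2) (neg_pos.2 (not_le.1 hc))]
      rw [max_eq_left (by linarith), max_eq_left (by linarith), max_eq_left hE2] at h
      have : ((column m₁ m₂ k₁ k₂ i).card : ℝ) = 0 := by rw [h]; linarith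
      exact_mod_cast this
    · have h2 : (N : ℝ) < i := by exact_mod_cast hi h1
      have hE2 : E m₁ m₂ u v - i ≤ 0 := by
        by_contra hc
        nlinarith [mul_pos m1 (show 0 < i - u by linarith), mul_pos m2 (show 0 < i - v by linarith),
          mul_pos (add_pos m1 m2) (not_le.1 hc)]
      rw [max_eq_right (by linarith), max_eq_right (by linarith), max_eq_right hE2] at h
      have : ((column m₁ m₂ k₁ k₂ i).card : ℝ) = 0 := by rw [h]; ring
      exact_mod_cast this
  have hset : latticePoints m₁ m₂ k₁ k₂ = ((Finset.Ioc (-(N : ℤ)) N).sigma (column m₁ m₂ k₁ k₂)).map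
      (Equiv.sigmaEquivProd ℤ ℤ).toEmbedding := by
    ext ⟨i, j⟩
    simp only [latticePoints, Finset.coe_map, Set.mem_image, Finset.mem_coe, Finset.mem_sigma]
    constructor
    · intro h
      refine ⟨⟨i, j⟩, ⟨?_, h⟩, rfl⟩
      by_contra hi
      have h' : j ∈ column m₁ m₂ k₁ k₂ i := h
      rw [hzero i hi] at h'
      simp at h'
    · rintro ⟨⟨i', j'⟩, ⟨-, h⟩, he⟩
      cases he
      exact h
  rw [hset, Set.ncard_coe_finset, Finset.card_map, Finset.card_sigma, lam_eq_sum hm₁ hm₂ hu' hv']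
  push_cast
  exact Finset.sum_congr rfl fun i _ => hcol i

/-- Exactly, `phi s` exceeds the parabola by `f (1 - f) / 2`, where `f` is the fractional part of
`s`. -/
theorem phi_mem_Icc (s : ℝ) : phi s ∈ Icc ((s ^ 2 - s) / 2) ((s ^ 2 - s) / 2 + 1 / 8) := by
  have h : phi s = (s ^ 2 - s) / 2 + Int.fract s * (1 - Int.fract s) / 2 := by
    rw [phi, Int.floor_add_one, Int.fract]
    push_cast
    ring
  have h0 := Int.fract_nonneg s
  have h1 := (Int.fract_lt_one s).le
  rw [h]
  constructor
  · nlinarith [mul_nonneg h0 (sub_nonneg.2 h1)]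
  · nlinarith [sq_nonneg (Int.fract s - 1 / 2)]

/-- Replacing `phi` by its parabola turns `lam` into the area of the triangle; only the negative
term at `E` loses anything, at most `(m₁ + m₂) / 8`. This gives the growth needed for convergence.
-/
theorem le_lam {m₁ m₂ : ℕ} (hm₁ : 0 < m₁) (u v : ℝ) :
    m₁ * m₂ * (u - v) ^ 2 / (2 * (m₁ + m₂)) - (m₁ + m₂) / 8 ≤ lam m₁ m₂ u v := by
  have m1 : (0 : ℝ) < m₁ := by exact_mod_cast hm₁
  have h1 := (phi_mem_Icc u).1
  have h2 := (phi_mem_Icc v).1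
  have h3 := (phi_mem_Icc (E m₁ m₂ u v)).2
  have h4 : (m₁ : ℝ) * m₂ * (u - v) ^ 2 / (2 * (m₁ + m₂)) - (m₁ + m₂) / 8 =
      m₁ * ((u ^ 2 - u) / 2) + m₂ * ((v ^ 2 - v) / 2) -
        (m₁ + m₂) * ((E m₁ m₂ u v ^ 2 - E m₁ m₂ u v) / 2 + 1 / 8) := by
    simp only [E]
    field_simp
    ring
  rw [h4, lam]
  gcongr

/-! ### Intersections with the divisor -/

/-- Together with its positive counterpart, this converts the open conditions on a translate of `D`
into the half-open intervals of `column`. -/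
theorem add_intCast_neg_iff {s : ℝ} (h0 : 0 < s) (h1 : s < 1) (n : ℤ) : s + n < 0 ↔ n < 0 := by
  constructor
  · intro h
    have : (n : ℝ) < 0 := by linarith
    exact_mod_cast this
  · intro h
    have : (n : ℝ) ≤ -1 := by exact_mod_cast Int.le_sub_one_of_lt h
    linarith

theorem add_intCast_pos_iff {s : ℝ} (h0 : 0 < s) (h1 : s < 1) (n : ℤ) : 0 < s + n ↔ 0 ≤ n := by
  constructor
  · intro h
    have : (-1 : ℝ) < n := by linarith
    have : (-1 : ℤ) < n := by exact_mod_cast this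
    omega
  · intro h
    have : (0 : ℝ) ≤ n := by exact_mod_cast h
    linarith

theorem proj_notMem_lag {d : ℝ × ℝ} {m : ℤ} (h0 : 0 < d.2 + m * d.1) (h1 : d.2 + m * d.1 < 1) :
    proj d ∉ lag m := by
  rw [proj_mem_lag_iff]
  rintro ⟨n, hn⟩
  rw [hn] at h0 h1
  have h2 : (0 : ℤ) < n := by exact_mod_cast h0
  have h3 : n < (1 : ℤ) := by exact_mod_cast h1
  omega

/-- At `d + (i, j)` each of the three edge forms is an integer plus a number in `(0, 1)`, so its
sign is an integer inequality. The sign of the scale `l` decides whether the triangle is upright or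
turned by `π`, which matches the two cases of `column`. -/
theorem mem_latticePoints_iff {m₁ m₂ : ℕ} (hm₁ : 0 < m₁) (hm₂ : 0 < m₂) {u v : ℝ} {k₁ k₂ : ℤ}
    (hu : m₁ * u = k₁) (hv : m₂ * v = k₂) {d : ℝ × ℝ} (hd1 : 0 < d.1) (hd2 : 0 < d.2)
    (hd : d.2 + (m₁ + m₂) * d.1 < 1) (x : ℤ × ℤ) : x ∈ latticePoints m₁ m₂ k₁ k₂ ↔
      ∃ g ∈ standardTriangle m₁ m₂, (d.1 + x.1, d.2 + x.2) =
        (E m₁ m₂ u v, (0 : ℝ)) + ((v - u) / (m₁ + m₂)) • g := by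
  have m1 : (0 : ℝ) < m₁ := by exact_mod_cast hm₁
  have m2 : (0 : ℝ) < m₂ := by exact_mod_cast hm₂
  obtain ⟨i, j⟩ := x
  have s1 : d.2 + m₁ * d.1 < 1 := by nlinarith
  have s2 : d.2 < 1 := by nlinarith
  have p1 : 0 < d.2 + m₁ * d.1 := by positivity
  have p2 : 0 < d.2 + (m₁ + m₂) * d.1 := by positivity
  have hE : (m₁ + m₂) * E m₁ m₂ u v = k₁ + k₂ := by simp only [E]; field_simp; linarith
  set e := E m₁ m₂ u v with he
  set l := (v - u) / (m₁ + m₂) with hl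
  have hl1 : l * (m₁ + m₂) = v - u := by rw [hl]; field_simp
  have hl2 : m₁ * (e - l * m₂) = k₁ := by
    rw [he, hl, E, ← hu]; field_simp; ring
  have hcmp : ((m₂ : ℤ) * k₁ < m₁ * k₂) ↔ 0 < l := by
    have : ((m₂ : ℤ) * k₁ < m₁ * k₂) ↔ (m₂ : ℝ) * k₁ < m₁ * k₂ := by exact_mod_cast Iff.rfl
    rw [this, ← hu, ← hv]
    have h3 : (m₁ : ℝ) * (m₂ * v) - m₂ * (m₁ * u) = (m₁ * m₂ * (m₁ + m₂)) * l := by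
      linear_combination -(m₁ * m₂ : ℝ) * hl1
    rw [← sub_pos, h3, mul_pos_iff_of_pos_left (by positivity)]
  have e1 : ((0 : ℝ) < d.2 + m₁ * d.1 + ((j - k₁ + m₁ * i : ℤ) : ℝ)) ↔ k₁ - m₁ * i ≤ j := by
    rw [add_intCast_pos_iff p1 s1]; omega
  have e1' : (d.2 + m₁ * d.1 + ((j - k₁ + m₁ * i : ℤ) : ℝ) < 0) ↔ j < k₁ - m₁ * i := by
    rw [add_intCast_neg_iff p1 s1]; omega
  have e2 : (d.2 + (m₁ + m₂) * d.1 + ((j - k₁ - k₂ + (m₁ + m₂) * i : ℤ) : ℝ) < 0) ↔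
      j < k₁ + k₂ - (m₁ + m₂) * i := by
    rw [add_intCast_neg_iff p2 hd]
    constructor <;> intro h <;> linarith
  have e2' : (0 < d.2 + (m₁ + m₂) * d.1 + ((j - k₁ - k₂ + (m₁ + m₂) * i : ℤ) : ℝ)) ↔
      k₁ + k₂ - (m₁ + m₂) * i ≤ j := by
    rw [add_intCast_pos_iff p2 hd]
    constructor <;> intro h <;> linarith
  push_cast at e1 e1' e2 e2'
  have hmem : (i, j) ∈ latticePoints m₁ m₂ k₁ k₂ ↔ j ∈ column m₁ m₂ k₁ k₂ i := Iff.rfl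
  rw [hmem, column]
  have hg : ∀ g : ℝ × ℝ, (d.1 + (i : ℝ), d.2 + (j : ℝ)) = (e, (0 : ℝ)) + l • g ↔
      d.1 + i = e + l * g.1 ∧ d.2 + j = l * g.2 := fun g => by
    simp [Prod.ext_iff]
  simp only [hg]
  rcases lt_trichotomy 0 l with h | h | h
  · rw [if_pos (hcmp.2 h), Finset.mem_Ico, lt_min_iff, ← e1, ← e2, ← add_intCast_neg_iff hd2 s2]
    constructor
    · rintro ⟨a1, a2, a3⟩
      refine ⟨((d.1 + i - e) / l, (d.2 + j) / l), ⟨?_, ?_, ?_⟩, ?_, ?_⟩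
      · exact div_neg_of_neg_of_pos a2 h
      · have : (d.2 + j) / l + m₁ * ((d.1 + i - e) / l) + m₁ * m₂ =
            (d.2 + m₁ * d.1 + (j - k₁ + m₁ * i)) / l := by
          rw [← hl2]; field_simp; ring
        simp only [this]
        positivity
      · have : (d.2 + j) / l + (m₁ + m₂) * ((d.1 + i - e) / l) =
            (d.2 + (m₁ + m₂) * d.1 + (j - k₁ - k₂ + (m₁ + m₂) * i)) / l := by
          field_simp; linear_combination -hE
        simp only [this]
        exact div_neg_of_neg_of_pos a3 h
      · field_simp; ring
      · field_simp
    · rintro ⟨g, ⟨g1, g2, g3⟩, h1, h2⟩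
      have b1 := mul_neg_of_pos_of_neg h g1
      have b2 := mul_pos h g2
      have b3 := mul_neg_of_pos_of_neg h g3
      refine ⟨?_, ?_, ?_⟩
      · rwa [show d.2 + m₁ * d.1 + (j - k₁ + m₁ * i) = l * (g.2 + m₁ * g.1 + m₁ * m₂) by
          linear_combination h2 + m₁ * h1 + hl2]
      · rw [h2]; exact b1
      · rwa [show d.2 + (m₁ + m₂) * d.1 + (j - k₁ - k₂ + (m₁ + m₂) * i) =
          l * (g.2 + (m₁ + m₂) * g.1) by linear_combination h2 + (m₁ + m₂) * h1 + hE]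
  -- For `l = 0` both sides are false: the column is empty, and the degenerate triangle has second
  -- coordinate `0`, which `d.2 + j` never is.
  · rw [if_neg (by rw [hcmp]; exact h.not_lt), ← h]
    constructor
    · intro hj
      rw [Finset.mem_Ico, max_le_iff, ← e1', ← e2', ← add_intCast_pos_iff hd2 s2] at hj
      exfalso
      obtain ⟨⟨a1, a2⟩, a3⟩ := hj
      rw [← h] at hl1 hl2
      have : (k₁ : ℝ) = m₁ * e := by linarith
      have h2 : (k₂ : ℝ) = m₂ * e := by linarith
      have c1 : d.1 + i - e < 0 := by
        by_contra hc
        nlinarith [mul_nonneg m1.le (not_lt.1 hc)]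
      nlinarith [mul_pos m2 (neg_pos.2 c1)]
    · rintro ⟨g, -, -, h2⟩
      exfalso
      rw [zero_mul] at h2
      have a1 : ¬ (d.2 + j < 0) := by rw [h2]; exact lt_irrefl _
      have a2 : ¬ (0 < d.2 + j) := by rw [h2]; exact lt_irrefl _
      rw [add_intCast_neg_iff hd2 s2] at a1
      rw [add_intCast_pos_iff hd2 s2] at a2
      omega
  · rw [if_neg (by rw [hcmp]; exact h.not_gt), Finset.mem_Ico, max_le_iff, ← e1', ← e2',
      ← add_intCast_pos_iff hd2 s2]
    have h' := h.ne
    constructor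
    · rintro ⟨⟨a1, a2⟩, a3⟩
      refine ⟨((d.1 + i - e) / l, (d.2 + j) / l), ⟨?_, ?_, ?_⟩, ?_, ?_⟩
      · exact div_neg_of_pos_of_neg a1 h
      · have : (d.2 + j) / l + m₁ * ((d.1 + i - e) / l) + m₁ * m₂ =
            (d.2 + m₁ * d.1 + (j - k₁ + m₁ * i)) / l := by
          rw [← hl2]; field_simp; ring
        simp only [this]
        exact div_pos_of_neg_of_neg a3 h
      · have : (d.2 + j) / l + (m₁ + m₂) * ((d.1 + i - e) / l) =
            (d.2 + (m₁ + m₂) * d.1 + (j - k₁ - k₂ + (m₁ + m₂) * i)) / l := by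
          field_simp; linear_combination -hE
        simp only [this]
        exact div_neg_of_pos_of_neg a2 h
      · field_simp; ring
      · field_simp
    · rintro ⟨g, ⟨g1, g2, g3⟩, h1, h2⟩
      have b1 := mul_pos_of_neg_of_neg h g1
      have b2 := mul_neg_of_neg_of_pos h g2
      have b3 := mul_pos_of_neg_of_neg h g3
      refine ⟨⟨?_, ?_⟩, ?_⟩
      · rw [h2]; exact b1
      · rwa [show d.2 + (m₁ + m₂) * d.1 + (j - k₁ - k₂ + (m₁ + m₂) * i) =
          l * (g.2 + (m₁ + m₂) * g.1) by linear_combination h2 + (m₁ + m₂) * h1 + hE]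
      · rwa [show d.2 + m₁ * d.1 + (j - k₁ + m₁ * i) = l * (g.2 + m₁ * g.1 + m₁ * m₂) by
          linear_combination h2 + m₁ * h1 + hl2]

namespace ProductTriangle

variable {J : ℝ × ℝ →ₗ[ℝ] ℝ × ℝ} {m₁ m₂ : ℕ} {κ₁ κ₂ : ℝ} {y : Torus}

theorem mem_lag_of_mem_sphere (S : ProductTriangle J m₁ m₂ κ₁ κ₂ y) {w : ℂ}
    (hw : w ∈ Metric.sphere (0 : ℂ) 1) : proj (S.F w) ∈ lag ((0 : ℕ) : ℤ) ∨
      proj (S.F w) ∈ lag (m₁ : ℤ) ∨ proj (S.F w) ∈ lag ((m₁ + m₂ : ℕ) : ℤ) :=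
  (S.ccw.sphere_eq hw).imp (S.side₀ w) fun h => h.imp (S.side₁ w) (S.side₂ w)

/-- No preimage lies on the circle, since `D` avoids the three Lagrangians. In the open disc `G` is
a bijection onto the standard triangle, so the preimages correspond to the lattice translates of `d`
in the rescaled triangle. -/
theorem HasIndex.divisorCount_eq {S : ProductTriangle J m₁ m₂ κ₁ κ₂ y} {ℓ p q : ℤ}
    (hJ : IsComplexStructure J) (hm₁ : 0 < m₁) (hm₂ : 0 < m₂) (h : HasIndex S ℓ p q) {k₁ k₂ : ℤ}
    (hκ₁ : m₁ * κ₁ = k₁) (hκ₂ : m₂ * κ₂ = k₂) {d : ℝ × ℝ} (hd1 : 0 < d.1) (hd2 : 0 < d.2)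
    (hd : d.2 + (m₁ + m₂) * d.1 < 1) :
    (S.divisorCount (proj d) : ℝ) = lam m₁ m₂ κ₁ (κ₂ + ℓ) := by
  have m1 : (0 : ℝ) < m₁ := by exact_mod_cast hm₁
  have m2 : (0 : ℝ) < m₂ := by exact_mod_cast hm₂
  have hv : m₂ * (κ₂ + ℓ) = ((k₂ + m₂ * ℓ : ℤ) : ℝ) := by push_cast; rw [← hκ₂]; ring
  have m1' : (1 : ℝ) ≤ m₁ := by exact_mod_cast hm₁
  have hd1' : d.1 < 1 := by nlinarith
  have hd2' : d.2 < 1 := by nlinarith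
  rw [← ncard_latticePoints hm₁ hm₂ hκ₁ hv]
  obtain ⟨_, _, _, G, _, _, _, -, -, -, hG, hF⟩ := h.eqOn hJ hm₁ hm₂
  set W := {w ∈ Metric.closedBall (0 : ℂ) 1 | proj (S.F w) = proj d} with hW
  have hWball : ∀ w ∈ W, w ∈ Metric.ball (0 : ℂ) 1 := by
    rintro w ⟨hw, hwd⟩
    by_contra hnb
    have hsp : w ∈ Metric.sphere (0 : ℂ) 1 := by
      simp only [Metric.mem_closedBall, Metric.mem_ball, Metric.mem_sphere, not_lt] at *
      exact le_antisymm hw hnb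
    rcases S.mem_lag_of_mem_sphere hsp with h | h | h <;> rw [hwd] at h <;> revert h <;>
      apply proj_notMem_lag <;> push_cast <;> nlinarith
  -- As both coordinates of `d` lie in `(0, 1)`, floors recover the lattice translate on which the
  -- lift lands.
  set f : ℂ → ℤ × ℤ := fun w => (⌊(S.F w).1⌋ - p, ⌊(S.F w).2⌋ - q) with hf
  have key : ∀ w ∈ W, S.F w = (d.1 + (f w).1 + p, d.2 + (f w).2 + q) := by
    rintro w ⟨-, hwd⟩
    obtain ⟨i, j, hi, hj⟩ := proj_eq_proj_iff.1 hwd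
    have f1 : ⌊(S.F w).1⌋ = i := by
      rw [hi, Int.floor_add_intCast, Int.floor_eq_zero_iff.2 ⟨hd1.le, hd1'⟩, zero_add]
    have f2 : ⌊(S.F w).2⌋ = j := by
      rw [hj, Int.floor_add_intCast, Int.floor_eq_zero_iff.2 ⟨hd2.le, hd2'⟩, zero_add]
    simp only [hf, f1, f2]
    ext
    · rw [hi]; push_cast; ring
    · rw [hj]; push_cast; ring
  have key2 : ∀ w ∈ Metric.closedBall (0 : ℂ) 1, ∀ x : ℤ × ℤ,
      (d.1 + (x.1 : ℝ), d.2 + (x.2 : ℝ)) = (E m₁ m₂ κ₁ (κ₂ + ℓ), (0 : ℝ)) +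
        ((κ₂ + ℓ - κ₁) / (m₁ + m₂)) • G w ↔ S.F w = (d.1 + x.1 + p, d.2 + x.2 + q) := by
    intro w hw x
    rw [hF w hw, scale, Prod.ext_iff, Prod.ext_iff]
    simp only [Prod.fst_add, Prod.snd_add]
    constructor <;> rintro ⟨a1, a2⟩ <;> constructor <;> linarith
  have himage : f '' W = latticePoints m₁ m₂ k₁ (k₂ + m₂ * ℓ) := by
    ext x
    rw [mem_latticePoints_iff hm₁ hm₂ hκ₁ hv hd1 hd2 hd]
    constructor
    · rintro ⟨w, hw, rfl⟩
      exact ⟨G w, hG.bijOn.mapsTo (hWball w hw), (key2 w hw.1 _).2 (key w hw)⟩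
    · rintro ⟨g, hg, hx⟩
      obtain ⟨w, hw, rfl⟩ := hG.bijOn.surjOn hg
      have hw' := Metric.ball_subset_closedBall hw
      have hFw := (key2 w hw' x).1 hx
      have hwW : w ∈ W := ⟨hw', proj_eq_proj_iff.2 ⟨x.1 + p, x.2 + q, by
        rw [hFw]; push_cast; ring, by rw [hFw]; push_cast; ring⟩⟩
      refine ⟨w, hwW, ?_⟩
      have := key w hwW
      rw [hFw] at this
      simp only [Prod.mk.injEq, add_left_inj, add_right_inj, Int.cast_inj] at this
      exact Prod.ext this.1.symm this.2.symm
  have hinj : InjOn f W := by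
    intro w hw w' hw' hff
    have h1 := (key2 w hw.1 _).2 (key w hw)
    have h2 := (key2 w' hw'.1 _).2 (key w' hw')
    rw [← hff, h1] at h2
    have h3 := add_left_cancel h2
    have hne : (κ₂ + ℓ - κ₁) / (m₁ + m₂) ≠ 0 := by
      intro h0
      rw [h0] at h1
      have h4 := congrArg Prod.snd h1
      simp only [zero_smul, add_zero] at h4
      have a1 : ¬ (d.2 + (f w).2 < 0) := by rw [h4]; exact lt_irrefl _
      have a2 : ¬ (0 < d.2 + (f w).2) := by rw [h4]; exact lt_irrefl _
      rw [add_intCast_neg_iff hd2 hd2'] at a1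
      rw [add_intCast_pos_iff hd2 hd2'] at a2
      omega
    exact hG.bijOn.injOn (hWball w hw) (hWball w' hw') (smul_right_injective _ hne h3)
  rw [← himage, hinj.ncard_image]
  rfl

end ProductTriangle

/-! ### The symplectic area -/

theorem volume_standardTriangle {m₁ m₂ : ℝ} (hm₁ : 0 < m₁) (hm₂ : 0 < m₂) :
    volume.real (standardTriangle m₁ m₂) = m₁ * m₂ * (m₁ + m₂) / 2 := by
  have hset : standardTriangle m₁ m₂ = regionBetween (fun x => -m₁ * (x + m₂))
      (fun x => min 0 (-(m₁ + m₂) * x)) (Ioc (-m₂) m₁) := by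
    ext ⟨x, y⟩
    simp only [standardTriangle, regionBetween, mem_ofPred_eq, mem_Ioc, mem_Ioo, lt_min_iff]
    constructor
    · rintro ⟨h1, h2, h3⟩
      refine ⟨⟨?_, ?_⟩, ?_, h1, ?_⟩
      · by_contra h
        nlinarith
      · by_contra h
        nlinarith
      · linarith
      · linarith
    · rintro ⟨-, h1, h2, h3⟩
      exact ⟨h2, by linarith, by linarith⟩
  have hc1 : Continuous fun x : ℝ => -m₁ * (x + m₂) := by fun_prop
  have hc2 : Continuous fun x : ℝ => min 0 (-(m₁ + m₂) * x) := by fun_prop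
  have hle : ∀ x ∈ Ioc (-m₂) m₁, -m₁ * (x + m₂) ≤ min 0 (-(m₁ + m₂) * x) := fun x hx => by
    rw [le_min_iff]
    constructor <;> nlinarith [hx.1, hx.2]
  rw [hset, Measure.real, Measure.volume_eq_prod, volume_regionBetween_eq_integral
    (hc1.integrableOn_Ioc) (hc2.integrableOn_Ioc) measurableSet_Ioc hle, ENNReal.toReal_ofReal]
  · rw [← intervalIntegral.integral_of_le (by linarith), ← intervalIntegral.integral_add_adjacent_intervals
      (b := 0) ((hc2.sub hc1).intervalIntegrable _ _) ((hc2.sub hc1).intervalIntegrable _ _)]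
    have h1 : ∫ x in (-m₂)..0, ((fun x => min 0 (-(m₁ + m₂) * x)) - fun x => -m₁ * (x + m₂)) x =
        ∫ x in (-m₂)..0, m₁ * (x + m₂) := by
      apply intervalIntegral.integral_congr
      intro x hx
      rw [uIcc_of_le (by linarith)] at hx
      simp only [Pi.sub_apply]
      rw [min_eq_left (by nlinarith [hx.2])]
      ring
    have h2 : ∫ x in (0 : ℝ)..m₁, ((fun x => min 0 (-(m₁ + m₂) * x)) - fun x => -m₁ * (x + m₂)) x =
        ∫ x in (0 : ℝ)..m₁, m₂ * (m₁ - x) := by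
      apply intervalIntegral.integral_congr
      intro x hx
      rw [uIcc_of_le (by linarith)] at hx
      simp only [Pi.sub_apply]
      rw [min_eq_right (by nlinarith [hx.1])]
      ring
    rw [h1, h2]
    simp only [intervalIntegral.integral_const_mul]
    rw [intervalIntegral.integral_add (by simp) (by simp),
      intervalIntegral.integral_sub (by simp) (by simp)]
    simp only [integral_id, intervalIntegral.integral_const, smul_eq_mul]
    ring
  · refine setIntegral_nonneg measurableSet_Ioc fun x hx => ?_
    exact sub_nonneg.2 (hle x hx)

/-- The area formula for maps from the complex plane to `ℝ × ℝ`. -/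
theorem integral_abs_det_fderiv {G : ℂ → ℝ × ℝ} {s : Set ℂ} (hs : MeasurableSet s)
    (hd : ∀ w ∈ s, DifferentiableAt ℝ G w) (hi : InjOn G s) :
    ∫ w in s, |(fderiv ℝ G w 1).1 * (fderiv ℝ G w Complex.I).2
      - (fderiv ℝ G w 1).2 * (fderiv ℝ G w Complex.I).1| = volume.real (G '' s) := by
  set e := Complex.equivRealProdCLM with he
  have h1 := integral_image_eq_integral_abs_det_fderiv_smul volume hs (f := fun w => e.symm (G w))
    (f' := fun w => (e.symm : ℝ × ℝ →L[ℝ] ℂ) ∘L (fderiv ℝ G w))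
    (fun w hw => (e.symm.hasFDerivAt.comp w (hd w hw).hasFDerivAt).hasFDerivWithinAt)
    (fun a ha b hb h => hi ha hb (e.symm.injective h)) (fun _ => (1 : ℝ))
  have hdet : ∀ w, ((e.symm : ℝ × ℝ →L[ℝ] ℂ) ∘L (fderiv ℝ G w)).det =
      (fderiv ℝ G w 1).1 * (fderiv ℝ G w Complex.I).2
      - (fderiv ℝ G w 1).2 * (fderiv ℝ G w Complex.I).1 := by
    intro w
    rw [ContinuousLinearMap.det, ← LinearMap.det_toMatrix Complex.basisOneI, Matrix.det_fin_two]
    have hre : ∀ v, (e.symm v).re = v.1 := fun _ => rfl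
    have him : ∀ v, (e.symm v).im = v.2 := fun _ => rfl
    simp [LinearMap.toMatrix_apply, hre, him]
    ring
  simp only [hdet, smul_eq_mul, mul_one] at h1
  rw [← h1, setIntegral_const, smul_eq_mul, mul_one]
  have h2 : (fun w => e.symm (G w)) '' s = Complex.measurableEquivRealProd ⁻¹' (G '' s) := by
    ext z
    constructor
    · rintro ⟨w, hw, rfl⟩
      exact ⟨w, hw, rfl⟩
    · rintro ⟨w, hw, h⟩
      exact ⟨w, hw, by simp only [h]; rfl⟩
  rw [h2, Measure.real, Measure.real,
    Complex.volume_preserving_equiv_real_prod.measure_preimage_equiv]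

namespace ProductTriangle

variable {J : ℝ × ℝ →ₗ[ℝ] ℝ × ℝ} {m₁ m₂ : ℕ} {κ₁ κ₂ : ℝ} {y : Torus}

/-- The Jacobian of a `J`-holomorphic map is nonnegative by the orientation condition, so it equals
its absolute value and the area formula applies. The result is the square of the scale times the
area of the standard triangle. -/
theorem HasIndex.area_eq {S : ProductTriangle J m₁ m₂ κ₁ κ₂ y} {ℓ p q : ℤ}
    (hJ : IsComplexStructure J) (hm₁ : 0 < m₁) (hm₂ : 0 < m₂) (h : HasIndex S ℓ p q) :
    S.area = (ℓ + κ₂ - κ₁) ^ 2 / (2 * (1 / (m₁ : ℝ) + 1 / (m₂ : ℝ))) := by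
  have m1 : (0 : ℝ) < m₁ := by exact_mod_cast hm₁
  have m2 : (0 : ℝ) < m₂ := by exact_mod_cast hm₂
  obtain ⟨_, _, _, G, _, _, _, -, -, -, hG, hF⟩ := h.eqOn hJ hm₁ hm₂
  set c := scale m₁ m₂ κ₁ κ₂ ℓ with hc
  have hfd : ∀ w ∈ Metric.ball (0 : ℂ) 1, fderiv ℝ S.F w = c • fderiv ℝ G w := by
    intro w hw
    have : S.F =ᶠ[𝓝 w] fun w => (E m₁ m₂ κ₁ (κ₂ + ℓ) + p, (q : ℝ)) + c • G w := by
      filter_upwards [Metric.isOpen_ball.mem_nhds hw] with v hv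
      exact hF v (Metric.ball_subset_closedBall hv)
    rw [this.fderiv_eq, fderiv_const_add, fderiv_fun_const_smul (hG.hol w hw).1]
  have hint : S.area = ∫ w in Metric.ball (0 : ℂ) 1, c ^ 2 * |(fderiv ℝ G w 1).1 *
      (fderiv ℝ G w Complex.I).2 - (fderiv ℝ G w 1).2 * (fderiv ℝ G w Complex.I).1| := by
    refine setIntegral_congr_fun Metric.isOpen_ball.measurableSet fun w hw => ?_
    have h1 := (hG.hol w hw).2 1
    rw [mul_one] at h1
    simp only [hfd w hw, smul_apply, Prod.smul_fst, Prod.smul_snd, smul_eq_mul]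
    rw [abs_of_nonneg]
    · ring
    · rw [h1]
      by_cases h0 : fderiv ℝ G w 1 = 0
      · simp [h0]
      · exact (hJ.2 _ h0).le
  rw [hint, integral_const_mul, integral_abs_det_fderiv Metric.isOpen_ball.measurableSet
    (fun w hw => (hG.hol w hw).1) hG.bijOn.injOn, hG.bijOn.image_eq,
    volume_standardTriangle m1 m2, hc, scale]
  field_simp
  ring

end ProductTriangle

/-! ### The number of stars on the boundary -/

theorem finite_intTranslates (ε a b : ℝ) : (uIcc a b ∩ {t | ∃ i : ℤ, t = ε + i}).Finite := by
  refine ((finite_Icc ⌈min a b - ε⌉ ⌊max a b - ε⌋).image fun i : ℤ => ε + (i : ℝ)).subset ?_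
  rintro _ ⟨⟨h1, h2⟩, i, rfl⟩
  exact ⟨i, ⟨Int.ceil_le.2 (by linarith), Int.le_floor.2 (by linarith)⟩, rfl⟩

/-- On one arc the first coordinate is strictly monotone, so it maps the arc bijectively to the
interval between its end values. -/
theorem ncard_preimage_of_affine {x Q : ℝ → ℝ} {α β c s : ℝ} (hαβ : α ≤ β) (hs : s ≠ 0)
    (hm : StrictMonoOn Q (Icc α β)) (hc : ContinuousOn Q (Icc α β))
    (hx : ∀ θ ∈ Icc α β, x θ = c + s * Q θ) (T : Set ℝ) :
    {θ ∈ Icc α β | x θ ∈ T}.ncard = (uIcc (x α) (x β) ∩ T).ncard := by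
  have hα := left_mem_Icc.2 hαβ
  have hβ := right_mem_Icc.2 hαβ
  have himg : x '' Icc α β = uIcc (x α) (x β) := by
    have hQ : Q '' Icc α β = uIcc (Q α) (Q β) := by
      rw [uIcc_of_le (hm.monotoneOn hα hβ hαβ)]
      refine Subset.antisymm ?_ (intermediate_value_Icc hαβ hc)
      rintro _ ⟨θ, hθ, rfl⟩
      exact ⟨hm.monotoneOn hα hθ hθ.1, hm.monotoneOn hθ hβ hθ.2⟩
    rw [show x '' Icc α β = (fun t => c + t) '' ((fun t => s * t) '' (Q '' Icc α β)) by
      rw [image_image, image_image]; exact image_congr hx, hQ, image_const_mul_uIcc,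
      image_const_add_uIcc, hx α hα, hx β hβ]
  have hinj : InjOn x (Icc α β) := fun a ha b hb h => by
    rw [hx a ha, hx b hb] at h
    exact hm.injOn ha hb (mul_left_cancel₀ hs (add_left_cancel h))
  have : uIcc (x α) (x β) ∩ T = x '' {θ ∈ Icc α β | x θ ∈ T} := by
    rw [← himg]
    ext t
    constructor
    · rintro ⟨⟨θ, hθ, rfl⟩, ht⟩
      exact ⟨θ, ⟨hθ, ht⟩, rfl⟩
    · rintro ⟨θ, ⟨hθ, ht⟩, rfl⟩
      exact ⟨⟨θ, hθ, rfl⟩, ht⟩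
  rw [this, InjOn.ncard_image]
  exact hinj.mono fun θ hθ => hθ.1

theorem finite_preimage_of_affine {x Q : ℝ → ℝ} {α β c s ε : ℝ} (hαβ : α ≤ β) (hs : s ≠ 0)
    (hm : StrictMonoOn Q (Icc α β))
    (hx : ∀ θ ∈ Icc α β, x θ = c + s * Q θ) :
    {θ ∈ Icc α β | x θ ∈ {t | ∃ i : ℤ, t = ε + i}}.Finite := by
  have hinj : InjOn x (Icc α β) := fun a ha b hb h => by
    rw [hx a ha, hx b hb] at h
    exact hm.injOn ha hb (mul_left_cancel₀ hs (add_left_cancel h))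
  have hα := left_mem_Icc.2 hαβ
  have hβ := right_mem_Icc.2 hαβ
  refine Finite.of_finite_image ((finite_intTranslates ε (x α) (x β)).subset ?_)
    (hinj.mono fun θ hθ => hθ.1)
  rintro _ ⟨θ, ⟨hθ, ht⟩, rfl⟩
  refine ⟨?_, ht⟩
  have h1 := hm.monotoneOn hα hθ hθ.1
  have h2 := hm.monotoneOn hθ hβ hθ.2
  rw [hx α hα, hx β hβ, hx θ hθ, mem_uIcc]
  rcases le_total 0 s with h | h
  · left; constructor <;> nlinarith
  · right; constructor <;> nlinarith

/-- A function on a circle that moves from `x₀` to `x₁`, `x₂` and back to `x₀`, where `x₀` is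
between `x₁` and `x₂`, takes each value an even number of times. -/
theorem even_ncard_union {A B D : Set ℝ} {T : Set ℝ} {x₀ x₁ x₂ : ℝ} (h : x₀ ∈ uIcc x₁ x₂)
    (hx₀ : x₀ ∉ T) (hT : ∀ a b, (uIcc a b ∩ T).Finite)
    (hA : A.ncard = (uIcc x₀ x₁ ∩ T).ncard) (hB : B.ncard = (uIcc x₁ x₂ ∩ T).ncard)
    (hD : D.ncard = (uIcc x₂ x₀ ∩ T).ncard) (fA : A.Finite) (fB : B.Finite) (fD : D.Finite)
    (hAB : Disjoint A B) (hAD : Disjoint A D) (hBD : Disjoint B D) :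
    Even (A ∪ B ∪ D).ncard := by
  -- The long side covers exactly what the two short sides cover together, so every count is
  -- doubled.
  have hU : uIcc x₁ x₂ ∩ T = (uIcc x₀ x₁ ∩ T) ∪ (uIcc x₂ x₀ ∩ T) := by
    ext t
    simp only [mem_inter_iff, mem_union, mem_uIcc] at h ⊢
    constructor
    · rintro ⟨ht, hT⟩
      rcases le_total t x₀ with a | a <;> rcases h with h | h <;> rcases ht with ht | ht <;>
        [left; left; right; right; right; right; left; left] <;> refine ⟨?_, hT⟩ <;>
        first
          | exact Or.inl ⟨by linarith, by linarith⟩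
          | exact Or.inr ⟨by linarith, by linarith⟩
    · rintro (⟨ht, hT⟩ | ⟨ht, hT⟩) <;> refine ⟨?_, hT⟩ <;> rcases h with h | h <;>
        rcases ht with ht | ht <;>
        first
          | exact Or.inl ⟨by linarith, by linarith⟩
          | exact Or.inr ⟨by linarith, by linarith⟩
  have hdisj : Disjoint (uIcc x₀ x₁ ∩ T) (uIcc x₂ x₀ ∩ T) := by
    rw [Set.disjoint_left]
    rintro t ⟨h1, hT⟩ ⟨h2, -⟩
    have : t = x₀ := by
      rw [mem_uIcc] at h h1 h2
      rcases h with h | h <;> rcases h1 with h1 | h1 <;> rcases h2 with h2 | h2 <;>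
        apply le_antisymm <;> linarith
    exact hx₀ (this ▸ hT)
  rw [ncard_union_eq (disjoint_union_left.2 ⟨hAD, hBD⟩) (fA.union fB) fD, ncard_union_eq hAB fA fB,
    hB, hU, ncard_union_eq hdisj (hT _ _) (hT _ _), ← hA, ← hD]
  exact ⟨A.ncard + D.ncard, by ring⟩

theorem proj_eq_star_iff {ε : ℝ} {m : ℤ} {v : ℝ × ℝ} :
    proj v = star ε m ↔ (∃ i : ℤ, v.1 = ε + i) ∧ ∃ j : ℤ, v.2 = -m * ε + j := by
  rw [star, proj_eq_proj_iff]
  constructor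
  · rintro ⟨i, j, h1, h2⟩; exact ⟨⟨i, h1⟩, j, h2⟩
  · rintro ⟨⟨i, h1⟩, j, h2⟩; exact ⟨i, j, h1, h2⟩

/-- On the circle `L_m` the star of `L_m` is determined by its first coordinate, and the stars of
the other circles do not lie on `L_m`. -/
theorem proj_eq_star_iff_of_mem_lag {ε : ℝ} (hε : Irrational ε) {m m' : ℤ} {v : ℝ × ℝ}
    (hv : proj v ∈ lag m) : proj v = star ε m' ↔ (∃ i : ℤ, v.1 = ε + i) ∧ m = m' := by
  obtain ⟨n, hn⟩ := proj_mem_lag_iff.1 hv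
  rw [proj_eq_star_iff]
  refine and_congr_right ?_
  rintro ⟨i, hi⟩
  constructor
  · rintro ⟨j, hj⟩
    by_contra hne
    have h1 : ((m - m' : ℤ) : ℝ) * ε = ((n - j - m * i : ℤ) : ℝ) := by
      push_cast; rw [hi, hj] at hn; linarith
    exact (hε.intCast_mul (sub_ne_zero.2 hne)).ne_int _ h1
  · rintro rfl
    exact ⟨n - m * i, by push_cast; rw [hi] at hn; linarith⟩

theorem notMem_intTranslates_of_irrational {ε x : ℝ} (hε : Irrational ε)
    {m k : ℤ} (hm : m ≠ 0) (hx : m * x = k) :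
    x ∉ {t | ∃ i : ℤ, t = ε + i} := by
  rintro ⟨i, rfl⟩
  exact (hε.intCast_mul hm).ne_int (k - m * i) (by push_cast; rw [← hx]; ring)

namespace ProductTriangle

variable {J : ℝ × ℝ →ₗ[ℝ] ℝ × ℝ} {m₁ m₂ : ℕ} {κ₁ κ₂ : ℝ} {y : Torus}

/-- Because `ε` is irrational, a boundary point meets a star exactly when its first coordinate lies
in `ε + ℤ`, and the vertices, which have rational first coordinates, never do. The claim reduces to
a loop on the line that turns only at `κ₁` and `κ₂ + ℓ`, with `E_ℓ` between them. -/
theorem HasIndex.even_starCount {S : ProductTriangle J m₁ m₂ κ₁ κ₂ y} {ℓ p q : ℤ}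
    (hJ : IsComplexStructure J) (hm₁ : 0 < m₁) (hm₂ : 0 < m₂) (h : HasIndex S ℓ p q) {k₁ k₂ : ℤ}
    (hκ₁ : m₁ * κ₁ = k₁) (hκ₂ : m₂ * κ₂ = k₂) {ε : ℝ} (hε : Irrational ε) :
    Even (S.starCount ε) := by
  have m1 : (0 : ℝ) < m₁ := by exact_mod_cast hm₁
  have m2 : (0 : ℝ) < m₂ := by exact_mod_cast hm₂
  obtain ⟨θ₀, θ₁, θ₂, G, Q₀, Q₁, Q₂, h01, h12, h20, hG, hF⟩ := h.eqOn hJ hm₁ hm₂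
  set c := scale m₁ m₂ κ₁ κ₂ ℓ with hc
  have hc' : (m₁ + m₂) * c = κ₂ + ℓ - κ₁ := by rw [hc, scale]; field_simp
  set e := E m₁ m₂ κ₁ (κ₂ + ℓ) with he
  have he' : (m₁ + m₂) * e = m₁ * κ₁ + m₂ * (κ₂ + ℓ) := by rw [he, E]; field_simp
  set T : Set ℝ := {t | ∃ i : ℤ, t = ε + i} with hT
  set x : ℝ → ℝ := fun θ => (S.F (Complex.exp (θ * Complex.I))).1 with hx
  have hxG : ∀ θ : ℝ, x θ = e + p + c * (G (Complex.exp (θ * Complex.I))).1 := fun θ => by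
    simp only [hx]
    rw [hF _ (by rw [mem_closedBall_zero_iff, norm_exp_mul_I])]
    simp
  have hx0 : ∀ θ ∈ Icc θ₀ θ₁, x θ = (e + p) + (-c) * Q₀ θ := fun θ hθ => by
    rw [hxG, hG.arc₀ θ hθ]; ring
  have hx1 : ∀ θ ∈ Icc θ₁ θ₂, x θ = (e + p - c * m₂) + c * Q₁ θ := fun θ hθ => by
    rw [hxG, hG.arc₁ θ hθ]; ring
  have hx2 : ∀ θ ∈ Icc θ₂ (θ₀ + 2 * Real.pi), x θ = (e + p + c * m₁) + (-c) * Q₂ θ := fun θ hθ => by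
    rw [hxG, hG.arc₂ θ hθ]; ring
  have v0 : x θ₀ = e + p := by rw [hx0 _ (left_mem_Icc.2 h01.le), hG.start₀]; ring
  have v1 : x θ₁ = κ₁ + p := by
    rw [hx1 _ (left_mem_Icc.2 h12.le), hG.start₁]
    apply mul_left_cancel₀ (add_pos m1 m2).ne'
    linear_combination he' - m₂ * hc'
  have v2 : x θ₂ = κ₂ + ℓ + p := by
    rw [hx2 _ (left_mem_Icc.2 h20.le), hG.start₂]
    apply mul_left_cancel₀ (add_pos m1 m2).ne'
    linear_combination he' + m₁ * hc'
  have v3 : x (θ₀ + 2 * Real.pi) = e + p := by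
    rw [hx2 _ (right_mem_Icc.2 h20.le), hG.end₂]; ring
  have n0 : e + p ∉ T := notMem_intTranslates_of_irrational hε (m := m₁ + m₂)
    (k := k₁ + k₂ + m₂ * ℓ + (m₁ + m₂) * p) (by positivity)
    (by push_cast; rw [← hκ₁, ← hκ₂]; linear_combination he')
  have n1 : κ₁ + p ∉ T := notMem_intTranslates_of_irrational hε (m := m₁)
    (k := k₁ + m₁ * p) (by positivity) (by push_cast; rw [← hκ₁]; ring)
  have n2 : κ₂ + ℓ + p ∉ T := notMem_intTranslates_of_irrational hε (m := m₂)
    (k := k₂ + m₂ * ℓ + m₂ * p) (by positivity) (by push_cast; rw [← hκ₂]; ring)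
  set A := {θ ∈ Icc θ₀ θ₁ | x θ ∈ T} with hA
  set B := {θ ∈ Icc θ₁ θ₂ | x θ ∈ T} with hB
  set D := {θ ∈ Icc θ₂ (θ₀ + 2 * Real.pi) | x θ ∈ T} with hD
  have hZ : {w ∈ Metric.sphere (0 : ℂ) 1 | proj (S.F w) = star ε ((0 : ℕ) : ℤ) ∨
      proj (S.F w) = star ε (m₁ : ℤ) ∨ proj (S.F w) = star ε ((m₁ + m₂ : ℕ) : ℤ)} =
      (fun θ : ℝ => Complex.exp (θ * Complex.I)) '' (A ∪ B ∪ D) := by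
    have h1 : ∀ w ∈ Metric.sphere (0 : ℂ) 1, (proj (S.F w) = star ε ((0 : ℕ) : ℤ) ∨
        proj (S.F w) = star ε (m₁ : ℤ) ∨ proj (S.F w) = star ε ((m₁ + m₂ : ℕ) : ℤ)) ↔
        (S.F w).1 ∈ T := by
      intro w hw
      rcases S.mem_lag_of_mem_sphere hw with h | h | h <;>
        simp only [proj_eq_star_iff_of_mem_lag hε h, hT, mem_ofPred_eq] <;> tauto
    ext w
    simp only [mem_ofPred_eq]
    constructor
    · rintro ⟨hw, hs⟩
      obtain ⟨θ, hθ, rfl⟩ := exists_exp_of_mem_sphere hw θ₀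
      have hxT : x θ ∈ T := (h1 _ hw).1 hs
      refine ⟨θ, ?_, rfl⟩
      rcases le_total θ θ₁ with a | a
      · exact Or.inl (Or.inl ⟨⟨hθ.1, a⟩, hxT⟩)
      · rcases le_total θ θ₂ with b | b
        · exact Or.inl (Or.inr ⟨⟨a, b⟩, hxT⟩)
        · exact Or.inr ⟨⟨b, hθ.2.le⟩, hxT⟩
    · rintro ⟨θ, hθ, rfl⟩
      have hw : Complex.exp (θ * Complex.I) ∈ Metric.sphere (0 : ℂ) 1 := by
        rw [mem_sphere_zero_iff_norm, norm_exp_mul_I]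
      have hxT : x θ ∈ T := by
        rcases hθ with (hθ | hθ) | hθ <;> exact hθ.2
      exact ⟨hw, (h1 _ hw).2 hxT⟩
  have hinj : InjOn (fun θ : ℝ => Complex.exp (θ * Complex.I)) (A ∪ B ∪ D) := by
    -- The angles `θ₀` and `θ₀ + 2π` give the same point; the latter is excluded because a vertex is
    -- not over a star.
    have hsub : ∀ θ ∈ A ∪ B ∪ D, θ₀ ≤ θ ∧ θ < θ₀ + 2 * Real.pi := by
      rintro θ ((hθ | hθ) | hθ)
      · exact ⟨hθ.1.1, by linarith [hθ.1.2]⟩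
      · exact ⟨by linarith [hθ.1.1], by linarith [hθ.1.2]⟩
      · refine ⟨by linarith [hθ.1.1], lt_of_le_of_ne hθ.1.2 ?_⟩
        rintro rfl
        exact n0 (v3 ▸ hθ.2)
    intro θ hθ θ' hθ' heq
    have a := hsub θ hθ
    have b := hsub θ' hθ'
    rcases lt_trichotomy θ θ' with hlt | rfl | hlt
    · exact absurd heq.symm (exp_mul_I_ne hlt (by linarith))
    · rfl
    · exact absurd heq (exp_mul_I_ne hlt (by linarith))
  have hstar : S.starCount ε = (A ∪ B ∪ D).ncard := by
    rw [← hinj.ncard_image, ← hZ]; rfl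
  rw [hstar]
  -- A constant triangle stays at a vertex and meets no star; monotonicity of the sides is only
  -- available for `c ≠ 0`.
  by_cases hc0 : c = 0
  · have : A ∪ B ∪ D = ∅ := by
      rw [eq_empty_iff_forall_notMem]
      intro θ hθ
      have hxT : x θ ∈ T := by
        rcases hθ with (hθ | hθ) | hθ <;> exact hθ.2
      rw [hxG, hc0] at hxT
      exact n0 (by simpa using hxT)
    rw [this, ncard_empty]
    exact Even.zero
  · refine even_ncard_union (x₀ := e + p) (x₁ := κ₁ + p) (x₂ := κ₂ + ℓ + p) ?_ n0
      (finite_intTranslates ε) ?_ ?_ ?_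
      (finite_preimage_of_affine h01.le (neg_ne_zero.2 hc0) hG.mono₀ hx0)
      (finite_preimage_of_affine h12.le hc0 hG.mono₁ hx1)
      (finite_preimage_of_affine h20.le (neg_ne_zero.2 hc0) hG.mono₂ hx2) ?_ ?_ ?_
    · have a1 : (m₁ + m₂) * (e - κ₁) = m₂ * (κ₂ + ℓ - κ₁) := by linear_combination he'
      have a2 : (m₁ + m₂) * (κ₂ + ℓ - e) = m₁ * (κ₂ + ℓ - κ₁) := by linear_combination -he'
      rw [mem_uIcc]
      rcases le_total 0 (κ₂ + ℓ - κ₁) with hle | hle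
      · left
        constructor
        · have := nonneg_of_mul_nonneg_right (a1 ▸ mul_nonneg m2.le hle) (add_pos m1 m2)
          linarith
        · have := nonneg_of_mul_nonneg_right (a2 ▸ mul_nonneg m1.le hle) (add_pos m1 m2)
          linarith
      · right
        constructor
        · by_contra hcon
          nlinarith [mul_pos (add_pos m1 m2) (show 0 < κ₂ + ℓ - e by linarith)]
        · by_contra hcon
          nlinarith [mul_pos (add_pos m1 m2) (show 0 < e - κ₁ by linarith)]
    · rw [← v0, ← v1]
      exact (ncard_preimage_of_affine h01.le (neg_ne_zero.2 hc0) hG.mono₀ hG.cont₀ hx0 T)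
    · rw [← v1, ← v2]
      exact (ncard_preimage_of_affine h12.le hc0 hG.mono₁ hG.cont₁ hx1 T)
    · rw [← v2, ← v3]
      exact (ncard_preimage_of_affine h20.le (neg_ne_zero.2 hc0) hG.mono₂ hG.cont₂ hx2 T)
    · rw [Set.disjoint_left]
      rintro θ hθ hθ'
      have : θ = θ₁ := le_antisymm hθ.1.2 hθ'.1.1
      exact n1 (by rw [← v1, ← this]; exact hθ.2)
    · rw [Set.disjoint_left]
      rintro θ hθ hθ'
      linarith [hθ.1.2, hθ'.1.1]
    · rw [Set.disjoint_left]
      rintro θ hθ hθ'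
      have : θ = θ₂ := le_antisymm hθ.1.2 hθ'.1.1
      exact n2 (by rw [← v2, ← this]; exact hθ.2)

end ProductTriangle

/-! ### The triangle product as a sum over the index -/

namespace ProductTriangle

variable {J : ℝ × ℝ →ₗ[ℝ] ℝ × ℝ} {m₁ m₂ : ℕ} {κ₁ κ₂ : ℝ} {y : Torus}

/-- The index of a triangle: the difference of the lifts of `x₂` and `x₁`, up to `κ₂ - κ₁`. -/
def index (S : ProductTriangle J m₁ m₂ κ₁ κ₂ y) : ℤ := S.exists_hasIndex.choose

theorem hasIndex_index (S : ProductTriangle J m₁ m₂ κ₁ κ₂ y) : ∃ p q, HasIndex S S.index p q :=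
  S.exists_hasIndex.choose_spec

theorem index_eq_of_equivalent (hm₁ : 0 < m₁) (hm₂ : 0 < m₂)
    {S S' : ProductTriangle J m₁ m₂ κ₁ κ₂ y} (h : S.Equivalent S') : S.index = S'.index := by
  obtain ⟨p, q, h1⟩ := S.hasIndex_index
  obtain ⟨p', q', h2⟩ := S'.hasIndex_index
  exact h1.index_eq hm₁ hm₂ h2 h

theorem equivalent_refl (S : ProductTriangle J m₁ m₂ κ₁ κ₂ y) : S.Equivalent S :=
  ⟨id, ⟨0, 1, by simp, by simp, fun w => by simp⟩, rfl, rfl, rfl, fun _ _ => rfl⟩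

theorem HasIndex.eq_index (hm₁ : 0 < m₁) (hm₂ : 0 < m₂) {S : ProductTriangle J m₁ m₂ κ₁ κ₂ y}
    {ℓ p q : ℤ} (h : HasIndex S ℓ p q) : ℓ = S.index := by
  obtain ⟨p', q', h'⟩ := S.hasIndex_index
  exact h.index_eq hm₁ hm₂ h' S.equivalent_refl

/-- The index descends to the moduli space, so it does not matter which representative `Quot.out`
selects. -/
theorem index_out (hm₁ : 0 < m₁) (hm₂ : 0 < m₂) (S : ProductTriangle J m₁ m₂ κ₁ κ₂ y) :
    index (Quot.mk HoloTriangle.Equivalent S).out = S.index :=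
  congrArg (Quot.lift index fun _ _ h => index_eq_of_equivalent hm₁ hm₂ h)
    (Quot.out_eq (Quot.mk HoloTriangle.Equivalent S))

/-- The triangles that contribute to the product are classified by their index. -/
theorem bijective_index (hJ : IsComplexStructure J) (hm₁ : 0 < m₁) (hm₂ : 0 < m₂) {k₁ k₂ : ℤ}
    (hκ₁ : m₁ * κ₁ = k₁) (hκ₂ : m₂ * κ₂ = k₂) : Function.Bijective
      (fun u : RigidTriangle J ((0 : ℕ) : ℤ) (m₁ : ℤ) ((m₁ + m₂ : ℕ) : ℤ) y
        (dehnTwist^[0] (xPoint κ₁)) (dehnTwist^[m₁] (xPoint κ₂)) =>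
        (⟨index u.1.out, by
          obtain ⟨p, q, h⟩ := hasIndex_index u.1.out
          exact h.vertex_eq hm₁ hm₂⟩ : {ℓ : ℤ // xPoint (E m₁ m₂ κ₁ (κ₂ + ℓ)) = y})) := by
  constructor
  · intro u u' h
    simp only [Subtype.mk.injEq] at h
    obtain ⟨p, q, h1⟩ := hasIndex_index u.1.out
    obtain ⟨p', q', h2⟩ := hasIndex_index u'.1.out
    rw [h] at h1
    have := Quot.sound (h1.equivalent hJ hm₁ hm₂ h2)
    exact Subtype.ext ((Quot.out_eq u.1).symm.trans (this.trans (Quot.out_eq u'.1)))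
  · rintro ⟨ℓ, hℓ⟩
    obtain ⟨S, hS⟩ := exists_of_index hJ hm₁ hm₂ ⟨k₁, hκ₁⟩ ⟨k₂, hκ₂⟩ ℓ hℓ
    have hidx : triangleIndex ((0 : ℕ) : ℤ) (m₁ : ℤ) ((m₁ + m₂ : ℕ) : ℤ) = 0 := by
      simp only [triangleIndex, maslov]
      rw [if_pos (by push_cast; omega), if_pos (by push_cast; omega), if_pos (by push_cast; omega)]
      rfl
    refine ⟨⟨Quot.mk _ S, hidx⟩, Subtype.ext ?_⟩
    exact (index_out hm₁ hm₂ S).trans (hS.eq_index hm₁ hm₂).symm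

end ProductTriangle

/-! ### Fibres, holonomy and the contribution of a single triangle -/

section Algebra

variable {R : Type*} [CommRing R] {σ : RingAut R}

theorem eq_of_coe_eq {a b : ℝ} (ha : a ∈ Ico (0 : ℝ) 1) (hb : b ∈ Ico (0 : ℝ) 1)
    (h : (a : UnitAddCircle) = b) : a = b := by
  obtain ⟨n, hn⟩ := coe_eq_coe_iff.1 h
  have h1 : (n : ℝ) < 1 := by linarith [ha.2, hb.1]
  have h2 : (-1 : ℝ) < n := by linarith [ha.1, hb.2]
  have h3 : n < 1 := by exact_mod_cast h1
  have h4 : -1 < n := by exact_mod_cast h2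
  have h5 : n = 0 := by omega
  simpa [h5] using hn

/-- `Fiber.mk` as a homomorphism of additive groups. -/
def Fiber.mkHom (σ : RingAut R) {θ : UnitAddCircle} (s : Lifts θ) : R →+ Fiber σ θ where
  toFun := Fiber.mk σ s
  map_zero' := Subtype.ext (funext fun _ => map_zero _)
  map_add' a b := Subtype.ext (funext fun _ => map_add _ a b)

theorem Fiber.continuous_mkHom [TopologicalSpace R] (hσ : ∀ k : ℤ, Continuous (σ ^ k : RingAut R))
    {θ : UnitAddCircle} (s : Lifts θ) : Continuous (Fiber.mkHom σ s) :=
  Continuous.subtype_mk (continuous_pi fun _ => hσ _) _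

theorem gen_of_eq {n n' : ℕ} {κ : ℝ} (a : R) (p : ↥(lag (n : ℤ) ∩ lag (n' : ℤ)))
    (h : p.1 = dehnTwist^[n] (xPoint κ)) (s : Lifts p.1.1) (hs : s.1 = Int.fract κ) :
    gen σ n n' κ a p = Fiber.mk σ s a := by
  obtain ⟨p, hp⟩ := p
  obtain ⟨s, hs'⟩ := s
  simp only at h hs
  subst h hs
  simp [gen, CF.single]

theorem gen_of_ne {n n' : ℕ} {κ : ℝ} (a : R) (p : ↥(lag (n : ℤ) ∩ lag (n' : ℤ)))
    (h : p.1 ≠ dehnTwist^[n] (xPoint κ)) : gen σ n n' κ a p = 0 := by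
  simp [gen, CF.single, h]

theorem transport_zero {θ θ' : UnitAddCircle} (s : Lifts θ) (t : Lifts θ') :
    transport σ s t 0 = 0 := rfl

theorem contribution_zero_left {J : ℝ × ℝ →ₗ[ℝ] ℝ × ℝ} {ε : ℝ} {n₀ n₁ n₂ : ℤ}
    (wt : Weight σ J n₀ n₁ n₂) {y x₁ x₂ : Torus} (a : Fiber σ x₁.1)
    (u : RigidTriangle J n₀ n₁ n₂ y x₁ x₂) : contribution σ J ε wt 0 a u = 0 := by
  simp [contribution, HoloTriangle.holonomy, transport_zero]

theorem contribution_zero_right {J : ℝ × ℝ →ₗ[ℝ] ℝ × ℝ} {ε : ℝ} {n₀ n₁ n₂ : ℤ}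
    (wt : Weight σ J n₀ n₁ n₂) {y x₁ x₂ : Torus} (b : Fiber σ x₂.1)
    (u : RigidTriangle J n₀ n₁ n₂ y x₁ x₂) : contribution σ J ε wt b 0 u = 0 := by
  simp [contribution, HoloTriangle.holonomy, transport_zero]

/-- The coefficient of the product at index `ℓ`. -/
def productTerm (σ : RingAut R) (tp : ℤ → R) (m₁ m₂ : ℕ) (κ₁ κ₂ : ℝ) (a b : R) (ℓ : ℤ) : R :=
  tp ℓ * (σ ^ (ℓ - ⌊E m₁ m₂ κ₁ (κ₂ + ℓ)⌋)) b * (σ ^ (-⌊E m₁ m₂ κ₁ (κ₂ + ℓ)⌋)) a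

variable {J : ℝ × ℝ →ₗ[ℝ] ℝ × ℝ} {m₁ m₂ : ℕ} {κ₁ κ₂ : ℝ}

theorem zpow_fixed {r : R} (hr : σ r = r) (k : ℤ) : (σ ^ k) r = r := by
  have h : σ ∈ MulAction.stabilizer (RingAut R) r := hr
  exact Subgroup.zpow_mem _ h k

/-- The sign is trivial by `even_starCount`. The holonomy is evaluated at an arbitrary lift `s₀ + k`
of the vertex `y`; the common power `σ ^ k` is what `Fiber.mk` at `s₀` prescribes. -/
theorem contribution_eq (hJ : IsComplexStructure J) (hm₁ : 0 < m₁) (hm₂ : 0 < m₂) {k₁ k₂ : ℤ}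
    (hκ₁ : m₁ * κ₁ = k₁) (hκ₂ : m₂ * κ₂ = k₂) (hκ₁' : κ₁ ∈ Ico (0 : ℝ) 1)
    (hκ₂' : κ₂ ∈ Ico (0 : ℝ) 1) {ε : ℝ} (hε : Irrational ε)
    (wt : Weight σ J ((0 : ℕ) : ℤ) (m₁ : ℤ) ((m₁ + m₂ : ℕ) : ℤ)) {y : Torus} {tp : ℤ → R}
    (hwt : ∀ (S : ProductTriangle J m₁ m₂ κ₁ κ₂ y) (ℓ p q : ℤ), S.HasIndex ℓ p q →
      (wt _ _ _ S).1 = tp ℓ)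
    (u : RigidTriangle J ((0 : ℕ) : ℤ) (m₁ : ℤ) ((m₁ + m₂ : ℕ) : ℤ) y
        (dehnTwist^[0] (xPoint κ₁)) (dehnTwist^[m₁] (xPoint κ₂)))
    {a b : R} (s₀ : Lifts y.1) (hs₀ : s₀.1 ∈ Ico (0 : ℝ) 1)
    (s₁ : Lifts (dehnTwist^[0] (xPoint κ₁)).1) (hs₁ : s₁.1 = Int.fract κ₁)
    (s₂ : Lifts (dehnTwist^[m₁] (xPoint κ₂)).1) (hs₂ : s₂.1 = Int.fract κ₂) :
    contribution σ J ε wt (Fiber.mk σ s₂ b) (Fiber.mk σ s₁ a) u =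
      Fiber.mk σ s₀ (productTerm σ tp m₁ m₂ κ₁ κ₂ a b (ProductTriangle.index u.1.out)) := by
  obtain ⟨p, q, h⟩ := ProductTriangle.hasIndex_index u.1.out
  obtain ⟨v0, v1, v2⟩ := h.vertices hm₁ hm₂
  set S : ProductTriangle J m₁ m₂ κ₁ κ₂ y := u.1.out with hS
  set ℓ := ProductTriangle.index S with hℓ
  set e := E m₁ m₂ κ₁ (κ₂ + ℓ) with he
  have hfe : s₀.1 = Int.fract e := by
    refine eq_of_coe_eq hs₀ ⟨Int.fract_nonneg _, Int.fract_lt_one _⟩ ?_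
    rw [s₀.2, fract_coe, ← h.vertex_eq hm₁ hm₂]
    rfl
  have hc : contribution σ J ε wt (Fiber.mk σ s₂ b) (Fiber.mk σ s₁ a) u =
      (-1) ^ S.starCount ε * (Fiber.const σ y.1 (wt _ _ _ S) *
        S.holonomy σ (Fiber.mk σ s₂ b) (Fiber.mk σ s₁ a)) := rfl
  rw [hc, (h.even_starCount hJ hm₁ hm₂ hκ₁ hκ₂ hε).neg_one_pow, one_mul]
  apply Subtype.ext
  funext r
  obtain ⟨r, hr⟩ := r
  obtain ⟨k, hk⟩ : ∃ k : ℤ, r = s₀.1 + k := coe_eq_coe_iff.1 (hr.trans s₀.2.symm)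
  have e0 : ⌊r - s₀.1⌋ = k := by rw [hk]; simp
  -- Transport moves the lift by `κ₂ + ℓ - e`, and `s₀` is the fractional part of `e`. The number is
  -- already an integer, so the floor only reads it off.
  have e1 : ⌊r - ((S.F S.z₀).1 - (S.F S.z₂).1) - s₂.1⌋ = k + (ℓ - ⌊e⌋) := by
    rw [Int.floor_eq_iff, v0, v2, hs₂, Int.fract_eq_self.2 hκ₂', hk, hfe, Int.fract]
    push_cast
    constructor <;> linarith
  have e2 : ⌊r - ((S.F S.z₀).1 - (S.F S.z₂).1) - ((S.F S.z₂).1 - (S.F S.z₁).1) - s₁.1⌋ =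
      k + -⌊e⌋ := by
    rw [Int.floor_eq_iff, v0, v1, hs₁, Int.fract_eq_self.2 hκ₁', hk, hfe, Int.fract]
    push_cast
    constructor <;> linarith
  change (wt _ _ _ S).1 * ((σ ^ ⌊r - ((S.F S.z₀).1 - (S.F S.z₂).1) - s₂.1⌋) b *
    ((σ ^ ⌊r - ((S.F S.z₀).1 - (S.F S.z₂).1) - ((S.F S.z₂).1 - (S.F S.z₁).1) - s₁.1⌋) a * 1)) =
    (σ ^ ⌊r - s₀.1⌋) (productTerm σ tp m₁ m₂ κ₁ κ₂ a b ℓ)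
  have hfix := zpow_fixed (wt _ _ _ S).2 k
  rw [e0, e1, e2, productTerm, map_mul, map_mul, ← hwt S ℓ p q h, hfix, zpow_add, zpow_add,
    mul_one, ← mul_assoc]
  rfl

/-- At a fixed vertex `y` only the indices with `E_ℓ` over `y` contribute, and `bijective_index`
reindexes the triangles by them. Summability is required of every restriction `I.indicator` because
each `y` selects its own subfamily. -/
theorem hasSum_mu2 [TopologicalSpace R] [T2Space R] (hσ : ∀ k : ℤ, Continuous (σ ^ k : RingAut R))
    (hJ : IsComplexStructure J) (hm₁ : 0 < m₁) (hm₂ : 0 < m₂) {k₁ k₂ : ℤ}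
    (hκ₁ : m₁ * κ₁ = k₁) (hκ₂ : m₂ * κ₂ = k₂) (hκ₁' : κ₁ ∈ Ico (0 : ℝ) 1)
    (hκ₂' : κ₂ ∈ Ico (0 : ℝ) 1) {ε : ℝ} (hε : Irrational ε)
    (wt : Weight σ J ((0 : ℕ) : ℤ) (m₁ : ℤ) ((m₁ + m₂ : ℕ) : ℤ)) {tp : ℤ → R}
    (hwt : ∀ (y : Torus) (S : ProductTriangle J m₁ m₂ κ₁ κ₂ y) (ℓ p q : ℤ), S.HasIndex ℓ p q →
      (wt _ _ _ S).1 = tp ℓ) (a b : R)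
    (hsum : ∀ I : Set ℤ, Summable (I.indicator (productTerm σ tp m₁ m₂ κ₁ κ₂ a b))) :
    Mu2Converges σ J ε wt (gen σ m₁ (m₁ + m₂) κ₂ b) (gen σ 0 m₁ κ₁ a) ∧
    HasSum (fun ℓ : ℤ => gen σ 0 (m₁ + m₂) (E m₁ m₂ κ₁ (κ₂ + ℓ))
      (productTerm σ tp m₁ m₂ κ₁ κ₂ a b ℓ))
      (mu2 σ J ε wt (gen σ m₁ (m₁ + m₂) κ₂ b) (gen σ 0 m₁ κ₁ a)) := by
  have hmem₁ : dehnTwist^[0] (xPoint κ₁) ∈ lag ((0 : ℕ) : ℤ) ∩ lag (m₁ : ℤ) := by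
    rw [dehnTwist_iterate_xPoint]
    exact ⟨proj_mem_lag_iff.2 ⟨0, by simp⟩, proj_mem_lag_iff.2 ⟨k₁, by simp [hκ₁]⟩⟩
  have hmem₂ : dehnTwist^[m₁] (xPoint κ₂) ∈ lag (m₁ : ℤ) ∩ lag ((m₁ + m₂ : ℕ) : ℤ) := by
    rw [dehnTwist_iterate_xPoint]
    exact ⟨proj_mem_lag_iff.2 ⟨0, by simp⟩,
      proj_mem_lag_iff.2 ⟨k₂, by push_cast; rw [← hκ₂]; ring⟩⟩
  have hlift₁ : ((Int.fract κ₁ : ℝ) : UnitAddCircle) = (dehnTwist^[0] (xPoint κ₁)).1 := by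
    rw [dehnTwist_iterate_fst, fract_coe]; rfl
  have hlift₂ : ((Int.fract κ₂ : ℝ) : UnitAddCircle) = (dehnTwist^[m₁] (xPoint κ₂)).1 := by
    rw [dehnTwist_iterate_fst, fract_coe]; rfl
  have g₁ := gen_of_eq (σ := σ) a ⟨_, hmem₁⟩ rfl ⟨_, hlift₁⟩ rfl
  have g₂ := gen_of_eq (σ := σ) b ⟨_, hmem₂⟩ rfl ⟨_, hlift₂⟩ rfl
  have key : ∀ y : ↥(lag ((0 : ℕ) : ℤ) ∩ lag ((m₁ + m₂ : ℕ) : ℤ)),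
      ∃ z, HasSum (fun ℓ : ℤ => gen σ 0 (m₁ + m₂) (E m₁ m₂ κ₁ (κ₂ + ℓ))
        (productTerm σ tp m₁ m₂ κ₁ κ₂ a b ℓ) y) z ∧
      HasSum (fun u : RigidTriangle J ((0 : ℕ) : ℤ) (m₁ : ℤ) ((m₁ + m₂ : ℕ) : ℤ) y.1
        (dehnTwist^[0] (xPoint κ₁)) (dehnTwist^[m₁] (xPoint κ₂)) =>
        contribution σ J ε wt (gen σ m₁ (m₁ + m₂) κ₂ b ⟨_, hmem₂⟩)
          (gen σ 0 m₁ κ₁ a ⟨_, hmem₁⟩) u) z := by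
    intro y
    obtain ⟨t, ht⟩ : ∃ t : ℝ, (t : UnitAddCircle) = y.1.1 := QuotientAddGroup.mk_surjective _
    set s₀ : Lifts y.1.1 := ⟨Int.fract t, (fract_coe t).trans ht⟩ with hs₀
    set I : Set ℤ := {ℓ | xPoint (E m₁ m₂ κ₁ (κ₂ + ℓ)) = y.1} with hI
    set c := productTerm σ tp m₁ m₂ κ₁ κ₂ a b with hc
    have hgen : (fun ℓ : ℤ => gen σ 0 (m₁ + m₂) (E m₁ m₂ κ₁ (κ₂ + ℓ)) (c ℓ) y) =
        fun ℓ => Fiber.mkHom σ s₀ (I.indicator c ℓ) := by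
      funext ℓ
      by_cases hℓ : ℓ ∈ I
      · rw [indicator_of_mem hℓ]
        have hℓ' : xPoint (E m₁ m₂ κ₁ (κ₂ + ℓ)) = y.1 := hℓ
        refine gen_of_eq _ _ hℓ'.symm s₀ ?_
        refine eq_of_coe_eq ⟨Int.fract_nonneg _, Int.fract_lt_one _⟩
          ⟨Int.fract_nonneg _, Int.fract_lt_one _⟩ ?_
        rw [fract_coe, fract_coe, ht]
        exact congrArg Prod.fst hℓ'.symm
      · rw [indicator_of_notMem hℓ, map_zero]
        exact gen_of_ne _ _ (fun h => hℓ (Eq.symm h))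
    have hS : Summable (fun ℓ : ℤ => gen σ 0 (m₁ + m₂) (E m₁ m₂ κ₁ (κ₂ + ℓ)) (c ℓ) y) := by
      rw [hgen]
      exact (hsum I).map (Fiber.mkHom σ s₀) (Fiber.continuous_mkHom hσ s₀)
    refine ⟨_, hS.hasSum, ?_⟩
    have hb := ProductTriangle.bijective_index (y := y.1) hJ hm₁ hm₂ hκ₁ hκ₂
    refine HasSum.congr_fun ((Function.Injective.hasSum_iff
      (Subtype.val_injective.comp hb.1) fun ℓ hℓ => ?_).2 hS.hasSum) fun u => ?_
    · have hn : ℓ ∉ I := fun h => by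
        obtain ⟨u, hu⟩ := hb.2 ⟨ℓ, h⟩
        exact hℓ ⟨u, congrArg Subtype.val hu⟩
      rw [congrFun hgen ℓ, indicator_of_notMem hn, map_zero]
    · have hu : ProductTriangle.index u.1.out ∈ I := by
        obtain ⟨p, q, h⟩ := ProductTriangle.hasIndex_index u.1.out
        exact h.vertex_eq hm₁ hm₂
      rw [g₁, g₂, contribution_eq hJ hm₁ hm₂ hκ₁ hκ₂ hκ₁' hκ₂' hε wt (hwt y.1) u s₀
        ⟨Int.fract_nonneg _, Int.fract_lt_one _⟩ _ rfl _ rfl]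
      refine Eq.trans ?_ (congrFun hgen (ProductTriangle.index u.1.out)).symm
      rw [indicator_of_mem hu]
      rfl
  constructor
  · intro y x₂ x₁
    by_cases h₂ : x₂ = ⟨_, hmem₂⟩
    · by_cases h₁ : x₁ = ⟨_, hmem₁⟩
      · subst h₁ h₂
        obtain ⟨z, -, hz⟩ := key y
        exact hz.summable
      · have : gen σ 0 m₁ κ₁ a x₁ = 0 := gen_of_ne _ _ fun h => h₁ (Subtype.ext h)
        simp only [this, contribution_zero_right]
        exact summable_zero
    · have : gen σ m₁ (m₁ + m₂) κ₂ b x₂ = 0 := gen_of_ne _ _ fun h => h₂ (Subtype.ext h)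
      simp only [this, contribution_zero_left]
      exact summable_zero
  · rw [Pi.hasSum]
    intro y
    obtain ⟨z, hz, hz'⟩ := key y
    have : mu2 σ J ε wt (gen σ m₁ (m₁ + m₂) κ₂ b) (gen σ 0 m₁ κ₁ a) y = z := by
      simp only [mu2]
      -- Each generator is supported at one intersection point, so the finite sums over `x₁` and
      -- `x₂` have a single nonzero term.
      rw [finsum_eq_single _ ⟨_, hmem₂⟩, finsum_eq_single _ ⟨_, hmem₁⟩]
      · exact hz'.tsum_eq
      · intro x₁ h₁
        have : gen σ 0 m₁ κ₁ a x₁ = 0 := gen_of_ne _ _ fun h => h₁ (Subtype.ext h)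
        simp only [this, contribution_zero_right, tsum_zero]
      · intro x₂ h₂
        have : gen σ m₁ (m₁ + m₂) κ₂ b x₂ = 0 := gen_of_ne _ _ fun h => h₂ (Subtype.ext h)
        simp only [this, contribution_zero_left, tsum_zero, finsum_zero]
    rw [this]
    exact hz

end Algebra

/-! ### The Novikov ring -/

section Novikov

variable {C : Type*} [CommRing C]

/-- A strictly decreasing sequence would give infinitely many points below its first term. This
supplies the Hahn series structure for sums built coefficientwise. -/
theorem isPWO_of_finite_inter_Iic {s : Set ℝ} (h : ∀ r, (s ∩ Iic r).Finite) : s.IsPWO := by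
  rw [isPWO_iff_isWF, isWF_iff_no_descending_seq]
  intro f hf hfs
  have := (infinite_range_of_injective hf.injective).mono
    (show range f ⊆ s ∩ Iic (f 0) by
      rintro _ ⟨n, rfl⟩
      exact ⟨hfs n, hf.antitone (Nat.zero_le n)⟩)
  exact this (h _)

theorem Novikov.continuous_truncation (r : ℝ) :
    @Continuous _ _ _ ⊥ (fun f : Novikov C => fun s : Iio r => f.1.coeff s.1) :=
  continuous_iInf_dom (i := r) continuous_induced_dom

theorem Novikov.tendsto_of_eventually {ι : Type*} {l : Filter ι} {f : ι → Novikov C}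
    {g : Novikov C} (h : ∀ r : ℝ, ∀ᶠ i in l, ∀ x < r, (f i).1.coeff x = g.1.coeff x) :
    Tendsto f l (𝓝 g) := by
  rw [nhds_iInf, tendsto_iInf]
  intro r
  rw [@nhds_induced, tendsto_comap_iff, @nhds_discrete _ ⊥ (@DiscreteTopology.mk _ ⊥ rfl), tendsto_pure]
  filter_upwards [h r] with i hi
  funext s
  exact hi s.1 s.2

theorem Novikov.isOpen_congr (f : Novikov C) (r : ℝ) :
    IsOpen {h : Novikov C | ∀ x < r, h.1.coeff x = f.1.coeff x} := by
  convert @IsOpen.preimage _ _ _ ⊥ _ (Novikov.continuous_truncation (C := C) r)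
    {fun s : Iio r => f.1.coeff s.1} trivial using 1
  ext h
  exact ⟨fun hh => funext fun s => hh s.1 s.2, fun hh x hx => congrFun hh ⟨x, hx⟩⟩

instance : T2Space (Novikov C) := by
  refine ⟨fun f g hfg => ?_⟩
  obtain ⟨x, hx⟩ : ∃ x, f.1.coeff x ≠ g.1.coeff x := by
    by_contra! hc
    exact hfg (Subtype.ext (HahnSeries.ext (funext hc)))
  refine ⟨_, _, Novikov.isOpen_congr f (x + 1), Novikov.isOpen_congr g (x + 1), fun _ _ => rfl,
    fun _ _ => rfl, Set.disjoint_left.2 fun h h1 h2 => hx ?_⟩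
  exact (h1 x (by linarith)).symm.trans (h2 x (by linarith))

/-- The action of the automorphisms of `C` on `Λ_C` as a homomorphism. -/
def novikovAutHom (C : Type*) [CommRing C] : RingAut C →* RingAut (Novikov C) where
  toFun := novikovAut
  map_one' := by
    ext f : 2
    rfl
  map_mul' σ τ := by
    ext f : 2
    rfl

theorem novikovAut_zpow_coeff (σ : RingAut C) (k : ℤ) (f : Novikov C) (x : ℝ) :
    ((novikovAut σ ^ k) f).1.coeff x = (σ ^ k) (f.1.coeff x) := by
  have : novikovAut σ ^ k = novikovAut (σ ^ k) := ((novikovAutHom C).map_zpow σ k).symm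
  rw [this]
  rfl

theorem continuous_novikovAut_zpow (σ : RingAut C) (k : ℤ) :
    Continuous (novikovAut σ ^ k : RingAut (Novikov C)) := by
  rw [continuous_iff_continuousAt]
  intro f
  refine Novikov.tendsto_of_eventually fun r => ?_
  filter_upwards [(Novikov.isOpen_congr f r).mem_nhds fun _ _ => rfl] with h hh x hx
  rw [novikovAut_zpow_coeff, novikovAut_zpow_coeff, hh x hx]

/-- Below any exponent only finitely many terms are visible, so the sum may be formed coefficient by
coefficient, and its support below that exponent lies in a finite union of finite sets. -/
theorem Novikov.summable_of_finite {ι : Type*} {f : ι → Novikov C}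
    (h : ∀ r : ℝ, {i | ∃ x < r, (f i).1.coeff x ≠ 0}.Finite) : Summable f := by
  have hx : ∀ r : ℝ, ∀ x < r, ∀ t : Finset ι, {i | ∃ x < r, (f i).1.coeff x ≠ 0} ⊆ t →
      ∑ i ∈ t, (f i).1.coeff x = ∑ᶠ i, (f i).1.coeff x := by
    intro r x hx t ht
    refine (finsum_eq_sum_of_support_subset _ fun i hi => ht ⟨x, hx, hi⟩).symm
  have hsup : ∀ r : ℝ, ({x | ∑ᶠ i, (f i).1.coeff x ≠ 0} ∩ Iic r).Finite := by
    intro r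
    have hr := h (r + 1)
    refine (hr.biUnion fun i _ => (f i).2 r).subset ?_
    rintro x ⟨h1, h2 : x ≤ r⟩
    obtain ⟨i, hi⟩ : ∃ i, (f i).1.coeff x ≠ 0 := by
      by_contra! hc
      exact h1 (by simp only [hc, finsum_zero])
    exact mem_biUnion (show i ∈ {i | ∃ x < r + 1, (f i).1.coeff x ≠ 0} from
      ⟨x, by linarith, hi⟩) ⟨hi, h2⟩
  set g : Novikov C := ⟨⟨fun x => ∑ᶠ i, (f i).1.coeff x, isPWO_of_finite_inter_Iic hsup⟩, hsup⟩
    with hg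
  refine ⟨g, Novikov.tendsto_of_eventually fun r => ?_⟩
  filter_upwards [eventually_ge_atTop (h r).toFinset] with t ht x hxr
  have h1 : (∑ i ∈ t, f i).1.coeff x = ∑ i ∈ t, (f i).1.coeff x := by
    rw [AddSubmonoidClass.coe_finsetSum, HahnSeries.coeff_sum]
  rw [h1]
  exact hx r x hxr t fun i hi => ht ((h r).mem_toFinset.2 hi)

theorem le_of_mem_support_hahnSeries_mul {f g : HahnSeries ℝ C} {s t x : ℝ}
    (hf : ∀ x ∈ f.support, s ≤ x) (hg : ∀ x ∈ g.support, t ≤ x) (hx : x ∈ (f * g).support) :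
    s + t ≤ x := by
  obtain ⟨u, hu, v, hv, rfl⟩ := Set.mem_add.1 (HahnSeries.support_mul_subset hx)
  exact add_le_add (hf u hu) (hg v hv)

/-- Powers of `σ` act on coefficients and do not enlarge supports. The term of index `ℓ` is
therefore supported above `w ℓ` plus constants depending only on `a` and `b`. -/
theorem summable_novikov_productTerm (σ : RingAut C) {w : ℤ → ℝ} (hw : ∀ r, {ℓ | w ℓ < r}.Finite)
    (m₁ m₂ : ℕ) (κ₁ κ₂ : ℝ) (a b : Novikov C) (I : Set ℤ) : Summable
      (I.indicator (productTerm (novikovAut σ) (fun ℓ => tPow C (w ℓ)) m₁ m₂ κ₁ κ₂ a b)) := by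
  obtain ⟨s, hs⟩ := exists_lowerBound a.1
  obtain ⟨t, ht⟩ := exists_lowerBound b.1
  have hs' : ∀ k : ℤ, ∀ x ∈ ((novikovAut σ ^ k) a).1.support, s ≤ x := fun k x hx =>
    hs x fun h0 => hx (by rw [novikovAut_zpow_coeff, h0, map_zero])
  have ht' : ∀ k : ℤ, ∀ x ∈ ((novikovAut σ ^ k) b).1.support, t ≤ x := fun k x hx =>
    ht x fun h0 => hx (by rw [novikovAut_zpow_coeff, h0, map_zero])
  refine Novikov.summable_of_finite fun r => (hw (r - t - s)).subset ?_
  rintro ℓ ⟨x, hxr, hx⟩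
  by_cases hℓ : ℓ ∈ I
  · rw [indicator_of_mem hℓ] at hx
    have hsingle : ∀ x ∈ (tPow C (w ℓ)).1.support, w ℓ ≤ x := fun x hx =>
      ge_of_eq (HahnSeries.support_single_subset hx)
    have := le_of_mem_support_hahnSeries_mul
      (fun x hx => le_of_mem_support_hahnSeries_mul hsingle (ht' _) hx) (hs' _) hx
    simp only [mem_ofPred_eq]
    linarith
  · rw [indicator_of_notMem hℓ] at hx
    exact absurd rfl hx

end Novikov

/-! ### Power series -/

section PowerSeries

variable {C : Type*} [CommRing C]

theorem tendsto_powerSeries_of_eventually {ι : Type*} {l : Filter ι} {f : ι → PowerSeries C}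
    {g : PowerSeries C}
    (h : ∀ n : ℕ, ∀ᶠ i in l, PowerSeries.coeff n (f i) = PowerSeries.coeff n g) :
    Tendsto f l (𝓝 g) := by
  let _ : TopologicalSpace C := ⊥
  refine (PowerSeries.WithPiTopology.tendsto_iff_coeff_tendsto C _ _ _).2 fun n => ?_
  exact tendsto_nhds_of_eventually_eq (h n)

theorem eventually_powerSeries_coeff_eq (f : PowerSeries C) (n : ℕ) :
    ∀ᶠ g in 𝓝 f, PowerSeries.coeff n g = PowerSeries.coeff n f := by
  let _ : TopologicalSpace C := ⊥
  have : DiscreteTopology C := ⟨rfl⟩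
  have := (PowerSeries.WithPiTopology.continuous_coeff C n).continuousAt (x := f)
  exact this.eventually (p := fun c => c = PowerSeries.coeff n f) (by rw [nhds_discrete]; exact rfl)

instance : T2Space (PowerSeries C) :=
  letI : TopologicalSpace C := ⊥
  haveI : DiscreteTopology C := ⟨rfl⟩
  PowerSeries.WithPiTopology.instT2Space C

/-- The action of the automorphisms of `C` on `C⟦t⟧` as a homomorphism. -/
def powerSeriesAutHom (C : Type*) [CommRing C] : RingAut C →* RingAut (PowerSeries C) where
  toFun := powerSeriesAut
  map_one' := by
    ext f : 2
    rfl
  map_mul' σ τ := by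
    ext f : 2
    rfl

theorem coeff_powerSeriesAut_zpow (σ : RingAut C) (k : ℤ) (f : PowerSeries C) (n : ℕ) :
    PowerSeries.coeff n ((powerSeriesAut σ ^ k) f) = (σ ^ k) (PowerSeries.coeff n f) := by
  have : powerSeriesAut σ ^ k = powerSeriesAut (σ ^ k) := ((powerSeriesAutHom C).map_zpow σ k).symm
  rw [this]
  rfl

theorem continuous_powerSeriesAut_zpow (σ : RingAut C) (k : ℤ) :
    Continuous (powerSeriesAut σ ^ k : RingAut (PowerSeries C)) := by
  rw [continuous_iff_continuousAt]
  intro f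
  refine tendsto_powerSeries_of_eventually fun n => ?_
  filter_upwards [eventually_powerSeries_coeff_eq f n] with g hg
  rw [coeff_powerSeriesAut_zpow, coeff_powerSeriesAut_zpow, hg]

theorem summable_powerSeries_of_finite {ι : Type*} {f : ι → PowerSeries C}
    (h : ∀ n : ℕ, {i | PowerSeries.coeff n (f i) ≠ 0}.Finite) : Summable f := by
  refine ⟨PowerSeries.mk fun n => ∑ᶠ i, PowerSeries.coeff n (f i),
    tendsto_powerSeries_of_eventually fun n => ?_⟩
  filter_upwards [eventually_ge_atTop (h n).toFinset] with t ht
  rw [map_sum, PowerSeries.coeff_mk]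
  exact (finsum_eq_sum_of_support_subset _ fun i hi => ht ((h n).mem_toFinset.2 hi)).symm

/-- The factor `X ^ w ℓ` removes all coefficients below `w ℓ`, so each coefficient receives finitely
many contributions. -/
theorem summable_powerSeries_productTerm (σ : RingAut C) {w : ℤ → ℕ}
    (hw : ∀ r, {ℓ | w ℓ ≤ r}.Finite) (m₁ m₂ : ℕ) (κ₁ κ₂ : ℝ) (a b : PowerSeries C) (I : Set ℤ) :
    Summable (I.indicator (productTerm (powerSeriesAut σ) (fun ℓ => PowerSeries.X ^ w ℓ)
      m₁ m₂ κ₁ κ₂ a b)) := by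
  refine summable_powerSeries_of_finite fun n => (hw n).subset ?_
  intro ℓ hx
  by_contra hn
  apply hx
  by_cases hℓ : ℓ ∈ I
  · rw [indicator_of_mem hℓ, productTerm, mul_assoc, PowerSeries.coeff_X_pow_mul']
    exact if_neg hn
  · rw [indicator_of_notMem hℓ, map_zero]

end PowerSeries

/-- The two completed squares give `|x| ≤ x² + 1 / 4` for `x = ℓ + s`, so `x² < M / c` confines `ℓ`
to a bounded interval. -/
theorem finite_sq_lt {c M : ℝ} (hc : 0 < c) (s : ℝ) : {ℓ : ℤ | c * (ℓ + s) ^ 2 < M}.Finite := by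
  refine (finite_Icc ⌈-(M / c + 1) - s⌉ ⌊M / c + 1 - s⌋).subset ?_
  intro ℓ hℓ
  have h1 : ((ℓ : ℝ) + s) ^ 2 < M / c := by
    rw [lt_div_iff₀ hc, mul_comm]; exact hℓ
  refine ⟨Int.ceil_le.2 ?_, Int.le_floor.2 ?_⟩ <;> nlinarith [sq_nonneg ((ℓ : ℝ) + s - 1 / 2),
    sq_nonneg ((ℓ : ℝ) + s + 1 / 2)]

end FField

end

/-! ### Assembly of the absolute and the relative case -/

theorem mainTheorem3 {C : Type*} [CommRing C] (σ : RingAut C)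
    (J : ℝ × ℝ →ₗ[ℝ] ℝ × ℝ) (hJ : FField.IsComplexStructure J)
    (ε : ℝ) (hε : Irrational ε) (m₁ m₂ : ℕ) (hm₁ : 0 < m₁) (hm₂ : 0 < m₂) :
    -- `E` carries `(1/m₁) ℤ × (1/m₂) ℤ` into `(1/(m₁+m₂)) ℤ`
    (∀ k₁ k₂ : ℤ, ∃ k : ℤ,
      FField.E m₁ m₂ ((k₁ : ℝ) / m₁) ((k₂ : ℝ) / m₂) = (k : ℝ) / ((m₁ : ℝ) + m₂)) ∧
    -- the absolute case
    (∀ k₁ < m₁, ∀ k₂ < m₂, ∀ κ₁ κ₂ : ℝ, κ₁ = (k₁ : ℝ) / m₁ → κ₂ = (k₂ : ℝ) / m₂ →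
      ∀ a b : FField.Novikov C,
        FField.Mu2Converges (FField.novikovAut σ) J ε (FField.absWeight σ J _ _ _)
          (FField.gen (FField.novikovAut σ) m₁ (m₁ + m₂) κ₂ b)
          (FField.gen (FField.novikovAut σ) 0 m₁ κ₁ a) ∧
        HasSum
          (fun ℓ : ℤ => FField.gen (FField.novikovAut σ) 0 (m₁ + m₂)
            (FField.E m₁ m₂ κ₁ (κ₂ + ℓ))
            (FField.tPow C ((ℓ + κ₂ - κ₁) ^ 2 / (2 * (1 / (m₁ : ℝ) + 1 / (m₂ : ℝ)))) *
              (FField.novikovAut σ ^ (ℓ - ⌊FField.E m₁ m₂ κ₁ (κ₂ + ℓ)⌋)) b *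
              (FField.novikovAut σ ^ (-⌊FField.E m₁ m₂ κ₁ (κ₂ + ℓ)⌋)) a))
          (FField.mu2 (FField.novikovAut σ) J ε (FField.absWeight σ J _ _ _)
            (FField.gen (FField.novikovAut σ) m₁ (m₁ + m₂) κ₂ b)
            (FField.gen (FField.novikovAut σ) 0 m₁ κ₁ a))) ∧
    -- the relative case, for `D` in the first quadrant and sufficiently close to `(0, 0)`
    (∀ᶠ d : ℝ × ℝ in nhdsWithin (0, 0) (Set.Ioi 0 ×ˢ Set.Ioi 0),
      (FField.proj d ∉ FField.lag 0 ∧ FField.proj d ∉ FField.lag m₁ ∧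
        FField.proj d ∉ FField.lag (m₁ + m₂)) ∧
      ∀ k₁ < m₁, ∀ k₂ < m₂, ∀ κ₁ κ₂ : ℝ, κ₁ = (k₁ : ℝ) / m₁ → κ₂ = (k₂ : ℝ) / m₂ →
        ∃ n : ℤ → ℕ, (∀ ℓ : ℤ, (n ℓ : ℝ) = FField.lam m₁ m₂ κ₁ (κ₂ + ℓ)) ∧
        ∀ a b : PowerSeries C,
          FField.Mu2Converges (FField.powerSeriesAut σ) J ε
            (FField.relWeight σ (FField.proj d) J _ _ _)
            (FField.gen (FField.powerSeriesAut σ) m₁ (m₁ + m₂) κ₂ b)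
            (FField.gen (FField.powerSeriesAut σ) 0 m₁ κ₁ a) ∧
          HasSum
            (fun ℓ : ℤ => FField.gen (FField.powerSeriesAut σ) 0 (m₁ + m₂)
              (FField.E m₁ m₂ κ₁ (κ₂ + ℓ))
              (PowerSeries.X ^ n ℓ *
                (FField.powerSeriesAut σ ^ (ℓ - ⌊FField.E m₁ m₂ κ₁ (κ₂ + ℓ)⌋)) b *
                (FField.powerSeriesAut σ ^ (-⌊FField.E m₁ m₂ κ₁ (κ₂ + ℓ)⌋)) a))
            (FField.mu2 (FField.powerSeriesAut σ) J ε
              (FField.relWeight σ (FField.proj d) J _ _ _)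
              (FField.gen (FField.powerSeriesAut σ) m₁ (m₁ + m₂) κ₂ b)
              (FField.gen (FField.powerSeriesAut σ) 0 m₁ κ₁ a))) := by
  have m1 : (0 : ℝ) < m₁ := by exact_mod_cast hm₁
  have m2 : (0 : ℝ) < m₂ := by exact_mod_cast hm₂
  have hmul : ∀ {m k : ℕ} {κ : ℝ}, 0 < m → κ = (k : ℝ) / m → (m : ℝ) * κ = ((k : ℤ) : ℝ) := by
    intro m k κ hm h
    have : (m : ℝ) ≠ 0 := by exact_mod_cast hm.ne'
    rw [h]
    push_cast
    field_simp
  have hIco : ∀ {m k : ℕ} {κ : ℝ}, 0 < m → k < m → κ = (k : ℝ) / m → κ ∈ Set.Ico (0 : ℝ) 1 := by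
    intro m k κ hm hk h
    have h1 : (0 : ℝ) < m := by exact_mod_cast hm
    have h2 : (k : ℝ) < m := by exact_mod_cast hk
    rw [h]
    exact ⟨by positivity, (div_lt_one h1).2 h2⟩
  refine ⟨fun k₁ k₂ => ⟨k₁ + k₂, ?_⟩, ?_, ?_⟩
  · simp only [FField.E]
    push_cast
    field_simp
  · intro k₁ hk₁ k₂ hk₂ κ₁ κ₂ hκ₁ hκ₂ a b
    exact FField.hasSum_mu2 (σ := FField.novikovAut σ) (FField.continuous_novikovAut_zpow σ) hJ hm₁
      hm₂ (hmul hm₁ hκ₁) (hmul hm₂ hκ₂) (hIco hm₁ hk₁ hκ₁) (hIco hm₂ hk₂ hκ₂) hε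
      (FField.absWeight σ J _ _ _)
      (tp := fun ℓ => FField.tPow C ((ℓ + κ₂ - κ₁) ^ 2 / (2 * (1 / (m₁ : ℝ) + 1 / (m₂ : ℝ)))))
      (fun y S ℓ p q h => congrArg (FField.tPow C) (h.area_eq hJ hm₁ hm₂)) a b
      (FField.summable_novikov_productTerm σ (fun r =>
        (FField.finite_sq_lt (c := 1 / (2 * (1 / (m₁ : ℝ) + 1 / (m₂ : ℝ)))) (M := r) (by positivity)
          (κ₂ - κ₁)).subset fun ℓ (hℓ : _ < r) => by
            refine lt_of_eq_of_lt ?_ hℓ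
            rw [← add_sub_assoc]
            ring) m₁ m₂ κ₁ κ₂ a b)
  -- In the first quadrant this inequality bounds the linear forms of all three circles strictly
  -- between `0` and `1`. It is the only smallness needed, so the neighbourhood depends on `m₁` and
  -- `m₂` alone.
  · have hev : ∀ᶠ d : ℝ × ℝ in nhds (0, 0), d.2 + (m₁ + m₂) * d.1 < 1 := by
      have hc : Continuous fun d : ℝ × ℝ => d.2 + (m₁ + m₂) * d.1 := by fun_prop
      exact hc.continuousAt.eventually_lt continuousAt_const (by simp)
    filter_upwards [nhdsWithin_le_nhds hev, self_mem_nhdsWithin] with d hd hd0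
    obtain ⟨hd1 : 0 < d.1, hd2 : 0 < d.2⟩ := hd0
    refine ⟨⟨?_, ?_, ?_⟩, ?_⟩
    · apply FField.proj_notMem_lag <;> push_cast <;> nlinarith
    · apply FField.proj_notMem_lag <;> push_cast <;> nlinarith
    · apply FField.proj_notMem_lag <;> push_cast <;> nlinarith
    intro k₁ hk₁ k₂ hk₂ κ₁ κ₂ hκ₁ hκ₂
    have hv : ∀ ℓ : ℤ, m₂ * (κ₂ + ℓ) = (((k₂ : ℤ) + m₂ * ℓ : ℤ) : ℝ) := fun ℓ => by
      have := hmul hm₂ hκ₂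
      push_cast at this ⊢
      rw [← this]
      ring
    have hn : ∀ ℓ : ℤ, ((FField.latticePoints m₁ m₂ k₁ (k₂ + m₂ * ℓ)).ncard : ℝ) =
        FField.lam m₁ m₂ κ₁ (κ₂ + ℓ) := fun ℓ =>
      FField.ncard_latticePoints hm₁ hm₂ (hmul hm₁ hκ₁) (hv ℓ)
    -- The exponent is taken to be the number of lattice points, which shows that `lam` is a
    -- nonnegative integer.
    refine ⟨_, hn, fun a b => ?_⟩
    refine FField.hasSum_mu2 (σ := FField.powerSeriesAut σ) (FField.continuous_powerSeriesAut_zpow σ)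
      hJ hm₁ hm₂ (hmul hm₁ hκ₁) (hmul hm₂ hκ₂) (hIco hm₁ hk₁ hκ₁) (hIco hm₂ hk₂ hκ₂) hε
      (FField.relWeight σ (FField.proj d) J _ _ _)
      (tp := fun ℓ => PowerSeries.X ^ (FField.latticePoints m₁ m₂ k₁ (k₂ + m₂ * ℓ)).ncard)
      (fun y S ℓ p q h => ?_) a b
      (FField.summable_powerSeries_productTerm σ (fun r => ?_) m₁ m₂ κ₁ κ₂ a b)
    · refine congrArg (fun n : ℕ => (PowerSeries.X : PowerSeries C) ^ n) ?_
      have := (h.divisorCount_eq hJ hm₁ hm₂ (hmul hm₁ hκ₁) (hmul hm₂ hκ₂) hd1 hd2 hd).trans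
        (hn ℓ).symm
      exact_mod_cast this
    -- The constant `c` is the quadratic coefficient in `le_lam` and `(m₁ + m₂) / 8` its error; the
    -- extra `1` turns the weak inequality into a strict one.
    · refine (FField.finite_sq_lt (c := m₁ * m₂ / (2 * ((m₁ : ℝ) + m₂)))
        (M := r + ((m₁ : ℝ) + m₂) / 8 + 1) (by positivity) (κ₂ - κ₁)).subset fun ℓ hℓ => ?_
      have h1 : ((FField.latticePoints m₁ m₂ k₁ (k₂ + m₂ * ℓ)).ncard : ℝ) ≤ r := by
        exact_mod_cast hℓ
      rw [hn ℓ] at h1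
      have h2 := FField.le_lam (m₂ := m₂) hm₁ κ₁ (κ₂ + ℓ)
      have h3 : (m₁ : ℝ) * m₂ * (κ₁ - (κ₂ + ℓ)) ^ 2 / (2 * (m₁ + m₂)) =
          m₁ * m₂ / (2 * ((m₁ : ℝ) + m₂)) * (ℓ + (κ₂ - κ₁)) ^ 2 := by ring
      rw [h3] at h2
      simp only [Set.mem_ofPred_eq]
      linarith
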